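/- An instance of a generalised arrival problem is $G=(V,E,s,t,\mathcal V,P,\mathit{Ord})$, where $(V,E)$ is a finite directed graph (self-loops allowed) in which every vertex has an out-edge, $s,t\in V$, the only out-edge of $t$ is its self-loop, and $\mathcal V=\{V_R,V_S,V_1,V_2\}$ partitions $V\setminus\{t\}$ (classes may be empty) into random, switching, max player and min player nodes. For $v\in V_R$, $P(v,\cdot)$ is a rational probability distribution on $V$ with $P(v,w)>0$ iff $(v,w)\in E$. For $v\in V_S$, $\mathit{Ord}(v)$ is a finite sequence of vertices whose set of entries is $\{w:(v,w)\in E\}$. A state is a pair $(v,q)$ with $v\in V$ and $q:V_S\to\mathbb N_0$, $q(x)<|\mathit{Ord}(x)|$. A play starts in $(s,q_0)$, $q_0\equiv 0$. From $(v,q)$ it moves as follows: if $v\in V_R$, to $(w,q)$ with probability $P(v,w)$; if $v\in V_S$, to $(\mathit{Ord}(v)_{q(v)},q')$, where $q'$ is $q$ with the entry $q(v)$ replaced by $q(v)+1 \bmod |\mathit{Ord}(v)|$ (positions count from $0$); if $v\in V_1$ or $v\in V_2$, to $(w,q)$ with $(v,w)\in E$, where $w$ is chosen, as a deterministic function of the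 current state, by the strategy $\sigma$ of the max player or $\tau$ of the min player, respectively; at $t$ it stays. The value of $G$ is $$val(G)=\max_{\sigma}\min_{\tau}\mathbb P_{\sigma,\tau}(\text{the play visits } t).$$ For $B\subseteq\{R,S,1,2\}$, a $B$-instance is an instance in which all nonempty classes $V_k$ have $k\in B$. Instances are encoded as strings with $V$, $E$ and the sequences $\mathit{Ord}(v)$ listed explicitly and with rational numbers written as numerator and denominator in binary. Two decision problems are polynomial-time equivalent if each is reducible to the other by a polynomial-time many-one reduction. Proposition. Let $B\subseteq\{R,S,1,2\}$ with $R\in B$. The problem "given a rational $p\in(0,1)$ and a $B$-instance $G$, decide whether $val(G)\ge p$" is polynomial-time equivalent to the problem "given a $B$-instance $G$, decide whether $val(G)>1/2$". Moreover, for every fixed rational $p\in(0,1)$, the problem "given a $B$-instance $G$, decide whether $val(G)\ge p$" is polynomial-time equivalent to the problem "given a $B$-instance $G$, decide whether $val(G)>1/2$". -/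

import Mathlib

open MeasureTheory ProbabilityTheory

/-! ### Arrival instances -/

/-- The four node types `R`, `S`, `1`, `2`. -/
inductive NodeKind : Type
  | random
  | switching
  | maxPlayer
  | minPlayer
  deriving DecidableEq

/-- An instance `(V, E, s, t, 𝒱, P, Ord)` of a generalised arrival problem, with vertex set
`V = Fin n`. The partition `𝒱` of `V - {t}` is given by `kind`, which is `none` exactly at `t`.
The functions `P` (on `V_R`) and `Ord` (on `V_S`) are extended by `0` and `[]` to all of `V`. -/
structure ArrivalInstance : Type where
  n : ℕ
  E : Finset (Fin n × Fin n)
  s : Fin n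
  t : Fin n
  kind : Fin n → Option NodeKind
  P : Fin n → Fin n → ℚ
  Ord : Fin n → List (Fin n)
  exists_out : ∀ v, ∃ w, (v, w) ∈ E
  target_out : ∀ v, (t, v) ∈ E → v = t
  kind_eq_none_iff : ∀ v, kind v = none ↔ v = t
  P_nonneg : ∀ v w, 0 ≤ P v w
  P_sum : ∀ v, kind v = some .random → ∑ w, P v w = 1
  P_pos_iff : ∀ v w, kind v = some .random → (0 < P v w ↔ (v, w) ∈ E)
  P_eq_zero : ∀ v w, kind v ≠ some .random → P v w = 0
  mem_Ord_iff : ∀ v w, kind v = some .switching → (w ∈ Ord v ↔ (v, w) ∈ E)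
  Ord_eq_nil : ∀ v, kind v ≠ some .switching → Ord v = []

namespace ArrivalInstance

variable (G : ArrivalInstance)

/-- The nodes of type `k`. -/
abbrev NodesOf (k : NodeKind) : Type := {v : Fin G.n // G.kind v = some k}

/-- The set `Q` of switching node positions: `q v < |Ord v|` for every switching node `v`. -/
abbrev Position : Type := ∀ v : G.NodesOf .switching, Fin (G.Ord v).length

/-- The state space `V × Q`. -/
abbrev State : Type := Fin G.n × G.Position

theorem Ord_length_pos (v : G.NodesOf .switching) : 0 < (G.Ord v).length := by
  obtain ⟨w, hw⟩ := G.exists_out v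
  exact List.length_pos_of_mem ((G.mem_Ord_iff v w v.2).2 hw)

/-- The initial position `q₀ = 0`. -/
def initialPosition : G.Position := fun v => ⟨0, G.Ord_length_pos v⟩

/-- The initial state `(s, q₀)`. -/
def initialState : G.State := (G.s, G.initialPosition)

/-- The successor of the state `(v, q)` at a switching node `v`: move to `Ord(v)_{q(v)}` and
increase `q(v)` by one modulo `|Ord(v)|`. -/
def switchStep (v : G.NodesOf .switching) (q : G.Position) : G.State :=
  ((G.Ord v).get (q v),
    Function.update q v ⟨((q v : ℕ) + 1) % (G.Ord v).length, Nat.mod_lt _ (G.Ord_length_pos v)⟩)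

/-- The distribution `P(v, ·)` of the next vertex at a random node `v`. -/
noncomputable def randomStep (v : G.NodesOf .random) : PMF (Fin G.n) :=
  PMF.ofFintype (fun w => ENNReal.ofReal (G.P v w : ℝ)) (by
    rw [← ENNReal.ofReal_sum_of_nonneg fun w _ => by exact_mod_cast G.P_nonneg v w,
      ← Rat.cast_sum, G.P_sum v v.2]
    simp)

/-- Deterministic essentially memoryless strategies of the player who owns the nodes of type `k`:
at each state with current vertex of type `k`, choose an out-edge. -/
abbrev Strategy (k : NodeKind) : Type :=
  ∀ x : G.NodesOf k × G.Position, {w : Fin G.n // ((x.1 : Fin G.n), w) ∈ G.E}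

/-- The distribution of the next state under the strategies `σ` and `τ`. -/
noncomputable def stepPMF (σ : G.Strategy .maxPlayer) (τ : G.Strategy .minPlayer)
    (x : G.State) : PMF G.State :=
  match h : G.kind x.1 with
  | none => PMF.pure x
  | some .random => (G.randomStep ⟨x.1, h⟩).map fun w => (w, x.2)
  | some .switching => PMF.pure (G.switchStep ⟨x.1, h⟩ x.2)
  | some .maxPlayer => PMF.pure ((σ (⟨x.1, h⟩, x.2) : Fin G.n), x.2)
  | some .minPlayer => PMF.pure ((τ (⟨x.1, h⟩, x.2) : Fin G.n), x.2)

/-- The one-step transition kernel on the state space. -/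
noncomputable def stepKernel (σ : G.Strategy .maxPlayer) (τ : G.Strategy .minPlayer) :
    Kernel G.State G.State where
  toFun x := (G.stepPMF σ τ x).toMeasure
  measurable' := Measurable.of_discrete

instance (σ : G.Strategy .maxPlayer) (τ : G.Strategy .minPlayer) :
    IsMarkovKernel (G.stepKernel σ τ) :=
  ⟨fun x => inferInstanceAs (IsProbabilityMeasure (G.stepPMF σ τ x).toMeasure)⟩

/-- The probability measure on infinite sequences of states that starts at `(s, q₀)` and follows
the transition law given by `σ` and `τ`. -/
noncomputable def playMeasure (σ : G.Strategy .maxPlayer) (τ : G.Strategy .minPlayer) :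
    Measure (ℕ → G.State) :=
  Kernel.trajMeasure (X := fun _ => G.State) (Measure.dirac G.initialState) fun i =>
    (G.stepKernel σ τ).comap (fun h : (j : Finset.Iic i) → G.State => h ⟨i, by simp⟩)
      (measurable_pi_apply _)

/-- The event that the target is reached. -/
def Reach : Set (ℕ → G.State) := {π | ∃ i, (π i).1 = G.t}

/-- The value `max_σ min_τ ℙ_{σ,τ}(Reach)` (both range over finite nonempty sets). -/
noncomputable def val : ℝ :=
  ⨆ σ : G.Strategy .maxPlayer, ⨅ τ : G.Strategy .minPlayer, (G.playMeasure σ τ).real G.Reach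

end ArrivalInstance

/-- The instances of the generalised `B`-arrival problem. -/
abbrev ArrivalInstanceOf (B : Set NodeKind) : Type :=
  {G : ArrivalInstance // ∀ v k, G.kind v = some k → k ∈ B}

/-! ### Encoding -/

/-- The finite input alphabet. -/
inductive InputSymbol : Type
  | bit (b : Bool)
  | slash
  | tick
  | comma
  | node (k : Option NodeKind)
  | edge
  | ord
  deriving DecidableEq

/-- A nonnegative rational: numerator and denominator in binary. -/
def encodeRat (q : ℚ) : List InputSymbol :=
  (Computability.encodeNat q.num.natAbs).map .bit ++
    .slash :: (Computability.encodeNat q.den).map .bit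

/-- A vertex name. As all the vertices are listed explicitly in the encoding of an instance, unary
vertex names change its length only polynomially. -/
def encodeVertex {n : ℕ} (v : Fin n) : List InputSymbol := List.replicate v .tick

/-- A vertex: its type, its out-edges with their probabilities, and its switching order. -/
def ArrivalInstance.encodeNode (G : ArrivalInstance) (v : Fin G.n) : List InputSymbol :=
  .node (G.kind v) ::
    (((List.finRange G.n).filter fun w => (v, w) ∈ G.E).flatMap fun w =>
      .edge :: (encodeVertex w ++ .comma :: encodeRat (G.P v w))) ++
    (G.Ord v).flatMap fun w => .ord :: encodeVertex w

/-- An instance: start vertex, target vertex, and the list of all vertices. -/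
def ArrivalInstance.encode (G : ArrivalInstance) : List InputSymbol :=
  encodeVertex G.s ++ .comma :: (encodeVertex G.t ++ .comma ::
    (List.finRange G.n).flatMap G.encodeNode)

/-! ### Decision problems and polynomial-time equivalence -/

/-- A decision problem: a type of inputs, how they are written, and the yes-instances. -/
structure DecisionProblem : Type 1 where
  Input : Type
  encode : Input → List InputSymbol
  Yes : Input → Prop

/-- Polynomial-time many-one (Karp) reducibility, over Turing machines. -/
def PolyTimeReducible (A B : DecisionProblem) : Prop :=
  ∃ f : A.Input → B.Input,
    Nonempty (Turing.TM2ComputableInPolyTime A.encode B.encode f) ∧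
      ∀ x, A.Yes x ↔ B.Yes (f x)

/-- Polynomial-time equivalence: reducibility in both directions. -/
def PolyTimeEquivalent (A B : DecisionProblem) : Prop :=
  PolyTimeReducible A B ∧ PolyTimeReducible B A

/-- `B`-Arrival-Quant for the fixed threshold `p`: given `G`, decide whether `val(G) > p`. -/
def arrivalQuant (B : Set NodeKind) (p : ℚ) : DecisionProblem where
  Input := ArrivalInstanceOf B
  encode G := G.1.encode
  Yes G := (p : ℝ) < G.1.val

/-- Fixed threshold `p`: given `G`, decide whether `val(G) ≥ p`. -/
def arrivalQuantEq (B : Set NodeKind) (p : ℚ) : DecisionProblem where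
  Input := ArrivalInstanceOf B
  encode G := G.1.encode
  Yes G := (p : ℝ) ≤ G.1.val

/-- The threshold is part of the input: given a rational `p ∈ (0,1)` and `G`, decide whether
`val(G) ≥ p`. -/
def arrivalQuantEqInput (B : Set NodeKind) : DecisionProblem where
  Input := {p : ℚ // 0 < p ∧ p < 1} × ArrivalInstanceOf B
  encode x := encodeRat x.1 ++ x.2.1.encode
  Yes x := ((x.1 : ℚ) : ℝ) ≤ x.2.1.val

/-! ### Programs for stack machines -/

open Turing

/-! All four reductions use one construction. To an instance G add an entry vertex, which goes to
`s` with probability α and otherwise to a coin that reaches the target with probability π and the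
sink with probability 1 - π. In front of it put a chain of vertices which a play passes completely
only with a tiny probability ε; a play that leaves the chain early goes to the entry vertex. The end
of the chain leads to the target or to the sink, according to the flag `y`. No edge leads back to
the chain from there, so the new value is (1 - ε)(α·val(G) + (1 - α)π) + ε·[y] (`val_reduced`).

For α = 1/2, π = 1 - p and a winning end, the main term is at least 1/2 exactly if val(G) ≥ p, and ε
turns this weak inequality into a strict one. Conversely, if (1 - α)π = p - α/2 and the end is
losing, the main term exceeds p exactly if val(G) > 1/2, and ε rules out the case of equality.

This works if ε is below the distance of val(G) from the threshold. Under optimal strategies the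
play is a finite Markov chain on states, and Cramer's rule for its hitting probabilities bounds the
denominator of val(G) by a product over vertices, raised to the number of switching positions
(`exists_reach_den`). If switching nodes occur, the number of positions can be exponential and the
gap doubly exponentially small. A chain of m + 1 random vertices gives only ε = 2^-(m+1), but then
switching vertices may be used in the chain: sending the play back to the start at every first
visit, they act as a binary counter and give ε = 2^-(2^m). If switching is not allowed in B, there
is a single position and the random chain is small enough (`passProb_le`).

In the extended game the players also see the chain's counters. These stay fixed while the play is
in the copy of G, so for each value of them the play there is a play of G. The max player ignores
them, and the min player answers separately for each value (`IsExtension.exists_max_strategy`,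
`IsExtension.exists_min_strategy`).

Polynomial time is proved by explicit stack programs. The output is written from back to front with
vertex names in unary. The only arithmetic on probabilities is 1 - p, needed when p is part of the
input; it is a binary subtraction with borrow. -/

/-- Change the labels of a statement. -/
def Turing.TM2.Stmt.mapLabel {K : Type} {Γ : K → Type} {Λ Λ' σ : Type} (f : Λ → Λ') :
    TM2.Stmt Γ Λ σ → TM2.Stmt Γ Λ' σ
  | .push k g q => .push k g (mapLabel f q)
  | .peek k g q => .peek k g (mapLabel f q)
  | .pop k g q => .pop k g (mapLabel f q)
  | .load g q => .load g (mapLabel f q)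
  | .branch g q₁ q₂ => .branch g (mapLabel f q₁) (mapLabel f q₂)
  | .goto l => .goto fun v => f (l v)
  | .halt => .halt

theorem Turing.TM2.stepAux_mapLabel {K : Type} [DecidableEq K] {Γ : K → Type} {Λ Λ' σ : Type}
    (f : Λ → Λ') (q : TM2.Stmt Γ Λ σ) (v : σ) (S : ∀ k, List (Γ k)) :
    TM2.stepAux (q.mapLabel f) v S =
      ⟨(TM2.stepAux q v S).l.map f, (TM2.stepAux q v S).var, (TM2.stepAux q v S).stk⟩ := by
  induction q generalizing v S with
  | push k g q ih => simp [TM2.Stmt.mapLabel, ih]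
  | peek k g q ih => simp [TM2.Stmt.mapLabel, ih]
  | pop k g q ih => simp [TM2.Stmt.mapLabel, ih]
  | load g q ih => simp [TM2.Stmt.mapLabel, ih]
  | branch g q₁ q₂ ih₁ ih₂ =>
    simp only [TM2.Stmt.mapLabel, TM2.stepAux, ih₁, ih₂]
    cases g v <;> rfl
  | goto l => simp [TM2.Stmt.mapLabel]
  | halt => simp [TM2.Stmt.mapLabel]

/-- A program fragment for a machine whose stacks, indexed by `K`, hold symbols of `Γ`. The label
`none` is the exit. The local variable holds the last symbol that was popped. -/
structure StackProgram (K Γ : Type) where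
  Λ : Type
  fintypeΛ : Fintype Λ
  entry : Λ
  code : Λ → TM2.Stmt (fun _ : K => Γ) (Option Λ) (Option Γ)

namespace StackProgram

variable {K Γ : Type} [DecidableEq K]

/-- From the given label, the program reaches its exit in at most the given number of steps and
changes the stacks from `S` to `S'`. -/
inductive RunsFrom (F : StackProgram K Γ) :
    F.Λ → Option Γ → (K → List Γ) → (K → List Γ) → ℕ → Prop
  | exit {a v v' S S'} (n : ℕ) (h : TM2.stepAux (F.code a) v S = ⟨some none, v', S'⟩) :
      RunsFrom F a v S S' (n + 1)
  | next {a b v v₁ S S₁ S'} {n : ℕ}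
      (h : TM2.stepAux (F.code a) v S = ⟨some (some b), v₁, S₁⟩)
      (h' : RunsFrom F b v₁ S₁ S' n) : RunsFrom F a v S S' (n + 1)

/-- The program transforms the stacks `S` into `S'` in at most `n` steps. -/
def Runs (F : StackProgram K Γ) (S S' : K → List Γ) (n : ℕ) : Prop :=
  ∀ v, F.RunsFrom F.entry v S S' n

theorem RunsFrom.mono {F : StackProgram K Γ} {a v S S' n m} (h : F.RunsFrom a v S S' n)
    (hnm : n ≤ m) : F.RunsFrom a v S S' m := by
  induction h generalizing m with
  | exit n h =>
    obtain ⟨m, rfl⟩ : ∃ k, m = k + 1 := ⟨m - 1, by omega⟩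
    exact .exit m h
  | next h _ ih =>
    obtain ⟨m, rfl⟩ : ∃ k, m = k + 1 := ⟨m - 1, by omega⟩
    exact .next h (ih (by omega))

theorem Runs.mono {F : StackProgram K Γ} {S S' n m} (h : F.Runs S S' n) (hnm : n ≤ m) :
    F.Runs S S' m := fun v => (h v).mono hnm

theorem Runs.conv {F : StackProgram K Γ} {S S₁ S' n m} (h : F.Runs S S₁ n) (hS : S₁ = S')
    (hnm : n ≤ m) : F.Runs S S' m := hS ▸ h.mono hnm

/-- Push a list of symbols, the head of the list last. -/
def pushStmt {Λ σ : Type} (k : K) : List Γ → TM2.Stmt (fun _ : K => Γ) Λ σ →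
    TM2.Stmt (fun _ : K => Γ) Λ σ
  | [], q => q
  | a :: l, q => pushStmt k l (.push k (fun _ => a) q)

theorem stepAux_pushStmt {Λ σ : Type} (k : K) (l : List Γ)
    (q : TM2.Stmt (fun _ : K => Γ) Λ σ) (v : σ) (S : K → List Γ) :
    TM2.stepAux (pushStmt k l q) v S = TM2.stepAux q v (Function.update S k (l ++ S k)) := by
  induction l generalizing q with
  | nil => simp [pushStmt]
  | cons a l ih => simp [pushStmt, ih]

/-- Push a list of symbols. -/
def push (k : K) (l : List Γ) : StackProgram K Γ where
  Λ := Unit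
  fintypeΛ := inferInstance
  entry := ()
  code _ := pushStmt k l (.goto fun _ => none)

theorem push_runs (k : K) (l : List Γ) (S : K → List Γ) :
    (push k l).Runs S (Function.update S k (l ++ S k)) 1 := fun v => by
  refine .exit (v' := v) 0 ?_
  simp [push, stepAux_pushStmt]

/-- Run one program after the other. -/
def seq (F G : StackProgram K Γ) : StackProgram K Γ where
  Λ := F.Λ ⊕ G.Λ
  fintypeΛ := have := F.fintypeΛ; have := G.fintypeΛ; inferInstance
  entry := .inl F.entry
  code
    | .inl a => (F.code a).mapLabel fun o => some (o.elim (.inr G.entry) .inl)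
    | .inr b => (G.code b).mapLabel fun o => o.map .inr

theorem RunsFrom.seq_right {F G : StackProgram K Γ} {b v S S' n} (h : G.RunsFrom b v S S' n) :
    (seq F G).RunsFrom (.inr b) v S S' n := by
  induction h with
  | exit n h => exact .exit n (by simp only [seq, TM2.stepAux_mapLabel, h]; rfl)
  | next h _ ih => exact .next (by simp only [seq, TM2.stepAux_mapLabel, h]; rfl) ih

/-- The exit of `F` becomes a jump to the entry of `G` and costs no extra step. The local variable
left by `F` is arbitrary, which is why `Runs` quantifies over its initial value. -/
theorem RunsFrom.seq {F G : StackProgram K Γ} {a v S S₁ S' n m} (h : F.RunsFrom a v S S₁ n)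
    (h' : G.Runs S₁ S' m) : (seq F G).RunsFrom (.inl a) v S S' (n + m) := by
  induction h with
  | @exit a v v' S S' n h =>
    refine (RunsFrom.next (b := Sum.inr G.entry) (n := m) ?_ (h' v').seq_right).mono (by omega)
    · simp only [StackProgram.seq, TM2.stepAux_mapLabel, h]; rfl
  | @next a b v v₁ S S₁ S₂ n h _ ih =>
    refine (RunsFrom.next (b := Sum.inl b) ?_ (ih h')).mono (by omega)
    · simp only [StackProgram.seq, TM2.stepAux_mapLabel, h]; rfl

theorem Runs.seq {F G : StackProgram K Γ} {S S₁ S' n m} (h : F.Runs S S₁ n)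
    (h' : G.Runs S₁ S' m) : (seq F G).Runs S S' (n + m) := fun v => (h v).seq h'

/-- Pop a symbol, if there is one, and go on with a program that depends on it. -/
def branch [Fintype Γ] (k : K) (body : Option Γ → StackProgram K Γ) : StackProgram K Γ where
  Λ := Unit ⊕ Σ o, (body o).Λ
  fintypeΛ := have := fun o => (body o).fintypeΛ; inferInstance
  entry := .inl ()
  code
    | .inl _ => .pop k (fun _ o => o) (.goto fun v => some (.inr ⟨v, (body v).entry⟩))
    | .inr ⟨o, b⟩ => ((body o).code b).mapLabel fun l => l.map fun c => .inr ⟨o, c⟩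

theorem branch_runs [Fintype Γ] {k : K} {body : Option Γ → StackProgram K Γ} {S S' n}
    (h : (body (S k).head?).Runs (Function.update S k (S k).tail) S' n) :
    (branch k body).Runs S S' (n + 1) := by
  intro v
  have key : ∀ {o b v S S' n}, (body o).RunsFrom b v S S' n →
      (branch k body).RunsFrom (.inr ⟨o, b⟩) v S S' n := by
    intro o b v S S' n h
    induction h with
    | exit n h => exact .exit n (by simp only [branch, TM2.stepAux_mapLabel, h]; rfl)
    | next h _ ih => exact .next (by simp only [branch, TM2.stepAux_mapLabel, h]; rfl) ih
  exact .next (b := Sum.inr ⟨(S k).head?, (body (S k).head?).entry⟩) (v₁ := (S k).head?)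
    (by simp only [branch, TM2.stepAux]) (key (h _))

/-- Pop symbols until the stack is empty or one of the symbols in `isFinal` was popped, and run a
program for each other symbol. -/
def loop [Fintype Γ] (k : K) (isFinal : Γ → Bool) (body : Γ → StackProgram K Γ) :
    StackProgram K Γ where
  Λ := Unit ⊕ Σ a, (body a).Λ
  fintypeΛ := have := fun a => (body a).fintypeΛ; inferInstance
  entry := .inl ()
  code
    | .inl _ => .pop k (fun _ o => o) (.goto fun v =>
        v.elim none fun a => if isFinal a then none else some (.inr ⟨a, (body a).entry⟩))
    | .inr ⟨a, b⟩ => ((body a).code b).mapLabel fun l =>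
        some (l.elim (.inl ()) fun c => .inr ⟨a, c⟩)

section loop

variable [Fintype Γ] {k : K} {isFinal : Γ → Bool} {body : Γ → StackProgram K Γ}

theorem loop_nil {S : K → List Γ} (h : S k = []) : (loop k isFinal body).Runs S S 1 := fun v =>
  .exit (v' := none) 0 (by
    have : Function.update S k [] = S := by rw [← h, Function.update_eq_self]
    simp [loop, h, this])

theorem loop_final {S : K → List Γ} {a l} (h : S k = a :: l) (ha : isFinal a = true) :
    (loop k isFinal body).Runs S (Function.update S k l) 1 := fun v =>
  .exit (v' := some a) 0 (by simp [loop, h, ha])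

/-- Unrolls the loop once: one step for the pop, then the body, whose exit is redirected to the head
of the loop. Running times of loops follow by induction on the contents of the stack. -/
theorem loop_cons {S S₁ S' : K → List Γ} {a l n m} (h : S k = a :: l) (ha : isFinal a = false)
    (h₁ : (body a).Runs (Function.update S k l) S₁ n) (h₂ : (loop k isFinal body).Runs S₁ S' m) :
    (loop k isFinal body).Runs S S' (1 + n + m) := by
  intro v
  have key : ∀ {b v S n}, (body a).RunsFrom b v S S₁ n →
      (loop k isFinal body).RunsFrom (.inr ⟨a, b⟩) v S S' (n + m) := by
    intro b v S n h
    generalize hS : S₁ = S₂ at h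
    induction h with
    | @exit a' v v' S S' n h =>
      subst hS
      refine (RunsFrom.next (b := Sum.inl ()) (n := m) ?_ (h₂ v')).mono (by omega)
      simp only [loop, TM2.stepAux_mapLabel, h]; rfl
    | @next a' b v v₁ S S₁ S₂ n h _ ih =>
      refine (RunsFrom.next (b := Sum.inr ⟨a, b⟩) ?_ (ih hS)).mono (by omega)
      simp only [loop, TM2.stepAux_mapLabel, h]; rfl
  refine (RunsFrom.next (b := Sum.inr ⟨a, (body a).entry⟩) (v₁ := some a) ?_
    (key (h₁ _))).mono (by omega)
  simp [loop, h, ha]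

end loop

/-- The machine that runs a program. -/
def machine [Fintype K] [Fintype Γ] (F : StackProgram K Γ) (kin kout : K) : FinTM2 where
  K := K
  k₀ := kin
  k₁ := kout
  Γ _ := Γ
  Λ := Option F.Λ
  main := some F.entry
  ΛFin := have := F.fintypeΛ; inferInstance
  σ := Option Γ
  initialState := none
  m
    | none => .load (fun _ => none) .halt
    | some a => F.code a

theorem machine_step [Fintype K] [Fintype Γ] (F : StackProgram K Γ) (kin kout : K) (a v S) :
    flip bind (F.machine kin kout).step
      (some (⟨some (some a), v, S⟩ : TM2.Cfg (fun _ : K => Γ) (Option F.Λ) (Option Γ))) =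
      some (TM2.stepAux (F.code a) v S) := rfl

/-- The additional step is spent at the label `none`, which resets the local variable: a halting
configuration must hold its initial value. -/
theorem RunsFrom.evals [Fintype K] [Fintype Γ] {F : StackProgram K Γ} {kin kout : K}
    {a v S S' n} (h : F.RunsFrom a v S S' n) :
    ∃ m ≤ n + 1, (flip bind (F.machine kin kout).step)^[m]
      (some (⟨some (some a), v, S⟩ : TM2.Cfg (fun _ : K => Γ) (Option F.Λ) (Option Γ))) =
      some (⟨none, none, S'⟩ : TM2.Cfg (fun _ : K => Γ) (Option F.Λ) (Option Γ)) := by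
  induction h with
  | @exit a v v' S S' n h =>
    refine ⟨2, by omega, ?_⟩
    rw [Function.iterate_succ_apply, machine_step, h]
    rfl
  | @next a b v v₁ S S₁ S' n h _ ih =>
    obtain ⟨m, hm, e⟩ := ih
    refine ⟨m + 1, by omega, ?_⟩
    rw [Function.iterate_succ_apply, ← e, machine_step, h]
    rfl

/-- A program that transforms every input into the right output within a polynomial number of steps
computes in polynomial time. -/
theorem computableInPolyTime [Fintype K] [Fintype Γ] {α β : Type} {ea : α → List Γ}
    {eb : β → List Γ} {f : α → β} (F : StackProgram K Γ) (kin kout : K) (time : Polynomial ℕ)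
    (h : ∀ a, F.Runs (Function.update (fun _ => []) kin (ea a))
      (Function.update (fun _ => []) kout (eb (f a))) (time.eval (ea a).length)) :
    Nonempty (TM2ComputableInPolyTime ea eb f) := by
  refine ⟨{
    tm := F.machine kin kout
    inputAlphabet := Equiv.refl Γ
    outputAlphabet := Equiv.refl Γ
    time := time + 1
    outputsFun := fun a => Classical.choice ?_ }⟩
  obtain ⟨m, hm, e⟩ := (h a none).evals (kin := kin) (kout := kout)
  refine ⟨⟨⟨m, ?_⟩, by simpa using hm⟩⟩
  have e₁ : initList (F.machine kin kout) (List.map (Equiv.refl Γ).invFun (ea a)) =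
      (⟨some (some F.entry), none, Function.update (fun _ => []) kin (ea a)⟩ :
        TM2.Cfg (fun _ : K => Γ) (Option F.Λ) (Option Γ)) := by
    unfold initList
    congr 1
    funext k
    by_cases hk : k = kin
    · refine (dif_pos hk).trans ?_
      have h' : Function.update (fun _ : K => ([] : List Γ)) kin (ea a) k = ea a := by
        rw [show (k : K) = kin from hk]; exact Function.update_self _ _ _
      exact (List.map_id _).trans h'.symm
    · refine (dif_neg hk).trans ?_
      exact (Function.update_of_ne (f := fun _ : K => ([] : List Γ)) hk _).symm
  have e₂ : haltList (F.machine kin kout) (List.map (Equiv.refl Γ).invFun (eb (f a))) =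
      (⟨none, none, Function.update (fun _ => []) kout (eb (f a))⟩ :
        TM2.Cfg (fun _ : K => Γ) (Option F.Λ) (Option Γ)) := by
    unfold haltList
    congr 1
    funext k
    by_cases hk : k = kout
    · refine (dif_pos hk).trans ?_
      have h' : Function.update (fun _ : K => ([] : List Γ)) kout (eb (f a)) k = eb (f a) := by
        rw [show (k : K) = kout from hk]; exact Function.update_self _ _ _
      exact (List.map_id _).trans h'.symm
    · refine (dif_neg hk).trans ?_
      exact (Function.update_of_ne (f := fun _ : K => ([] : List Γ)) hk _).symm
  rw [Option.map_some]
  erw [e₁, e₂]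
  exact e

end StackProgram

/-! ### The machine that writes the reduced instance -/

instance : Fintype NodeKind where
  elems := {.random, .switching, .maxPlayer, .minPlayer}
  complete k := by cases k <;> simp

/-- The input symbols as a sum of finite types. -/
def InputSymbol.equivSum : InputSymbol ≃ Bool ⊕ Option NodeKind ⊕ Fin 5 where
  toFun
    | .bit b => .inl b
    | .node k => .inr (.inl k)
    | .slash => .inr (.inr 0)
    | .tick => .inr (.inr 1)
    | .comma => .inr (.inr 2)
    | .edge => .inr (.inr 3)
    | .ord => .inr (.inr 4)
  invFun
    | .inl b => .bit b
    | .inr (.inl k) => .node k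
    | .inr (.inr 0) => .slash
    | .inr (.inr 1) => .tick
    | .inr (.inr 2) => .comma
    | .inr (.inr 3) => .edge
    | .inr (.inr 4) => .ord
  left_inv x := by cases x <;> rfl
  right_inv x := by
    rcases x with b | k | i
    · rfl
    · rfl
    · fin_cases i <;> rfl

instance : Fintype InputSymbol := Fintype.ofEquiv _ InputSymbol.equivSum.symm

/-- The stacks of the machine. -/
inductive Reg : Type
  | inp | out | s | t | n | m | c | tmp | w1 | w2 | rest | b | d
  deriving DecidableEq

instance : Fintype Reg where
  elems := {.inp, .out, .s, .t, .n, .m, .c, .tmp, .w1, .w2, .rest, .b, .d}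
  complete k := by cases k <;> simp

/-- The contents of the stacks. -/
structure Regs : Type where
  (inp out s t n m c tmp w1 w2 rest b d : List InputSymbol)

/-- The contents of the stacks as a function. -/
def Regs.get (r : Regs) : Reg → List InputSymbol
  | .inp => r.inp
  | .out => r.out
  | .s => r.s
  | .t => r.t
  | .n => r.n
  | .m => r.m
  | .c => r.c
  | .tmp => r.tmp
  | .w1 => r.w1
  | .w2 => r.w2
  | .rest => r.rest
  | .b => r.b
  | .d => r.d

namespace Regs

variable (r : Regs) (l : List InputSymbol)

theorem update_inp : Function.update r.get .inp l = { r with inp := l }.get := by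
  funext k; cases k <;> rfl
theorem update_out : Function.update r.get .out l = { r with out := l }.get := by
  funext k; cases k <;> rfl
theorem update_s : Function.update r.get .s l = { r with s := l }.get := by
  funext k; cases k <;> rfl
theorem update_t : Function.update r.get .t l = { r with t := l }.get := by
  funext k; cases k <;> rfl
theorem update_n : Function.update r.get .n l = { r with n := l }.get := by
  funext k; cases k <;> rfl
theorem update_m : Function.update r.get .m l = { r with m := l }.get := by
  funext k; cases k <;> rfl
theorem update_c : Function.update r.get .c l = { r with c := l }.get := by
  funext k; cases k <;> rfl
theorem update_tmp : Function.update r.get .tmp l = { r with tmp := l }.get := by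
  funext k; cases k <;> rfl
theorem update_w1 : Function.update r.get .w1 l = { r with w1 := l }.get := by
  funext k; cases k <;> rfl
theorem update_w2 : Function.update r.get .w2 l = { r with w2 := l }.get := by
  funext k; cases k <;> rfl
theorem update_rest : Function.update r.get .rest l = { r with rest := l }.get := by
  funext k; cases k <;> rfl
theorem update_b : Function.update r.get .b l = { r with b := l }.get := by
  funext k; cases k <;> rfl
theorem update_d : Function.update r.get .d l = { r with d := l }.get := by
  funext k; cases k <;> rfl

end Regs

/-- A unary number. -/
abbrev ticks (k : ℕ) : List InputSymbol := List.replicate k .tick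

/-! ### Basic operations on the stacks: moving, clearing, copying, writing pieces of output -/

namespace StackProgram

/-- Move the contents of a stack to another one, in reverse order. -/
def move (k dst : Reg) : StackProgram Reg InputSymbol :=
  loop k (fun _ => false) fun a => push dst [a]

theorem move_runs {k dst : Reg} (hk : k ≠ dst) (S : Reg → List InputSymbol) :
    (move k dst).Runs S (Function.update (Function.update S dst ((S k).reverse ++ S dst)) k [])
      (2 * (S k).length + 1) := by
  generalize h : S k = l
  induction l generalizing S with
  | nil =>
    have : Function.update (Function.update S dst (([] : List InputSymbol).reverse ++ S dst)) k [] =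
        S := by
      rw [List.reverse_nil, List.nil_append, Function.update_eq_self, ← h, Function.update_eq_self]
    rw [this]
    exact loop_nil h
  | cons a l ih =>
    refine (loop_cons h rfl (push_runs _ _ _) (ih _ ?_)).conv ?_ (by simp; omega)
    · simp [hk]
    · funext j
      by_cases h₁ : j = k
      · subst h₁; simp
      · by_cases h₂ : j = dst
        · subst h₂; simp [h₁]
        · simp [h₁, h₂]

/-- Empty a stack. -/
def clear (k : Reg) : StackProgram Reg InputSymbol :=
  loop k (fun _ => false) fun _ => push k []

theorem clear_runs {k : Reg} (S : Reg → List InputSymbol) :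
    (clear k).Runs S (Function.update S k []) (2 * (S k).length + 1) := by
  generalize h : S k = l
  induction l generalizing S with
  | nil =>
    have : Function.update S k [] = S := by simp [← h]
    rw [this]
    exact loop_nil h
  | cons a l ih =>
    refine (loop_cons h rfl (push_runs _ _ _) (ih _ ?_)).conv ?_ (by simp; omega)
    · simp
    · simp

/-- Write the unary number on the stack `k` on top of `dst` as well. -/
def copy (k dst : Reg) : StackProgram Reg InputSymbol :=
  seq (loop k (fun _ => false) fun _ => seq (push dst [.tick]) (push .tmp [.tick])) (move .tmp k)

/-- Reading a stack destroys it, so a second copy goes to `tmp` and is moved back. Reversal is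
harmless for unary numbers. Each tick costs three steps on the way out and two on the way back. -/
theorem copy_runs {k dst : Reg} (hk : k ≠ dst) (hk' : k ≠ .tmp) (hd : dst ≠ .tmp)
    {S : Reg → List InputSymbol} {j : ℕ} (h : S k = ticks j) (ht : S .tmp = []) :
    (copy k dst).Runs S (Function.update S dst (ticks j ++ S dst)) (5 * j + 2) := by
  have key : ∀ (j : ℕ) (S : Reg → List InputSymbol), S k = ticks j →
      (loop k (fun _ => false) fun _ => seq (push dst [.tick]) (push .tmp [.tick])).Runs S
        (Function.update (Function.update (Function.update S dst (ticks j ++ S dst)) .tmp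
          (ticks j ++ S .tmp)) k []) (3 * j + 1) := by
    intro j
    induction j with
    | zero =>
      intro S h
      have : Function.update (Function.update (Function.update S dst (ticks 0 ++ S dst)) .tmp
          (ticks 0 ++ S .tmp)) k [] = S := by
        rw [show ([] : List InputSymbol) = S k from h.symm]
        simp
      rw [this]
      exact loop_nil h
    | succ j ih =>
      intro S h
      refine (loop_cons h rfl ((push_runs _ _ _).seq (push_runs _ _ _)) (ih _ ?_)).conv ?_
        (by omega)
      · simp [hk, hk']
      · funext i
        have e : ∀ l : List InputSymbol, ticks j ++ .tick :: l = .tick :: (ticks j ++ l) := by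
          intro l
          rw [← List.cons_append, ← List.replicate_succ, List.replicate_succ', List.append_assoc]
          rfl
        by_cases h₁ : i = k
        · subst h₁; simp
        · by_cases h₂ : i = dst
          · subst h₂
            simp [h₁, hd, List.replicate_succ, e]
          · by_cases h₃ : i = .tmp
            · subst h₃
              simp [h₁, h₂, List.replicate_succ, e]
            · simp [h₁, h₂, h₃]
  refine ((key j S h).seq (move_runs hk'.symm _)).conv ?_ ?_
  · funext i
    by_cases h₁ : i = k
    · subst h₁; simp [hk', h, hk'.symm, ht, hk]
    · by_cases h₃ : i = .tmp
      · subst h₃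
        simp [hd.symm, ht]
      · by_cases h₂ : i = dst
        · subst h₂
          simp [h₁, hd]
        · simp [h₁, h₂, h₃]
  · simp [ht, hk'.symm]; omega

/-- A piece of output: a fixed string, or the unary number on a stack. -/
inductive Piece : Type
  | const (l : List InputSymbol)
  | copy (k : Reg)

/-- The string for a piece of output. -/
def Piece.content (S : Reg → List InputSymbol) : Piece → List InputSymbol
  | .const l => l
  | .copy k => S k

/-- The piece can be written: fixed strings always can, other stacks have to hold unary numbers. -/
def Piece.Valid (S : Reg → List InputSymbol) : Piece → Prop
  | .const _ => True
  | .copy k => k ≠ .out ∧ k ≠ .tmp ∧ ∃ j, S k = ticks j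

/-- Write pieces of output. -/
def emit : List Piece → StackProgram Reg InputSymbol
  | [] => push .out []
  | .const l :: ps => seq (emit ps) (push .out l)
  | .copy k :: ps => seq (emit ps) (copy k .out)

/-- The output stack grows at its head, so the last piece is written first. The same holds for all
later writing programs. -/
theorem emit_runs (ps : List Piece) {S : Reg → List InputSymbol} (ht : S .tmp = [])
    (hps : ∀ p ∈ ps, p.Valid S) :
    (emit ps).Runs S (Function.update S .out (ps.flatMap (Piece.content S) ++ S .out))
      (5 * (ps.flatMap (Piece.content S)).length + 2 * ps.length + 1) := by
  induction ps with
  | nil => exact (push_runs _ _ _).mono (by simp)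
  | cons p ps ih =>
    have ih := ih fun q hq => hps q (List.mem_cons_of_mem _ hq)
    have hp := hps p List.mem_cons_self
    cases p with
    | const l =>
      have := (ih.seq (push_runs .out l _))
      simp only [Function.update_idem, Function.update_self] at this
      refine this.conv (by simp [Piece.content]) (by simp; omega)
    | copy k =>
      obtain ⟨h₁, h₂, j, hj⟩ := hp
      have := ih.seq (copy_runs (dst := .out) h₁ h₂ (by decide) (j := j) (by simp [h₁, hj])
        (by simp [ht]))
      simp only [Function.update_idem, Function.update_self] at this
      exact this.conv (by simp [Piece.content, hj]) (by simp [Piece.content, hj]; omega)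

end StackProgram

/-- The shape of a new vertex: a random vertex with one out-edge, a random vertex with two
out-edges, the first of which has probability `p`, or a switching vertex with two out-edges. -/
inductive Row : Type
  | one (a : ℕ)
  | two (a b : ℕ) (p : ℚ)
  | sw (a b : ℕ)

/-- An edge to the vertex `a` with probability `q`. -/
def encodeEdge (a : ℕ) (q : ℚ) : List InputSymbol :=
  .edge :: (ticks a ++ .comma :: encodeRat q)

/-- The encoding of a new vertex. -/
def Row.encode : Row → List InputSymbol
  | .one a => .node (some .random) :: encodeEdge a 1
  | .two a b p => .node (some .random) :: (encodeEdge a p ++ encodeEdge b (1 - p))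
  | .sw a b => .node (some .switching) ::
      (encodeEdge a 0 ++ encodeEdge b 0 ++ .ord :: ticks a ++ .ord :: ticks b)

/-- A vertex of the chain behind `n + 3` that leads on to the vertex `b`. -/
def Row.chain (sw : Bool) (n b : ℕ) : Row :=
  if sw then .sw (n + 3) b else .two n b (1 / 2)

/-! ### Reading the instance and writing the new vertices -/

namespace StackProgram

/-- The number of vertices in an encoded list of vertices. -/
def nodeCount (l : List InputSymbol) : ℕ :=
  l.countP fun a => match a with | .node _ => true | _ => false

theorem ticks_append (i j : ℕ) (l : List InputSymbol) :
    ticks i ++ (ticks j ++ l) = ticks (i + j) ++ l := by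
  rw [← List.append_assoc, List.replicate_append_replicate]

/-- Read the target. -/
def readTarget : StackProgram Reg InputSymbol :=
  loop .inp (fun a => decide (a = .comma)) fun _ => push .t [.tick]

theorem readTarget_runs (j : ℕ) (l : List InputSymbol) (r : Regs)
    (h : r.inp = ticks j ++ .comma :: l) :
    readTarget.Runs r.get { r with inp := l, t := ticks j ++ r.t }.get (2 * j + 1) := by
  induction j generalizing r with
  | zero =>
    have := loop_final (k := Reg.inp) (isFinal := fun a => decide (a = InputSymbol.comma))
      (body := fun _ => push Reg.t [.tick]) (S := r.get) (a := .comma) (l := l)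
      (by simp [Regs.get, h])
      (by simp)
    rw [Regs.update_inp] at this
    simpa [readTarget] using this
  | succ j ih =>
    have h₁ := push_runs Reg.t [.tick] { r with inp := ticks j ++ InputSymbol.comma :: l }.get
    rw [Regs.update_t] at h₁
    have h₂ := ih _ (show ({ r with
      inp := ticks j ++ InputSymbol.comma :: l
      t := InputSymbol.tick :: r.t } : Regs).inp
      = _ from rfl)
    refine (loop_cons (k := Reg.inp) (a := .tick) (l := ticks j ++ .comma :: l)
      (by simp [Regs.get, h, List.replicate_succ]) (by simp)
      (by rw [Regs.update_inp]; exact h₁) h₂).conv ?_ (by omega)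
    congr 2
    exact ticks_append j 1 r.t

theorem nodeCount_cons (a : InputSymbol) (l : List InputSymbol) :
    nodeCount (a :: l) = nodeCount l + nodeCount [a] := by
  rw [show a :: l = [a] ++ l from rfl]
  simp only [nodeCount, List.countP_append, add_comm]

/-- Read the vertices. -/
def readNodes : StackProgram Reg InputSymbol :=
  loop .inp (fun _ => false) fun a => seq (push .rest [a]) (seq (push .m (ticks 2))
    (push .n (ticks (nodeCount [a]))))

/-- One pass saves the vertex list (reversed), counts the vertices in `n`, and adds two ticks per
symbol to `m`. The result in `m` is the length of the chain, twice the length of the list plus what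
was on `m` before. -/
theorem readNodes_runs (l : List InputSymbol) (r : Regs) (h : r.inp = l) :
    readNodes.Runs r.get { r with
      inp := []
      rest := l.reverse ++ r.rest
      m := ticks (2 * l.length) ++ r.m
      n := ticks (nodeCount l) ++ r.n }.get (4 * l.length + 1) := by
  induction l generalizing r with
  | nil =>
    refine (loop_nil (by exact h)).conv ?_ le_rfl
    congr 1
    cases r
    simp_all [nodeCount]
  | cons a l ih =>
    have h₁ := ((push_runs Reg.rest [a] { r with inp := l }.get).seq
      ((push_runs .m (ticks 2) _).seq (push_runs .n (ticks (nodeCount [a])) _)))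
    simp only [Regs.update_rest, Regs.update_m, Regs.update_n] at h₁
    refine (loop_cons (a := a) (l := l) (by exact h) rfl
      (by rw [Regs.update_inp]; exact h₁) (ih _ rfl)).conv ?_ (by simp; omega)
    congr 1
    simp only [Regs.get, ticks_append, Regs.mk.injEq, true_and]
    refine ⟨?_, ?_, ?_⟩
    · rw [nodeCount_cons a l]
    · simp; ring_nf
    · simp

/-- The pieces of a vertex of the chain, with the next vertex on the stack `c`. -/
def chainPieces : Bool → List Piece
  | false => [.const [.node (some .random), .edge], .copy .n,
      .const (.comma :: encodeRat (1 / 2) ++ [.edge]), .copy .c,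
      .const (.comma :: encodeRat (1 / 2))]
  | true => [.const (.node (some .switching) :: .edge :: ticks 3), .copy .n,
      .const (.comma :: encodeRat 0 ++ [.edge]), .copy .c,
      .const (.comma :: encodeRat 0 ++ .ord :: ticks 3), .copy .n, .const [.ord], .copy .c]

theorem chainPieces_content (sw : Bool) (r : Regs) {n b : ℕ} (hn : r.n = ticks n)
    (hc : r.c = ticks b) :
    (chainPieces sw).flatMap (Piece.content r.get) = (Row.chain sw n b).encode := by
  cases sw
  · simp only [chainPieces, List.flatMap_cons, List.flatMap_nil, Piece.content, Regs.get, hn, hc,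
      Row.chain, Row.encode, encodeEdge]
    norm_num
  · simp only [chainPieces, List.flatMap_cons, List.flatMap_nil, Piece.content, Regs.get, hn, hc,
      Row.chain, Row.encode, encodeEdge]
    simp [ticks_append, add_comm 3 n]

theorem emit_regs_runs (ps : List Piece) (r : Regs) (ht : r.tmp = [])
    (hps : ∀ p ∈ ps, p.Valid r.get) {l : List InputSymbol}
    (hl : ps.flatMap (Piece.content r.get) = l) :
    (emit ps).Runs r.get { r with out := l ++ r.out }.get
      (5 * l.length + 2 * ps.length + 1) := by
  have := emit_runs ps (S := r.get) ht hps
  rw [hl, Regs.update_out] at this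
  exact this

theorem emit_chainPieces_runs (sw : Bool) (r : Regs) {n b : ℕ} (hn : r.n = ticks n)
    (hc : r.c = ticks b) (ht : r.tmp = []) :
    (emit (chainPieces sw)).Runs r.get
      { r with out := (Row.chain sw n b).encode ++ r.out }.get (10 * (n + b) + 200) := by
  refine (emit_regs_runs _ r ht ?_ (chainPieces_content sw r hn hc)).mono ?_
  · cases sw <;> simp [chainPieces, Piece.Valid, Regs.get, hn, hc]
  · have h0 : (encodeRat 0).length = 2 := rfl
    have h1 : (encodeRat 2⁻¹).length = 4 := by decide +kernel
    cases sw
    · simp [chainPieces, Row.chain, Row.encode, encodeEdge,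
        show (1 : ℚ) - 2⁻¹ = 2⁻¹ by norm_num, h1]
      omega
    · simp [chainPieces, Row.chain, Row.encode, encodeEdge, h0]
      omega

/-- Write the vertices of the chain. -/
def writeChain (sw : Bool) : StackProgram Reg InputSymbol :=
  loop .m (fun _ => false) fun _ => seq (emit (chainPieces sw)) (branch .c fun _ => push .out [])

/-- The stack `c` holds the successor of the chain vertex being written. The chain is written from
its end, so `c` loses one tick per round. -/
theorem writeChain_runs (sw : Bool) (n j b : ℕ) (r : Regs) (hn : r.n = ticks n) (hm : r.m = ticks j)
    (hc : r.c = ticks (b + j)) (ht : r.tmp = []) :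
    (writeChain sw).Runs r.get { r with
      m := []
      c := ticks b
      out := ((List.range j).flatMap fun i => (Row.chain sw n (b + 1 + i)).encode) ++ r.out }.get
      (j * (10 * (n + (b + j)) + 203) + 1) := by
  induction j generalizing r with
  | zero =>
    refine (loop_nil (by exact hm)).conv ?_ (by omega)
    congr 1
    cases r
    simp_all
  | succ j ih =>
    obtain ⟨r₂, hr₂⟩ : ∃ r₂ : Regs, r₂ =
      { r with m := ticks j, out := (Row.chain sw n (b + (j + 1))).encode ++ r.out } := ⟨_, rfl⟩
    have h₁ := (emit_chainPieces_runs sw { r with m := ticks j } (by exact hn) (by exact hc)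
      (by exact ht))
    rw [← hr₂] at h₁
    have h₂ : (branch Reg.c fun _ => push Reg.out []).Runs r₂.get
        { r₂ with c := ticks (b + j) }.get 2 := by
      refine branch_runs ((push_runs _ _ _).conv ?_ le_rfl)
      simp only [Regs.update_c, Regs.update_out, hr₂]
      congr 1
      simp [Regs.get, hc, List.replicate_succ, ← add_assoc]
    have h₃ := ih { r₂ with c := ticks (b + j) } (by rw [hr₂]; exact hn) (by rw [hr₂]) rfl
      (by rw [hr₂]; exact ht)
    refine (loop_cons (a := .tick) (l := ticks j) (by exact hm) rfl
      (by rw [Regs.update_m]; exact h₁.seq h₂) h₃).conv ?_ ?_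
    · congr 1
      simp [hr₂, List.range_succ, add_assoc, add_comm 1 j]
    · have : 10 * (n + (b + j)) ≤ 10 * (n + (b + (j + 1))) := by omega
      have := Nat.mul_le_mul_left j (Nat.add_le_add_right this 203)
      rw [Nat.succ_mul j]
      omega

end StackProgram

/-- The encoding of the new vertices, where `x₁` and `x₂` encode the probabilities of the
out-edges of the second of them. -/
def encodeNewNodes (sw : Bool) (α : ℚ) (y : Bool) (x₁ x₂ : List InputSymbol) (s t n m : ℕ) :
    List InputSymbol :=
  (Row.two s (n + 1) α).encode ++
  (.node (some .random) :: .edge :: (ticks t ++ .comma :: (x₁ ++ .edge :: (ticks (n + 2) ++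
    .comma :: x₂)))) ++
  (Row.one (n + 2)).encode ++
  (Row.chain false n (n + 4)).encode ++
  ((List.range m).flatMap fun i => (Row.chain sw n (n + 5 + i)).encode) ++
  (Row.one (if y then t else n + 2)).encode

namespace StackProgram

/-- The pieces of the last vertex. -/
def lastPieces (y : Bool) : List Piece :=
  .const [.node (some .random), .edge] ::
    ((if y then [.copy .t] else [.const (ticks 2), .copy .n]) ++ [.const (.comma :: encodeRat 1)])

/-- Compute the number of vertices, write the last vertex and the chain. -/
def writeTail (sw y : Bool) : StackProgram Reg InputSymbol :=
  seq (copy .n .c) <| seq (copy .m .c) <| seq (push .c (ticks 4)) <| seq (emit (lastPieces y)) <|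
    seq (writeChain sw) <| emit (chainPieces false)

/-- Write the first three new vertices. -/
def writeInit (α : ℚ) : StackProgram Reg InputSymbol :=
  seq (emit [.const (.node (some .random) :: .edge :: ticks 2), .copy .n,
    .const (.comma :: encodeRat 1)]) <|
  seq (move .w2 .out) <|
  seq (emit [.const (.edge :: ticks 2), .copy .n, .const [.comma]]) <|
  seq (move .w1 .out) <|
  seq (emit [.const [.node (some .random), .edge], .copy .t, .const [.comma]]) <|
  emit [.const [.node (some .random), .edge], .copy .s,
    .const (.comma :: encodeRat α ++ [.edge, .tick]), .copy .n,
    .const (.comma :: encodeRat (1 - α))]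

/-- Write the old vertices and the header, and clean up. -/
def writeHead (pre : List InputSymbol) : StackProgram Reg InputSymbol :=
  seq (move .rest .out) <|
  seq (emit [.const (pre ++ ticks 3), .copy .n, .const [.comma], .copy .t, .const [.comma]]) <|
  seq (clear .s) <| seq (clear .t) <| seq (clear .n) (clear .c)

theorem encodeRat_length_one : (encodeRat 1).length = 3 := by decide +kernel

theorem writeTail_runs (sw y : Bool) (s t n m : ℕ) (w₁ w₂ rest : List InputSymbol) :
    (writeTail sw y).Runs
      (Regs.mk [] [] (ticks s) (ticks t) (ticks n) (ticks m) [] [] w₁ w₂ rest [] []).get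
      (Regs.mk [] ((Row.chain false n (n + 4)).encode ++
        ((List.range m).flatMap fun i => (Row.chain sw n (n + 5 + i)).encode) ++
        (Row.one (if y then t else n + 2)).encode) (ticks s) (ticks t) (ticks n) [] (ticks (n + 4))
        [] w₁ w₂ rest [] []).get
      (300 * (t + n + m + 1) * (m + 2)) := by
  have h₁ := copy_runs (k := .n) (dst := .c) (by decide) (by decide) (by decide) (j := n)
    (S := (Regs.mk [] [] (ticks s) (ticks t) (ticks n) (ticks m) [] [] w₁ w₂ rest [] []).get)
    rfl rfl
  rw [Regs.update_c] at h₁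
  have h₂ := copy_runs (k := .m) (dst := .c) (by decide) (by decide) (by decide) (j := m)
    (S := (Regs.mk [] [] (ticks s) (ticks t) (ticks n) (ticks m) (ticks n ++ []) [] w₁ w₂ rest
      [] []).get) rfl rfl
  rw [Regs.update_c] at h₂
  have h₃ := push_runs Reg.c (ticks 4)
    (Regs.mk [] [] (ticks s) (ticks t) (ticks n) (ticks m) (ticks m ++ (ticks n ++ [])) [] w₁ w₂
      rest [] []).get
  rw [Regs.update_c] at h₃
  -- The index of the last vertex, which is the successor of the last vertex of the chain.
  have hc : ticks 4 ++ (ticks m ++ (ticks n ++ [])) = ticks (n + 4 + m) := by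
    rw [List.append_nil, List.replicate_append_replicate, List.replicate_append_replicate]
    congr 1; omega
  have hc' : ticks 4 ++ (Regs.mk [] [] (ticks s) (ticks t) (ticks n) (ticks m)
      (ticks m ++ (ticks n ++ [])) [] w₁ w₂ rest [] []).get .c = ticks (n + 4 + m) := hc
  rw [hc'] at h₃
  have h₄ := emit_regs_runs (lastPieces y)
    (Regs.mk [] [] (ticks s) (ticks t) (ticks n) (ticks m) (ticks (n + 4 + m)) [] w₁ w₂ rest
      [] []) rfl (by cases y <;> simp [lastPieces, Piece.Valid, Regs.get])
    (l := (Row.one (if y then t else n + 2)).encode) (by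
      cases y <;> simp [lastPieces, Piece.content, Regs.get, Row.encode, encodeEdge,
        List.replicate_succ])
  have h₅ := writeChain_runs sw n m (n + 4) (Regs.mk [] ((Row.one (if y then t else n + 2)).encode
    ++ []) (ticks s) (ticks t) (ticks n) (ticks m) (ticks (n + 4 + m)) [] w₁ w₂ rest [] [])
    rfl rfl rfl rfl
  -- After the loop `c` has come down to n + 4, the successor of the chain's first vertex, which is
  -- always random.
  have h₆ := emit_chainPieces_runs false (Regs.mk [] (((List.range m).flatMap fun i =>
    (Row.chain sw n (n + 4 + 1 + i)).encode) ++ ((Row.one (if y then t else n + 2)).encode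
    ++ [])) (ticks s) (ticks t) (ticks n) [] (ticks (n + 4)) [] w₁ w₂ rest [] [])
    (b := n + 4) rfl rfl rfl
  refine (h₁.seq (h₂.seq (h₃.seq (h₄.seq (h₅.seq h₆))))).conv ?_ ?_
  · congr 1
    simp
  · have e : (Row.one (if y then t else n + 2)).encode.length ≤ t + n + 9 := by
      have := encodeRat_length_one
      cases y <;> simp [Row.encode, encodeEdge, this] <;> omega
    have e' : (lastPieces y).length ≤ 4 := by cases y <;> simp [lastPieces]
    nlinarith [Nat.zero_le (t * m), Nat.zero_le (n * m), Nat.zero_le (m * m)]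

theorem move_out_runs {k : Reg} (hk : k ≠ .out) (r : Regs) :
    (move k .out).Runs r.get (Function.update { r with out := (r.get k).reverse ++ r.out }.get k [])
      (2 * (r.get k).length + 1) := by
  have := move_runs hk r.get
  rwa [Regs.update_out] at this

/-- The probabilities of the second new vertex may depend on the input. They wait in reversed form
on `w1` and `w2`, so that a plain `move` writes them the right way round. -/
theorem writeInit_runs (α : ℚ) (s t n k : ℕ) (o w₁ w₂ rest : List InputSymbol) :
    (writeInit α).Runs
      (Regs.mk [] o (ticks s) (ticks t) (ticks n) [] (ticks k) [] w₁ w₂ rest [] []).get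
      (Regs.mk [] ((Row.two s (n + 1) α).encode ++
        (.node (some .random) :: .edge :: (ticks t ++ .comma :: (w₁.reverse ++ .edge ::
          (ticks (n + 2) ++ .comma :: w₂.reverse)))) ++
        (Row.one (n + 2)).encode ++ o) (ticks s) (ticks t) (ticks n) [] (ticks k)
        [] [] [] rest [] []).get
      (20 * (s + t + n) + 2 * w₁.length + 2 * w₂.length +
        5 * ((encodeRat α).length + (encodeRat (1 - α)).length) + 200) := by
  have h₁ := emit_regs_runs [.const (.node (some .random) :: .edge :: ticks 2), .copy .n,
    .const (.comma :: encodeRat 1)]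
    (Regs.mk [] o (ticks s) (ticks t) (ticks n) [] (ticks k) [] w₁ w₂ rest [] []) rfl
    (by simp [Piece.Valid, Regs.get]) (l := (Row.one (n + 2)).encode) (by
      simp [Piece.content, Regs.get, Row.encode, encodeEdge, List.replicate_succ])
  have h₂ := move_out_runs (k := .w2) (by decide) (Regs.mk [] ((Row.one (n + 2)).encode ++ o)
    (ticks s) (ticks t) (ticks n) [] (ticks k) [] w₁ w₂ rest [] [])
  rw [Regs.update_w2] at h₂
  have h₃ := emit_regs_runs [.const (.edge :: ticks 2), .copy .n, .const [.comma]]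
    (Regs.mk [] (w₂.reverse ++ ((Row.one (n + 2)).encode ++ o))
    (ticks s) (ticks t) (ticks n) [] (ticks k) [] w₁ [] rest [] []) rfl
    (by simp [Piece.Valid, Regs.get]) (l := .edge :: (ticks (n + 2) ++ [.comma])) (by
      simp [Piece.content, Regs.get, List.replicate_succ])
  have h₄ := move_out_runs (k := .w1) (by decide) (Regs.mk [] (.edge :: (ticks (n + 2) ++ [.comma])
    ++ (w₂.reverse ++ ((Row.one (n + 2)).encode ++ o)))
    (ticks s) (ticks t) (ticks n) [] (ticks k) [] w₁ [] rest [] [])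
  rw [Regs.update_w1] at h₄
  have h₅ := emit_regs_runs [.const [.node (some .random), .edge], .copy .t, .const [.comma]]
    (Regs.mk [] (w₁.reverse ++ (.edge :: (ticks (n + 2) ++ [.comma])
    ++ (w₂.reverse ++ ((Row.one (n + 2)).encode ++ o))))
    (ticks s) (ticks t) (ticks n) [] (ticks k) [] [] [] rest [] []) rfl
    (by simp [Piece.Valid, Regs.get])
    (l := .node (some .random) :: .edge :: (ticks t ++ [.comma])) (by
      simp [Piece.content, Regs.get])
  have h₆ := emit_regs_runs [.const [.node (some .random), .edge], .copy .s,
    .const (.comma :: encodeRat α ++ [.edge, .tick]), .copy .n,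
    .const (.comma :: encodeRat (1 - α))]
    (Regs.mk [] (.node (some .random) :: .edge :: (ticks t ++ [.comma]) ++ (w₁.reverse ++
    (.edge :: (ticks (n + 2) ++ [.comma]) ++ (w₂.reverse ++ ((Row.one (n + 2)).encode ++ o)))))
    (ticks s) (ticks t) (ticks n) [] (ticks k) [] [] [] rest [] []) rfl
    (by simp [Piece.Valid, Regs.get]) (l := (Row.two s (n + 1) α).encode) (by
      simp [Piece.content, Regs.get, Row.encode, encodeEdge, List.replicate_succ])
  refine (h₁.seq (h₂.seq (h₃.seq (h₄.seq (h₅.seq h₆))))).conv ?_ ?_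
  · congr 1
    simp
  · have := encodeRat_length_one
    simp [Row.encode, encodeEdge, Regs.get, this]
    omega

theorem writeHead_runs (pre : List InputSymbol) (s t n k : ℕ) (o rest : List InputSymbol) :
    (writeHead pre).Runs
      (Regs.mk [] o (ticks s) (ticks t) (ticks n) [] (ticks k) [] [] [] rest [] []).get
      (Regs.mk [] (pre ++ (ticks (n + 3) ++ .comma :: (ticks t ++ .comma :: (rest.reverse ++ o))))
        [] [] [] [] [] [] [] [] [] [] []).get
      (2 * rest.length + 5 * pre.length + 10 * (s + t + n + k) + 100) := by
  have h₁ := move_out_runs (k := .rest) (by decide) (Regs.mk [] o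
    (ticks s) (ticks t) (ticks n) [] (ticks k) [] [] [] rest [] [])
  rw [Regs.update_rest] at h₁
  have h₂ := emit_regs_runs [.const (pre ++ ticks 3), .copy .n, .const [.comma], .copy .t,
      .const [.comma]] (Regs.mk [] (rest.reverse ++ o)
    (ticks s) (ticks t) (ticks n) [] (ticks k) [] [] [] [] [] []) rfl
    (by simp [Piece.Valid, Regs.get])
    (l := pre ++ (ticks (n + 3) ++ .comma :: (ticks t ++ [.comma]))) (by
      simp [Piece.content, Regs.get, List.replicate_succ])
  obtain ⟨o', ho'⟩ : ∃ o', o' = pre ++ (ticks (n + 3) ++ InputSymbol.comma ::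
    (ticks t ++ [.comma])) ++ (rest.reverse ++ o) := ⟨_, rfl⟩
  have h₃ := clear_runs (k := .s) (Regs.mk [] o' (ticks s) (ticks t) (ticks n) [] (ticks k)
    [] [] [] [] [] []).get
  have h₄ := clear_runs (k := .t) (Regs.mk [] o' [] (ticks t) (ticks n) [] (ticks k)
    [] [] [] [] [] []).get
  have h₅ := clear_runs (k := .n) (Regs.mk [] o' [] [] (ticks n) [] (ticks k)
    [] [] [] [] [] []).get
  have h₆ := clear_runs (k := .c) (Regs.mk [] o' [] [] [] [] (ticks k)
    [] [] [] [] [] []).get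
  rw [Regs.update_s] at h₃
  rw [Regs.update_t] at h₄
  rw [Regs.update_n] at h₅
  rw [Regs.update_c] at h₆
  rw [← ho'] at h₂
  refine (h₁.seq (h₂.seq (h₃.seq (h₄.seq (h₅.seq h₆))))).conv ?_ ?_
  · congr 1
    simp [ho']
  · simp [Regs.get]
    omega

end StackProgram

/-! ### Subtraction of binary numbers -/

/-- The number with the given binary digits, least significant digit first. -/
def bitsVal : List Bool → ℕ
  | [] => 0
  | b :: l => b.toNat + 2 * bitsVal l

theorem bitsVal_append (l l' : List Bool) :
    bitsVal (l ++ l') = bitsVal l + 2 ^ l.length * bitsVal l' := by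
  induction l with
  | nil => simp [bitsVal]
  | cons b l ih => simp [bitsVal, ih, pow_succ]; ring

theorem bitsVal_lt (l : List Bool) : bitsVal l < 2 ^ l.length := by
  induction l with
  | nil => simp [bitsVal]
  | cons b l ih => cases b <;> simp [bitsVal, pow_succ] <;> omega

theorem bitsVal_encodePosNum (n : PosNum) : bitsVal (Computability.encodePosNum n) = n := by
  induction n with
  | one => rfl
  | bit0 n ih => simp [Computability.encodePosNum, bitsVal, ih]; omega
  | bit1 n ih => simp [Computability.encodePosNum, bitsVal, ih]; omega

theorem bitsVal_encodeNat (n : ℕ) : bitsVal (Computability.encodeNat n) = n := by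
  conv_rhs => rw [← Num.to_of_nat n]
  unfold Computability.encodeNat
  cases (n : Num) with
  | zero => rfl
  | pos p => exact bitsVal_encodePosNum p

/-- Digits are stored with the least significant one first, so every string whose last digit is
`true` encodes a positive number. -/
theorem exists_encodePosNum_eq (l : List Bool) :
    ∃ p, Computability.encodePosNum p = l ++ [true] := by
  induction l with
  | nil => exact ⟨.one, rfl⟩
  | cons b l ih =>
    obtain ⟨p, hp⟩ := ih
    cases b
    · exact ⟨.bit0 p, by simp [Computability.encodePosNum, hp]⟩
    · exact ⟨.bit1 p, by simp [Computability.encodePosNum, hp]⟩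

theorem encodeNat_bitsVal (l : List Bool) :
    Computability.encodeNat (bitsVal (l ++ [true])) = l ++ [true] := by
  obtain ⟨p, hp⟩ := exists_encodePosNum_eq l
  rw [← hp, bitsVal_encodePosNum, Computability.encodeNat]
  have : (((p : ℕ) : Num)) = Num.pos p := by
    simp
  rw [this]
  rfl

theorem bitsVal_replicate_false (j : ℕ) : bitsVal (List.replicate j false) = 0 := by
  induction j with
  | zero => rfl
  | succ j ih => simp [List.replicate_succ, bitsVal, ih]

/-- Binary digits without the leading zeros. -/
theorem eq_encodeNat_append (l : List Bool) (hl : bitsVal l ≠ 0) : ∃ l' j,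
    Computability.encodeNat (bitsVal l) = l' ++ [true] ∧
    l = l' ++ true :: List.replicate j false := by
  have key : ∀ l : List Bool, (∃ j, l = List.replicate j false) ∨
      ∃ l' j, l = l' ++ true :: List.replicate j false := by
    intro l
    induction l with
    | nil => exact .inl ⟨0, rfl⟩
    | cons b l ih =>
      rcases ih with ⟨j, rfl⟩ | ⟨l', j, rfl⟩
      · cases b
        · exact .inl ⟨j + 1, rfl⟩
        · exact .inr ⟨[], j, rfl⟩
      · exact .inr ⟨b :: l', j, rfl⟩
  rcases key l with ⟨j, rfl⟩ | ⟨l', j, rfl⟩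
  · exact absurd (bitsVal_replicate_false j) hl
  · refine ⟨l', j, ?_, rfl⟩
    rw [← encodeNat_bitsVal l']
    congr 1
    rw [bitsVal_append, bitsVal_append]
    simp [bitsVal, bitsVal_replicate_false]

/-- A canonical encoding ends in its leading digit one, so a positive number with k + 1 digits is at
least 2^k, whereas any number is below 2 to the number of its digits. -/
theorem encodeNat_length_le {a b : ℕ} (h : a ≤ b) :
    (Computability.encodeNat a).length ≤ (Computability.encodeNat b).length := by
  rcases Nat.eq_zero_or_pos a with rfl | ha
  · simp [Computability.encodeNat, Computability.encodeNum]
  · obtain ⟨l, j, h₁, h₂⟩ := eq_encodeNat_append (Computability.encodeNat a)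
      (by rw [bitsVal_encodeNat]; omega)
    rw [bitsVal_encodeNat] at h₁
    rw [h₁]
    have h₃ := bitsVal_lt (Computability.encodeNat b)
    rw [bitsVal_encodeNat] at h₃
    have h₄ : 2 ^ l.length ≤ a := by
      conv_rhs => rw [← bitsVal_encodeNat a, h₁, bitsVal_append]
      simp [bitsVal]
    have := (Nat.pow_lt_pow_iff_right (a := 2) (by norm_num)).1 (h₄.trans_lt (h.trans_lt h₃))
    simpa using this

/-- The next borrow in a subtraction. -/
def borrow (y x r : Bool) : Bool := (!y && (x || r)) || (x && r)

/-- Subtract binary numbers. -/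
def subBits : List Bool → List Bool → Bool → List Bool
  | [], _, _ => []
  | y :: ys, xs, r =>
    ((y ^^ xs.headD false) ^^ r) :: subBits ys xs.tail (borrow y (xs.headD false) r)

/-- The invariant of subtraction with borrow: `r` is the incoming and `r'` the outgoing borrow. -/
theorem bitsVal_subBits (ys xs : List Bool) (r : Bool) (h : xs.length ≤ ys.length) :
    ∃ r' : Bool, bitsVal (subBits ys xs r) + bitsVal xs + r.toNat =
      bitsVal ys + r'.toNat * 2 ^ ys.length := by
  induction ys generalizing xs r with
  | nil =>
    obtain rfl : xs = [] := by simpa using h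
    exact ⟨r, by simp [subBits, bitsVal]⟩
  | cons y ys ih =>
    obtain ⟨r', hr'⟩ := ih xs.tail (borrow y (xs.headD false) r) (by simp at h ⊢; omega)
    refine ⟨r', ?_⟩
    have hx : bitsVal xs = (xs.headD false).toNat + 2 * bitsVal xs.tail := by
      cases xs <;> simp [bitsVal]
    rw [hx]
    simp only [subBits, bitsVal, List.length_cons, pow_succ]
    generalize xs.headD false = x at *
    rw [← mul_assoc]
    generalize r'.toNat * 2 ^ ys.length = z at *
    cases y <;> cases x <;> cases r <;> simp [borrow] at hr' ⊢ <;> omega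

theorem subBits_length (ys xs : List Bool) (r : Bool) : (subBits ys xs r).length = ys.length := by
  induction ys generalizing xs r with
  | nil => rfl
  | cons y ys ih => simp [subBits, ih]

/-- A final borrow would make the result at least 2 to its number of digits, which is impossible. -/
theorem bitsVal_subBits_encodeNat {a b : ℕ} (h : a ≤ b) :
    bitsVal (subBits (Computability.encodeNat b) (Computability.encodeNat a) false) = b - a := by
  obtain ⟨r, hr⟩ := bitsVal_subBits _ _ false (encodeNat_length_le h)
  have h₁ := bitsVal_lt (subBits (Computability.encodeNat b) (Computability.encodeNat a) false)
  rw [subBits_length] at h₁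
  rw [bitsVal_encodeNat, bitsVal_encodeNat] at hr
  cases r
  · simp at hr; omega
  · simp at hr; omega

/-- Binary digits as input symbols. -/
abbrev bitSymbols (l : List Bool) : List InputSymbol := l.map .bit

/-! ### The machine for the complement of a fraction -/

namespace StackProgram

/-- Read the numerator. -/
def readNum : StackProgram Reg InputSymbol :=
  loop .inp (fun a => decide (a = .slash)) fun a =>
    seq (push .tmp [a]) (seq (push .w2 [a]) (push .m [.tick]))

theorem readNum_runs (x : List Bool) (l : List InputSymbol) (r : Regs)
    (h : r.inp = bitSymbols x ++ .slash :: l) :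
    readNum.Runs r.get { r with
      inp := l
      tmp := (bitSymbols x).reverse ++ r.tmp
      w2 := (bitSymbols x).reverse ++ r.w2
      m := ticks x.length ++ r.m }.get (4 * x.length + 1) := by
  induction x generalizing r with
  | nil =>
    have := loop_final (k := Reg.inp) (isFinal := fun a => decide (a = InputSymbol.slash))
      (body := fun a => seq (push .tmp [a]) (seq (push .w2 [a]) (push .m [.tick])))
      (S := r.get) (a := .slash) (l := l) (by simp [Regs.get, h]) (by simp)
    rw [Regs.update_inp] at this
    simpa [readNum] using this
  | cons a x ih =>
    have h₁ := ((push_runs Reg.tmp [.bit a]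
      { r with inp := bitSymbols x ++ InputSymbol.slash :: l }.get).seq
      ((push_runs .w2 [.bit a] _).seq (push_runs .m [.tick] _)))
    simp only [Regs.update_tmp, Regs.update_m, Regs.update_w2] at h₁
    refine (loop_cons (k := Reg.inp) (a := .bit a) (l := bitSymbols x ++ .slash :: l)
      (by simp [Regs.get, h]) (by simp) (by rw [Regs.update_inp]; exact h₁) (ih _ rfl)).conv ?_
      (by simp; omega)
    congr 1
    simpa [Regs.get] using ticks_append x.length 1 r.m

/-- Read a string of digits and the start vertex. -/
def readStart : StackProgram Reg InputSymbol :=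
  loop .inp (fun a => decide (a = .comma)) fun a => match a with
    | .bit x => seq (push .b [.bit x]) (seq (push .w2 [.bit x]) (push .m [.tick]))
    | _ => push .s [.tick]

theorem readStart_runs_ticks (j : ℕ) (l : List InputSymbol) (r : Regs)
    (h : r.inp = ticks j ++ .comma :: l) :
    readStart.Runs r.get { r with inp := l, s := ticks j ++ r.s }.get (2 * j + 1) := by
  induction j generalizing r with
  | zero =>
    have := loop_final (k := Reg.inp) (isFinal := fun a => decide (a = InputSymbol.comma))
      (body := fun a => match a with
        | .bit x => seq (push .b [.bit x]) (seq (push .w2 [.bit x]) (push .m [.tick]))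
        | _ => push Reg.s [.tick])
      (S := r.get) (a := .comma) (l := l)
      (by simp [Regs.get, h])
      (by simp)
    rw [Regs.update_inp] at this
    simpa [readStart] using this
  | succ j ih =>
    have h₁ := push_runs Reg.s [.tick] { r with inp := ticks j ++ InputSymbol.comma :: l }.get
    rw [Regs.update_s] at h₁
    refine (loop_cons (k := Reg.inp) (a := .tick) (l := ticks j ++ .comma :: l)
      (by simp [Regs.get, h, List.replicate_succ]) (by simp)
      (by rw [Regs.update_inp]; exact h₁) (ih _ rfl)).conv ?_ (by omega)
    congr 2
    exact ticks_append j 1 r.s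

theorem readStart_runs (x : List Bool) (j : ℕ) (l : List InputSymbol) (r : Regs)
    (h : r.inp = bitSymbols x ++ (ticks j ++ .comma :: l)) :
    readStart.Runs r.get { r with
      inp := l
      s := ticks j ++ r.s
      b := (bitSymbols x).reverse ++ r.b
      w2 := (bitSymbols x).reverse ++ r.w2
      m := ticks x.length ++ r.m }.get (4 * x.length + 2 * j + 1) := by
  induction x generalizing r with
  | nil => simpa using readStart_runs_ticks j l r (by simpa using h)
  | cons a x ih =>
    have h₁ := ((push_runs Reg.b [.bit a]
      { r with inp := bitSymbols x ++ (ticks j ++ InputSymbol.comma :: l) }.get).seq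
      ((push_runs .w2 [.bit a] _).seq (push_runs .m [.tick] _)))
    simp only [Regs.update_b, Regs.update_m, Regs.update_w2] at h₁
    refine (loop_cons (k := Reg.inp) (a := .bit a) (l := bitSymbols x ++ (ticks j ++ .comma :: l))
      (by simp [Regs.get, h]) (by simp) (by rw [Regs.update_inp]; exact h₁) (ih _ rfl)).conv ?_
      (by simp; omega)
    congr 1
    simpa [Regs.get] using ticks_append x.length 1 r.m

/-- The digit that was popped. -/
def digit (o : Option InputSymbol) : Bool := decide (o = some (.bit true))

/-- Subtract the number on the stack `rest` from that on `c`, with a borrow on `d`. -/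
def subtract : StackProgram Reg InputSymbol :=
  loop .c (fun _ => false) fun y => branch .rest fun x => branch .d fun r =>
    seq (push .d [.bit (borrow (digit (some y)) (digit x) (digit r))])
      (seq (push .w1 [.bit ((digit (some y) ^^ digit x) ^^ digit r)]) (push .b [y]))

theorem digit_bit (b : Bool) : digit (some (.bit b)) = b := by cases b <;> rfl

theorem digit_head (x : List Bool) : digit (bitSymbols x).head? = x.headD false := by
  cases x with
  | nil => rfl
  | cons b x => exact digit_bit b

/-- The digits of the difference pile up on `w1` with the most significant one on top, where `trim`
can remove leading zeros. The minuend, the denominator in the application, is saved on `b`. The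
final borrow is discarded later, so it stays unspecified. -/
theorem subtract_runs (y x : List Bool) (b : Bool) (r : Regs) (hc : r.c = bitSymbols y)
    (hx : r.rest = bitSymbols x) (hd : r.d = [.bit b]) :
    ∃ b', subtract.Runs r.get { r with
      c := []
      rest := bitSymbols (x.drop y.length)
      d := [.bit b']
      w1 := (bitSymbols (subBits y x b)).reverse ++ r.w1
      b := (bitSymbols y).reverse ++ r.b }.get (6 * y.length + 1) := by
  induction y generalizing x b r with
  | nil =>
    refine ⟨b, (loop_nil (by exact hc)).conv ?_ (by simp)⟩
    congr 1
    cases r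
    simp_all [subBits]
  | cons a y ih =>
    have h₁ := ((push_runs Reg.d [InputSymbol.bit (borrow a (x.headD false) b)]
      { r with c := bitSymbols y, rest := bitSymbols x.tail, d := [] }.get).seq
      ((push_runs .w1 [.bit ((a ^^ x.headD false) ^^ b)] _).seq (push_runs .b [.bit a] _)))
    simp only [Regs.update_d, Regs.update_w1, Regs.update_b] at h₁
    obtain ⟨r₂, hr₂⟩ : ∃ r₂ : Regs, r₂ = { r with
      c := bitSymbols y
      rest := bitSymbols x.tail
      d := [.bit (borrow a (x.headD false) b)]
      w1 := .bit ((a ^^ x.headD false) ^^ b) :: r.w1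
      b := .bit a :: r.b } := ⟨_, rfl⟩
    obtain ⟨b', h₂⟩ := ih x.tail (borrow a (x.headD false) b) r₂ (by rw [hr₂]) (by rw [hr₂])
      (by rw [hr₂])
    have h₃ : (branch Reg.rest fun x => branch .d fun r =>
        seq (push .d [.bit (borrow a (digit x) (digit r))])
        (seq (push .w1 [.bit ((a ^^ digit x) ^^ digit r)]) (push .b [.bit a]))).Runs
        { r with c := bitSymbols y }.get r₂.get (1 + (1 + 1) + 1 + 1) := by
      refine branch_runs (branch_runs ?_)
      simp only [Regs.update_rest, Regs.update_d]
      have e₁ : ({ r with c := bitSymbols y } : Regs).get .rest = bitSymbols x := hx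
      have e₂ : ({ r with c := bitSymbols y, rest := (bitSymbols x).tail } : Regs).get .d =
        [.bit b] := hd
      rw [e₁, e₂, digit_head]
      simp only [List.head?_cons, digit_bit, List.tail_cons]
      rw [← List.map_tail, hr₂]
      exact h₁
    refine ⟨b', (loop_cons (k := Reg.c) (a := .bit a) (l := bitSymbols y)
      (by simp [Regs.get, hc]) rfl (by rw [Regs.update_c, digit_bit]; exact h₃) h₂).conv ?_
      (by simp; omega)⟩
    · congr 1
      simp [subBits, hr₂]

/-- Remove leading zeros. -/
def trim : StackProgram Reg InputSymbol :=
  seq (loop .w1 (fun a => decide (a = .bit true)) fun _ => push .w1 []) (push .w1 [.bit true])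

theorem trim_runs (j : ℕ) (l : List InputSymbol) (r : Regs)
    (h : r.w1 = List.replicate j (.bit false) ++ .bit true :: l) :
    trim.Runs r.get { r with w1 := .bit true :: l }.get (2 * j + 2) := by
  have key : ∀ (j : ℕ) (r : Regs), r.w1 = List.replicate j (.bit false) ++ .bit true :: l →
      (loop Reg.w1 (fun a => decide (a = InputSymbol.bit true)) fun _ => push .w1 []).Runs
        r.get { r with w1 := l }.get (2 * j + 1) := by
    intro j
    induction j with
    | zero =>
      intro r h
      rw [← Regs.update_w1 r l]
      exact loop_final (by simpa [Regs.get] using h) (by simp)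
    | succ j ih =>
      intro r h
      have h₂ := ih { r with w1 := List.replicate j (.bit false) ++ .bit true :: l } rfl
      refine (loop_cons (k := Reg.w1) (a := .bit false)
        (l := List.replicate j (.bit false) ++ .bit true :: l)
        (by simp [Regs.get, h, List.replicate_succ]) (by simp) (push_runs _ _ _)
        (S' := Regs.get { r with w1 := l }) ?_).mono (m := 2 * (j + 1) + 1)
        (n := 1 + 1 + (2 * j + 1))
        (by omega)
      simp only [Regs.update_w1]
      exact h₂
  refine ((key j r h).seq (push_runs _ _ _)).conv ?_ (by omega)
  rw [Regs.update_w1]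
  rfl

/-- Read a fraction `a / b` and write the encodings of `a / b` and of `(b - a) / b`, reversed, to
`w2` and `w1`. -/
def readFraction : StackProgram Reg InputSymbol :=
  seq readNum <| seq (push .w2 [.slash]) <| seq readStart <| seq (move .tmp .rest) <|
  seq (move .b .c) <| seq (push .d [.bit false]) <| seq subtract <| seq (clear .d) <|
  seq (clear .rest) <| seq trim <| seq (push .w1 [.slash]) <| seq (move .b .c) <| move .c .w1

/-- The strict inequality makes the difference nonzero, so that `trim` finds a digit one to stop at.
The ticks on `m`, one per digit of the fraction, lengthen the chain: the gap between the value and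
the threshold depends on the size of p. -/
theorem readFraction_runs {a b : ℕ} (hab : a < b) (j : ℕ) (l : List InputSymbol) :
    readFraction.Runs
      (Regs.mk (bitSymbols (Computability.encodeNat a) ++ .slash ::
        (bitSymbols (Computability.encodeNat b) ++ (ticks j ++ .comma :: l)))
        [] [] [] [] [] [] [] [] [] [] [] []).get
      (Regs.mk l [] (ticks j) [] []
        (ticks ((Computability.encodeNat b).length + (Computability.encodeNat a).length)) [] []
        (bitSymbols (Computability.encodeNat (b - a)) ++ .slash ::
          bitSymbols (Computability.encodeNat b)).reverse
        (bitSymbols (Computability.encodeNat a) ++ .slash ::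
          bitSymbols (Computability.encodeNat b)).reverse [] [] []).get
      (50 * ((Computability.encodeNat b).length + j + 1)) := by
  have hlen := encodeNat_length_le hab.le
  have hsub := bitsVal_subBits_encodeNat hab.le
  -- The computed digits are the canonical encoding of b - a followed by `i` superfluous zeros.
  obtain ⟨l', i, e₁, e₂⟩ := eq_encodeNat_append (subBits (Computability.encodeNat b)
    (Computability.encodeNat a) false) (by rw [hsub]; omega)
  rw [hsub] at e₁
  have hi := congrArg List.length e₂
  rw [subBits_length] at hi
  rw [e₁]
  generalize Computability.encodeNat a = x at *
  generalize Computability.encodeNat b = y at *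
  have h₁ := readNum_runs x (bitSymbols y ++ (ticks j ++ .comma :: l))
    (Regs.mk (bitSymbols x ++ .slash :: (bitSymbols y ++ (ticks j ++ .comma :: l)))
      [] [] [] [] [] [] [] [] [] [] [] []) rfl
  simp only [List.append_nil] at h₁
  have h₂ := push_runs Reg.w2 [.slash] (Regs.mk (bitSymbols y ++ (ticks j ++ .comma :: l))
      [] [] [] [] (ticks x.length) [] (bitSymbols x).reverse [] (bitSymbols x).reverse [] [] []).get
  rw [Regs.update_w2] at h₂
  have h₃ := readStart_runs y j l (Regs.mk (bitSymbols y ++ (ticks j ++ .comma :: l))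
      [] [] [] [] (ticks x.length) [] (bitSymbols x).reverse [] (.slash :: (bitSymbols x).reverse)
      [] [] []) rfl
  simp only [List.append_nil] at h₃
  obtain ⟨w, hw⟩ : ∃ w, w = (bitSymbols y).reverse ++ .slash :: (bitSymbols x).reverse := ⟨_, rfl⟩
  obtain ⟨m, hm⟩ : ∃ m, m = ticks y.length ++ ticks x.length := ⟨_, rfl⟩
  have h₄ := move_runs (k := Reg.tmp) (dst := .rest) (by decide) (Regs.mk l [] (ticks j) [] []
    m [] (bitSymbols x).reverse [] w [] (bitSymbols y).reverse []).get
  have h₅ := move_runs (k := Reg.b) (dst := .c) (by decide) (Regs.mk l [] (ticks j) [] []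
    m [] [] [] w (bitSymbols x) (bitSymbols y).reverse []).get
  have h₆ := push_runs Reg.d [.bit false] (Regs.mk l [] (ticks j) [] []
    m (bitSymbols y) [] [] w (bitSymbols x) [] []).get
  obtain ⟨b', h₇⟩ := subtract_runs y x false (Regs.mk l [] (ticks j) [] []
    m (bitSymbols y) [] [] w (bitSymbols x) [] [.bit false]) rfl rfl rfl
  simp only [List.append_nil] at h₇
  have h₈ := clear_runs (k := Reg.d) (Regs.mk l [] (ticks j) [] []
    m [] [] (bitSymbols (subBits y x false)).reverse w (bitSymbols (x.drop y.length))
    (bitSymbols y).reverse [.bit b']).get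
  have h₉ := clear_runs (k := Reg.rest) (Regs.mk l [] (ticks j) [] []
    m [] [] (bitSymbols (subBits y x false)).reverse w (bitSymbols (x.drop y.length))
    (bitSymbols y).reverse []).get
  have h₁₀ := trim_runs i (bitSymbols l').reverse (Regs.mk l [] (ticks j) [] []
    m [] [] (bitSymbols (subBits y x false)).reverse w []
    (bitSymbols y).reverse []) (by rw [e₂]; simp)
  have h₁₁ := push_runs Reg.w1 [.slash] (Regs.mk l [] (ticks j) [] []
    m [] [] (.bit true :: (bitSymbols l').reverse) w [] (bitSymbols y).reverse []).get
  have h₁₂ := move_runs (k := Reg.b) (dst := .c) (by decide) (Regs.mk l [] (ticks j) [] []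
    m [] [] (.slash :: .bit true :: (bitSymbols l').reverse) w [] (bitSymbols y).reverse []).get
  have h₁₃ := move_runs (k := Reg.c) (dst := .w1) (by decide) (Regs.mk l [] (ticks j) [] []
    m (bitSymbols y) [] (.slash :: .bit true :: (bitSymbols l').reverse) w [] [] []).get
  simp only [Regs.update_tmp, Regs.update_rest, Regs.update_b, Regs.update_c, Regs.update_d,
    Regs.update_w1, Regs.get, List.reverse_reverse, List.append_nil, List.cons_append,
    List.nil_append] at h₂ h₄ h₅ h₆ h₈ h₉ h₁₁ h₁₂ h₁₃
  rw [← hw, ← hm] at h₃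
  refine (h₁.seq (h₂.seq (h₃.seq (h₄.seq (h₅.seq (h₆.seq (h₇.seq (h₈.seq (h₉.seq (h₁₀.seq
    (h₁₁.seq (h₁₂.seq h₁₃)))))))))))).conv ?_ ?_
  · congr 1
    simp [hw, hm]
  · simp at hi hlen ⊢
    omega

end StackProgram

/-! ### The reduced instance as a function on strings, in polynomial time -/

/-- The encoding of the reduced instance, computed from that of the given instance. -/
def encodeReduced (pre : List InputSymbol) (sw : Bool) (α : ℚ) (y : Bool)
    (x₁ x₂ : List InputSymbol) (c s t : ℕ) (l : List InputSymbol) : List InputSymbol :=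
  pre ++ (ticks (StackProgram.nodeCount l + 3) ++ .comma :: (ticks t ++ .comma :: (l ++
    encodeNewNodes sw α y x₁ x₂ s t (StackProgram.nodeCount l) (2 * l.length + c))))

/-- Passing from p to 1 - p keeps the reduced denominator, so subtracting the numerator from it
gives lowest terms again and no gcd has to be computed. -/
theorem encodeRat_one_sub {p : ℚ} (h₀ : 0 < p) (h₁ : p < 1) :
    p.num.natAbs < p.den ∧ encodeRat (1 - p) =
      bitSymbols (Computability.encodeNat (p.den - p.num.natAbs)) ++ .slash ::
        bitSymbols (Computability.encodeNat p.den) := by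
  have hn : 0 < p.num := Rat.num_pos.2 h₀
  have hlt : p.num < p.den := by
    have h₂ : (p.num : ℚ) < p.den := by
      have h₃ : (0 : ℚ) < p.den := by exact_mod_cast p.den_pos
      rw [← Rat.mul_den_eq_num p]
      nlinarith
    exact_mod_cast h₂
  have hden : (1 - p).den = p.den := by
    simp
  have hnum : (1 - p).num = p.den - p.num := by
    have h₂ : ((1 - p).num : ℚ) = (p.den - p.num : ℤ) := by
      have h₃ := Rat.mul_den_eq_num (1 - p)
      have h₄ := Rat.mul_den_eq_num p
      rw [hden] at h₃
      push_cast
      rw [← h₃, ← h₄]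
      ring
    exact_mod_cast h₂
  refine ⟨by omega, ?_⟩
  rw [encodeRat, hden, hnum]
  congr 3
  omega

namespace StackProgram

theorem nodeCount_le (l : List InputSymbol) : nodeCount l ≤ l.length := List.countP_le_length

/-- Read the target and the vertices and write the reduced instance. -/
def build (pre : List InputSymbol) (sw : Bool) (α : ℚ) (y : Bool) :
    StackProgram Reg InputSymbol :=
  seq readTarget <| seq readNodes <| seq (writeTail sw y) <| seq (writeInit α) (writeHead pre)

/-- A constant in the bound for the running time. -/
def buildConst (pre : List InputSymbol) (α : ℚ) : ℕ :=
  5 * ((encodeRat α).length + (encodeRat (1 - α)).length) + 5 * pre.length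

theorem build_runs (pre : List InputSymbol) (sw : Bool) (α : ℚ) (y : Bool) (c s t : ℕ)
    (l w₁ w₂ : List InputSymbol) :
    (build pre sw α y).Runs
      (Regs.mk (ticks t ++ .comma :: l) [] (ticks s) [] [] (ticks c) [] [] w₁ w₂ [] [] []).get
      (Regs.mk [] (encodeReduced pre sw α y w₁.reverse w₂.reverse c s t l)
        [] [] [] [] [] [] [] [] [] [] []).get
      (5000 * (s + t + l.length + c + 1) ^ 2 + 2 * (w₁.length + w₂.length) + buildConst pre α) := by
  have h₁ := readTarget_runs t l
    (Regs.mk (ticks t ++ .comma :: l) [] (ticks s) [] [] (ticks c) [] [] w₁ w₂ [] [] []) rfl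
  have h₂ := readNodes_runs l
    (Regs.mk l [] (ticks s) (ticks t) [] (ticks c) [] [] w₁ w₂ [] [] []) rfl
  simp only [List.append_nil, List.replicate_append_replicate] at h₁ h₂
  have h₃ := writeTail_runs sw y s t (nodeCount l) (2 * l.length + c) w₁ w₂ l.reverse
  have h₄ := writeInit_runs α s t (nodeCount l) (nodeCount l + 4)
    ((Row.chain false (nodeCount l) (nodeCount l + 4)).encode ++
      ((List.range (2 * l.length + c)).flatMap fun i =>
        (Row.chain sw (nodeCount l) (nodeCount l + 5 + i)).encode) ++
      (Row.one (if y then t else nodeCount l + 2)).encode) w₁ w₂ l.reverse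
  have h₅ := writeHead_runs pre s t (nodeCount l) (nodeCount l + 4)
    ((Row.two s (nodeCount l + 1) α).encode ++
        (.node (some .random) :: .edge :: (ticks t ++ .comma :: (w₁.reverse ++ .edge ::
          (ticks (nodeCount l + 2) ++ .comma :: w₂.reverse)))) ++
        (Row.one (nodeCount l + 2)).encode ++
      ((Row.chain false (nodeCount l) (nodeCount l + 4)).encode ++
      ((List.range (2 * l.length + c)).flatMap fun i =>
        (Row.chain sw (nodeCount l) (nodeCount l + 5 + i)).encode) ++
      (Row.one (if y then t else nodeCount l + 2)).encode)) l.reverse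
  refine (h₁.seq (h₂.seq (h₃.seq (h₄.seq h₅)))).conv ?_ ?_
  · congr 1
    simp only [encodeReduced, encodeNewNodes, List.reverse_reverse, List.append_assoc]
  · have hn := nodeCount_le l
    rw [List.length_reverse]
    obtain ⟨X, hX⟩ : ∃ X, X = s + t + l.length + c + 1 := ⟨_, rfl⟩
    have e₁ : 300 * (t + nodeCount l + (2 * l.length + c) + 1) * (2 * l.length + c + 2) ≤
        300 * (3 * X) * (2 * X) := by
      gcongr <;> omega
    have e₂ : X ≤ X ^ 2 := Nat.le_self_pow (by norm_num) X
    have e₃ : 300 * (3 * X) * (2 * X) = 1800 * X ^ 2 := by ring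
    rw [← hX]
    simp only [buildConst]
    omega

theorem regs_get_inp (l : List InputSymbol) :
    Function.update (fun _ => []) Reg.inp l =
      (Regs.mk l [] [] [] [] [] [] [] [] [] [] [] []).get := by
  funext k; cases k <;> rfl

theorem regs_get_out (l : List InputSymbol) :
    Function.update (fun _ => []) Reg.out l =
      (Regs.mk [] l [] [] [] [] [] [] [] [] [] [] []).get := by
  funext k; cases k <;> rfl

open Polynomial in
-- The case in which the weights and the prefix do not depend on the input: they are pushed as
-- constants before the instance is read.
theorem computable_encodeReduced {ι κ : Type} {ea : ι → List InputSymbol}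
    {eb : κ → List InputSymbol} {f : ι → κ} (pre : List InputSymbol) (sw : Bool) (α π : ℚ)
    (y : Bool) (c : ℕ)
    (h : ∀ a, ∃ s t l, ea a = ticks s ++ .comma :: (ticks t ++ .comma :: l) ∧
      eb (f a) = encodeReduced pre sw α y (encodeRat π) (encodeRat (1 - π)) c s t l) :
    Nonempty (Turing.TM2ComputableInPolyTime ea eb f) := by
  obtain ⟨K, hK⟩ : ∃ K, K = 2 * ((encodeRat π).length + (encodeRat (1 - π)).length) +
    buildConst pre α + 10 := ⟨_, rfl⟩
  refine computableInPolyTime (seq (push .w1 (encodeRat π).reverse)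
    (seq (push .w2 (encodeRat (1 - π)).reverse) (seq (push .m (ticks c)) (seq readStart
    (build pre sw α y))))) .inp .out (C 5000 * (X + C (c + 1)) ^ 2 + C 2 * X + C K) fun a => ?_
  obtain ⟨s, t, l, e₁, e₂⟩ := h a
  rw [regs_get_inp, regs_get_out, e₂]
  have h₁ := push_runs Reg.w1 (encodeRat π).reverse
    (Regs.mk (ea a) [] [] [] [] [] [] [] [] [] [] [] []).get
  rw [Regs.update_w1] at h₁
  have h₂ := push_runs Reg.w2 (encodeRat (1 - π)).reverse
    (Regs.mk (ea a) [] [] [] [] [] [] [] (encodeRat π).reverse [] [] [] []).get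
  rw [Regs.update_w2] at h₂
  have h₃ := push_runs Reg.m (ticks c) (Regs.mk (ea a) [] [] [] [] [] [] [] (encodeRat π).reverse
    (encodeRat (1 - π)).reverse [] [] []).get
  rw [Regs.update_m] at h₃
  have h₄ := readStart_runs_ticks s (ticks t ++ .comma :: l) (Regs.mk (ea a) [] [] [] []
    (ticks c) [] [] (encodeRat π).reverse (encodeRat (1 - π)).reverse [] [] []) e₁
  have h₅ := build_runs pre sw α y c s t l (encodeRat π).reverse (encodeRat (1 - π)).reverse
  simp only [Regs.get, List.append_nil] at h₁ h₂ h₃ h₄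
  simp only [List.reverse_reverse] at h₅
  refine (h₁.seq (h₂.seq (h₃.seq (h₄.seq h₅)))).mono ?_
  have hl : (ea a).length = s + t + l.length + 2 := by
    rw [e₁]; simp; omega
  simp only [eval_add, eval_mul, eval_C, eval_pow, eval_X, hl, List.length_reverse]
  have : (s + t + l.length + c + 1) ^ 2 ≤ (s + t + l.length + 2 + (c + 1)) ^ 2 :=
    Nat.pow_le_pow_left (by omega) 2
  omega

open Polynomial in
-- The case in which the threshold is read from the input; the coin reaches the target with
-- probability 1 - p.
theorem computable_encodeReduced_of_fraction {ι κ : Type} {ea : ι → List InputSymbol}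
    {eb : κ → List InputSymbol} {f : ι → κ} (sw : Bool) (α : ℚ) (y : Bool)
    (h : ∀ a, ∃ s t l, ∃ p : ℚ, 0 < p ∧ p < 1 ∧
      ea a = encodeRat p ++ (ticks s ++ .comma :: (ticks t ++ .comma :: l)) ∧
      eb (f a) = encodeReduced [] sw α y (encodeRat (1 - p)) (encodeRat p)
        ((Computability.encodeNat p.den).length + (Computability.encodeNat p.num.natAbs).length)
        s t l) :
    Nonempty (Turing.TM2ComputableInPolyTime ea eb f) := by
  refine computableInPolyTime (seq readFraction (build [] sw α y)) .inp .out
    (C 5000 * (X + C 1) ^ 2 + C 100 * X + C (buildConst [] α + 100)) fun a => ?_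
  obtain ⟨s, t, l, p, hp₀, hp₁, e₁, e₂⟩ := h a
  rw [regs_get_inp, regs_get_out, e₂]
  obtain ⟨hlt, e₃⟩ := encodeRat_one_sub hp₀ hp₁
  have e₄ : encodeRat p = bitSymbols (Computability.encodeNat p.num.natAbs) ++ .slash ::
    bitSymbols (Computability.encodeNat p.den) := rfl
  have h₁ := readFraction_runs hlt s (ticks t ++ .comma :: l)
  have h₂ := build_runs [] sw α y
    ((Computability.encodeNat p.den).length + (Computability.encodeNat p.num.natAbs).length) s t l
    (encodeRat (1 - p)).reverse (encodeRat p).reverse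
  have e₅ : ea a = bitSymbols (Computability.encodeNat p.num.natAbs) ++ .slash ::
        (bitSymbols (Computability.encodeNat p.den) ++ (ticks s ++ .comma ::
        (ticks t ++ .comma :: l))) := by
    rw [e₁, e₄, List.append_assoc, List.cons_append]
  rw [← e₅, ← e₃, ← e₄] at h₁
  simp only [List.reverse_reverse] at h₂
  refine (h₁.seq h₂).mono ?_
  have hl : (ea a).length = (Computability.encodeNat p.num.natAbs).length +
      (Computability.encodeNat p.den).length + s + t + l.length + 3 := by
    rw [e₅]; simp; omega
  have hl' := encodeNat_length_le (show p.den - p.num.natAbs ≤ p.den by omega)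
  simp only [eval_add, eval_mul, eval_C, eval_pow, eval_X, hl, List.length_reverse, e₃, e₄]
  have : (s + t + l.length + ((Computability.encodeNat p.den).length +
      (Computability.encodeNat p.num.natAbs).length) + 1) ^ 2 ≤
      ((Computability.encodeNat p.num.natAbs).length +
      (Computability.encodeNat p.den).length + s + t + l.length + 3 + 1) ^ 2 :=
    Nat.pow_le_pow_left (by omega) 2
  simp
  omega

end StackProgram

/-! ### The initial state of a play -/

theorem ProbabilityTheory.Kernel.trajMeasure_dirac_zero {X : ℕ → Type}
    [∀ n, MeasurableSpace (X n)] {κ : (n : ℕ) → Kernel (∀ i : Finset.Iic n, X i) (X (n + 1))}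
    [∀ n, IsMarkovKernel (κ n)] (x₀ : X 0) {A : Set (X 0)} (hA : MeasurableSet A) :
    Kernel.trajMeasure (Measure.dirac x₀) κ {π | π 0 ∈ A} = A.indicator 1 x₀ := by
  have hm' : ∀ (n : ℕ) (i : Finset.Iic n) (A : Set (X i)), MeasurableSet A →
      MeasurableSet {h : (j : Finset.Iic n) → X j | h i ∈ A} :=
    fun n i A hA => measurable_pi_apply i hA
  have hm := hm' 0 ⟨0, by simp⟩ A hA
  have e₁ : trajMeasure (Measure.dirac x₀) κ =
      traj κ 0 ((MeasurableEquiv.piUnique fun i : Finset.Iic 0 => X i).symm x₀) := by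
    have e₂ := Measure.map_dirac'
      (f := (MeasurableEquiv.piUnique fun i : Finset.Iic 0 => X i).symm)
      (MeasurableEquiv.measurable _) x₀
    exact (congrArg (fun ν => ν.bind (traj κ 0)) e₂).trans
      (Measure.dirac_bind (Kernel.measurable _) _)
  rw [e₁]
  have h := congrArg (fun κ => κ ((MeasurableEquiv.piUnique fun i : Finset.Iic 0 => X i).symm
    x₀) {h : (j : Finset.Iic 0) → X j | h ⟨0, by simp⟩ ∈ A})
    (traj_map_frestrictLe (κ := κ) 0 0)
  beta_reduce at h
  rw [Kernel.map_apply' _ (by fun_prop) _ hm, partialTraj_self, Kernel.id_apply,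
    Measure.dirac_apply' _ hm] at h
  exact h

/-! ### The probability of reaching the target -/

namespace ArrivalInstance

variable (G : ArrivalInstance) (σ : G.Strategy .maxPlayer) (τ : G.Strategy .minPlayer)

/-- The expected value of `g` at the next state. -/
noncomputable def stepExp (g : G.State → ℝ) (x : G.State) : ℝ :=
  ∑ y, (G.stepPMF σ τ x y).toReal * g y

theorem stepPMF_target {x : G.State} (h : x.1 = G.t) : G.stepPMF σ τ x = PMF.pure x := by
  have h' := (G.kind_eq_none_iff x.1).2 h
  unfold stepPMF
  split
  · rfl
  all_goals rename_i e; rw [h'] at e; cases e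

theorem stepPMF_random {x : G.State} (h : G.kind x.1 = some .random) :
    G.stepPMF σ τ x = (G.randomStep ⟨x.1, h⟩).map fun w => (w, x.2) := by
  unfold stepPMF
  split <;> first | rfl | (rename_i e; rw [h] at e; cases e)

theorem stepPMF_switching {x : G.State} (h : G.kind x.1 = some .switching) :
    G.stepPMF σ τ x = PMF.pure (G.switchStep ⟨x.1, h⟩ x.2) := by
  unfold stepPMF
  split <;> first | rfl | (rename_i e; rw [h] at e; cases e)

theorem stepPMF_max {x : G.State} (h : G.kind x.1 = some .maxPlayer) :
    G.stepPMF σ τ x = PMF.pure ((σ (⟨x.1, h⟩, x.2) : Fin G.n), x.2) := by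
  unfold stepPMF
  split <;> first | rfl | (rename_i e; rw [h] at e; cases e)

theorem stepPMF_min {x : G.State} (h : G.kind x.1 = some .minPlayer) :
    G.stepPMF σ τ x = PMF.pure ((τ (⟨x.1, h⟩, x.2) : Fin G.n), x.2) := by
  unfold stepPMF
  split <;> first | rfl | (rename_i e; rw [h] at e; cases e)

theorem stepExp_of_pure (g : G.State → ℝ) {x y : G.State} (h : G.stepPMF σ τ x = PMF.pure y) :
    G.stepExp σ τ g x = g y := by
  rw [stepExp, h, Finset.sum_eq_single y]
  · simp
  · intro z _ hz; simp [PMF.pure_apply, hz]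
  · simp

theorem stepExp_target (g : G.State → ℝ) {x : G.State} (h : x.1 = G.t) :
    G.stepExp σ τ g x = g x :=
  G.stepExp_of_pure σ τ g (G.stepPMF_target σ τ h)

theorem stepExp_switching (g : G.State → ℝ) {x : G.State} (h : G.kind x.1 = some .switching) :
    G.stepExp σ τ g x = g (G.switchStep ⟨x.1, h⟩ x.2) :=
  G.stepExp_of_pure σ τ g (G.stepPMF_switching σ τ h)

theorem stepExp_max (g : G.State → ℝ) {x : G.State} (h : G.kind x.1 = some .maxPlayer) :
    G.stepExp σ τ g x = g ((σ (⟨x.1, h⟩, x.2) : Fin G.n), x.2) :=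
  G.stepExp_of_pure σ τ g (G.stepPMF_max σ τ h)

theorem stepExp_min (g : G.State → ℝ) {x : G.State} (h : G.kind x.1 = some .minPlayer) :
    G.stepExp σ τ g x = g ((τ (⟨x.1, h⟩, x.2) : Fin G.n), x.2) :=
  G.stepExp_of_pure σ τ g (G.stepPMF_min σ τ h)

theorem stepPMF_random_apply {x : G.State} (h : G.kind x.1 = some .random) (y : G.State) :
    (G.stepPMF σ τ x y).toReal = if y.2 = x.2 then (G.P x.1 y.1 : ℝ) else 0 := by
  rw [stepPMF_random G σ τ h, PMF.map_apply, tsum_fintype]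
  split_ifs with hy
  · rw [Finset.sum_eq_single y.1]
    · rw [if_pos (by rw [← hy])]
      exact ENNReal.toReal_ofReal (by exact_mod_cast G.P_nonneg _ _)
    · intro w _ hw
      rw [if_neg]
      intro e
      exact hw (by rw [e])
    · simp
  · rw [Finset.sum_eq_zero, ENNReal.toReal_zero]
    intro w _
    rw [if_neg]
    intro e
    exact hy (by rw [e])

theorem stepExp_random (g : G.State → ℝ) {x : G.State} (h : G.kind x.1 = some .random) :
    G.stepExp σ τ g x = ∑ w, (G.P x.1 w : ℝ) * g (w, x.2) := by
  simp only [stepExp, G.stepPMF_random_apply σ τ h, ite_mul, zero_mul]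
  rw [Fintype.sum_prod_type]
  refine Finset.sum_congr rfl fun w _ => ?_
  simp

theorem sum_stepPMF (x : G.State) : ∑ y, (G.stepPMF σ τ x y).toReal = 1 := by
  rw [← ENNReal.toReal_sum fun y _ => PMF.apply_ne_top _ _,
    show ∑ y, G.stepPMF σ τ x y = 1 by rw [← PMF.tsum_coe (G.stepPMF σ τ x), tsum_fintype]]
  rfl

theorem stepExp_mono {g g' : G.State → ℝ} (h : ∀ x, g x ≤ g' x) (x : G.State) :
    G.stepExp σ τ g x ≤ G.stepExp σ τ g' x :=
  Finset.sum_le_sum fun y _ => mul_le_mul_of_nonneg_left (h y) ENNReal.toReal_nonneg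

theorem stepExp_const (c : ℝ) (x : G.State) : G.stepExp σ τ (fun _ => c) x = c := by
  rw [stepExp, ← Finset.sum_mul, sum_stepPMF, one_mul]

/-- The probability of being at the target after `k` steps. -/
noncomputable def reachIn : ℕ → G.State → ℝ
  | 0 => fun x => if x.1 = G.t then 1 else 0
  | k + 1 => G.stepExp σ τ (reachIn k)

theorem reachIn_target (k : ℕ) {x : G.State} (h : x.1 = G.t) : G.reachIn σ τ k x = 1 := by
  induction k with
  | zero => simp [reachIn, h]
  | succ k ih => rw [reachIn, stepExp_target G σ τ _ h, ih]

theorem reachIn_nonneg (k : ℕ) (x : G.State) : 0 ≤ G.reachIn σ τ k x := by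
  induction k generalizing x with
  | zero => simp only [reachIn]; split_ifs <;> norm_num
  | succ k ih => rw [← G.stepExp_const σ τ 0 x]; exact G.stepExp_mono σ τ ih x

theorem reachIn_le_one (k : ℕ) (x : G.State) : G.reachIn σ τ k x ≤ 1 := by
  induction k generalizing x with
  | zero => simp only [reachIn]; split_ifs <;> norm_num
  | succ k ih => rw [← G.stepExp_const σ τ 1 x]; exact G.stepExp_mono σ τ ih x

theorem reachIn_le_succ (k : ℕ) (x : G.State) : G.reachIn σ τ k x ≤ G.reachIn σ τ (k + 1) x := by
  induction k generalizing x with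
  | zero =>
    by_cases h : x.1 = G.t
    · rw [G.reachIn_target σ τ _ h, G.reachIn_target σ τ _ h]
    · have : G.reachIn σ τ 0 x = 0 := by simp [reachIn, h]
      rw [this]
      exact G.reachIn_nonneg σ τ _ _
  | succ k ih => exact G.stepExp_mono σ τ ih x

/-- The probability of reaching the target from a state. -/
noncomputable def reach (x : G.State) : ℝ := ⨆ k, G.reachIn σ τ k x

theorem bddAbove_reachIn (x : G.State) : BddAbove (Set.range fun k => G.reachIn σ τ k x) :=
  ⟨1, by rintro _ ⟨k, rfl⟩; exact G.reachIn_le_one σ τ k x⟩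

open Filter Topology in
theorem tendsto_reachIn (x : G.State) :
    Tendsto (fun k => G.reachIn σ τ k x) atTop (𝓝 (G.reach σ τ x)) :=
  tendsto_atTop_ciSup (monotone_nat_of_le_succ fun k => G.reachIn_le_succ σ τ k x)
    (G.bddAbove_reachIn σ τ x)

theorem reach_target {x : G.State} (h : x.1 = G.t) : G.reach σ τ x = 1 := by
  simp [reach, G.reachIn_target σ τ _ h]

theorem reach_nonneg (x : G.State) : 0 ≤ G.reach σ τ x :=
  Real.iSup_nonneg fun k => G.reachIn_nonneg σ τ k x

theorem reach_le_one (x : G.State) : G.reach σ τ x ≤ 1 :=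
  ciSup_le fun k => G.reachIn_le_one σ τ k x

/-- Pass to the limit in the recursion of `reachIn`; the expectation is a finite sum. -/
theorem reach_eq_stepExp (x : G.State) :
    G.reach σ τ x = G.stepExp σ τ (G.reach σ τ) x := by
  refine tendsto_nhds_unique ((G.tendsto_reachIn σ τ x).comp (Filter.tendsto_add_atTop_nat 1)) ?_
  exact tendsto_finsetSum _ fun y _ => (G.tendsto_reachIn σ τ y).const_mul _

/-! ### The measure on plays -/

instance : IsProbabilityMeasure (G.playMeasure σ τ) := by
  unfold playMeasure; infer_instance

/-- The Markov property. The kernel looks only at the last state of the history, so the integrand is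
constant where the play is in x at time k and vanishes elsewhere. -/
theorem playMeasure_pair (k : ℕ) (x y : G.State) :
    G.playMeasure σ τ {π | π k = x ∧ π (k + 1) = y} =
      G.playMeasure σ τ {π | π k = x} * G.stepPMF σ τ x y := by
  have key := Kernel.map_frestrictLe_trajMeasure_compProd_eq_map_trajMeasure
    (X := fun _ => G.State) (μ₀ := Measure.dirac G.initialState) (a := k)
    (κ := fun i => (G.stepKernel σ τ).comap (fun h : (j : Finset.Iic i) → G.State =>
      h ⟨i, by simp⟩) (measurable_pi_apply _))
  have hm : MeasurableSet {p : ((j : Finset.Iic k) → G.State) × G.State |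
      p.1 ⟨k, by simp⟩ = x ∧ p.2 = y} := by
    refine MeasurableSet.inter
      (s₁ := {p : ((j : Finset.Iic k) → G.State) × G.State | p.1 ⟨k, by simp⟩ = x})
      (s₂ := {p : ((j : Finset.Iic k) → G.State) × G.State | p.2 = y}) ?_ ?_
    · exact ((measurable_pi_apply (X := fun _ => G.State) (⟨k, by simp⟩ : Finset.Iic k)).comp
        measurable_fst) (MeasurableSet.singleton x)
    · exact measurable_snd (MeasurableSet.singleton y)
  have h := congrArg (fun μ => μ {p : ((j : Finset.Iic k) → G.State) × G.State |
    p.1 ⟨k, by simp⟩ = x ∧ p.2 = y}) key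
  beta_reduce at h
  rw [Measure.compProd_apply hm, Measure.map_apply (by fun_prop) hm, lintegral_map
    (Kernel.measurable_kernel_prodMk_left hm) (by fun_prop)] at h
  refine Eq.trans ?_ (h.symm.trans ?_)
  · rfl
  · have hx : MeasurableSet {π : ℕ → G.State | π k = x} :=
      measurable_pi_apply (X := fun _ => G.State) k (MeasurableSet.singleton x)
    rw [mul_comm, ← lintegral_indicator_const hx]
    refine lintegral_congr fun π => ?_
    rw [Kernel.comap_apply]
    show (G.stepPMF σ τ (π k)).toMeasure {z | π k = x ∧ z = y} = _
    by_cases hπ : π k = x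
    · rw [Set.indicator_of_mem (by exact hπ), hπ]
      simp only [true_and]
      exact PMF.toMeasure_apply_singleton _ _ (MeasurableSet.singleton y)
    · rw [Set.indicator_of_notMem (by exact hπ)]
      simp [hπ]

/-- The probability of being in a state at time `k`. -/
noncomputable def law (k : ℕ) (x : G.State) : ℝ := (G.playMeasure σ τ).real {π | π k = x}

theorem measurableSet_eq (k : ℕ) (x : G.State) :
    MeasurableSet {π : ℕ → G.State | π k = x} :=
  measurable_pi_apply (X := fun _ => G.State) k (MeasurableSet.singleton x)

theorem law_succ (k : ℕ) (y : G.State) :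
    G.law σ τ (k + 1) y = ∑ x, G.law σ τ k x * (G.stepPMF σ τ x y).toReal := by
  have h : {π : ℕ → G.State | π (k + 1) = y} =
      ⋃ x ∈ (Finset.univ : Finset G.State), {π | π k = x ∧ π (k + 1) = y} := by
    ext π; simp
  rw [law, h, measureReal_biUnion_finset]
  · refine Finset.sum_congr rfl fun x _ => ?_
    rw [measureReal_def, playMeasure_pair, ENNReal.toReal_mul]
    rfl
  · intro x _ x' _ hx
    refine Set.disjoint_left.2 fun π h₁ h₂ => hx ?_
    exact h₁.1.symm.trans h₂.1
  · intro x _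
    exact (G.measurableSet_eq k x).inter (G.measurableSet_eq (k + 1) y)

theorem law_zero (x : G.State) : G.law σ τ 0 x = if x = G.initialState then 1 else 0 := by
  rw [law, measureReal_def, playMeasure]
  have := Kernel.trajMeasure_dirac_zero (X := fun _ => G.State) (κ := fun i =>
      (G.stepKernel σ τ).comap (fun h : (j : Finset.Iic i) → G.State =>
      h ⟨i, by simp⟩) (measurable_pi_apply _)) G.initialState (MeasurableSet.singleton x)
  refine (congrArg ENNReal.toReal this).trans ?_
  by_cases hx : x = G.initialState
  · rw [Set.indicator_of_mem (by exact hx.symm), if_pos hx]; rfl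
  · rw [Set.indicator_of_notMem (fun h' => hx h'.symm), if_neg hx]; rfl

/-- Links the forward description of a play by its laws with the backward recursion: k of the k + j
steps are moved from one to the other. -/
theorem sum_law_mul_reachIn (k j : ℕ) :
    ∑ x, G.law σ τ k x * G.reachIn σ τ j x = G.reachIn σ τ (k + j) G.initialState := by
  induction k generalizing j with
  | zero => simp [law_zero]
  | succ k ih =>
    rw [show k + 1 + j = k + (j + 1) by ring, ← ih]
    simp only [law_succ, Finset.sum_mul, reachIn, stepExp, Finset.mul_sum]
    rw [Finset.sum_comm]
    refine Finset.sum_congr rfl fun x _ => Finset.sum_congr rfl fun y _ => by ring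

theorem playMeasure_target (k : ℕ) :
    (G.playMeasure σ τ).real {π | (π k).1 = G.t} = G.reachIn σ τ k G.initialState := by
  have h : {π : ℕ → G.State | (π k).1 = G.t} =
      ⋃ x ∈ (Finset.univ.filter fun x : G.State => x.1 = G.t), {π | π k = x} := by
    ext π; simp
  rw [h, measureReal_biUnion_finset]
  · have := G.sum_law_mul_reachIn σ τ k 0
    rw [add_zero] at this
    rw [← this, Finset.sum_filter]
    refine Finset.sum_congr rfl fun x _ => ?_
    simp only [reachIn, mul_ite, mul_one, mul_zero]
    rfl
  · intro x _ x' _ hx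
    exact Set.disjoint_left.2 fun π h₁ h₂ => hx (h₁.symm.trans h₂)
  · intro x _
    exact G.measurableSet_eq k x

theorem ae_target_succ (k : ℕ) :
    ∀ᵐ π ∂G.playMeasure σ τ, (π k).1 = G.t → (π (k + 1)).1 = G.t := by
  have h : ∀ x y : G.State, ∀ᵐ π ∂G.playMeasure σ τ,
      x.1 = G.t → y.1 ≠ G.t → ¬ (π k = x ∧ π (k + 1) = y) := by
    intro x y
    by_cases hx : x.1 = G.t
    · by_cases hy : y.1 = G.t
      · exact .of_forall fun π _ h => absurd hy h
      · refine (?_ : ∀ᵐ π ∂G.playMeasure σ τ, ¬ (π k = x ∧ π (k + 1) = y)).mono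
          fun π h _ _ => h
        rw [ae_iff]
        simp only [not_not]
        rw [playMeasure_pair, stepPMF_target G σ τ hx, PMF.pure_apply, if_neg, mul_zero]
        rintro rfl
        exact hy hx
    · exact .of_forall fun π h => absurd h hx
  have h' := ae_all_iff.2 fun x => ae_all_iff.2 (h x)
  filter_upwards [h'] with π hπ hk
  by_contra hy
  exact hπ _ _ hk hy ⟨rfl, rfl⟩

open Filter Topology in
-- The target is almost surely absorbing, so having visited it by time k agrees almost surely with
-- being there at time k. Continuity of the measure along the increasing union gives the limit.
theorem playMeasure_reach :
    (G.playMeasure σ τ).real G.Reach = G.reach σ τ G.initialState := by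
  have hae := ae_all_iff.2 (G.ae_target_succ σ τ)
  have h₁ : G.Reach = ⋃ k, {π | (π k).1 = G.t} := by ext π; simp [Reach]
  have h₂ := tendsto_measure_iUnion_accumulate (μ := G.playMeasure σ τ)
    (f := fun k => {π : ℕ → G.State | (π k).1 = G.t})
  rw [← h₁] at h₂
  have h₃ : ∀ k, G.playMeasure σ τ (Set.accumulate
      (fun k => {π : ℕ → G.State | (π k).1 = G.t}) k) =
      G.playMeasure σ τ {π | (π k).1 = G.t} := by
    intro k
    refine measure_congr ?_
    filter_upwards [hae] with π hπ
    refine propext ⟨fun h => ?_, fun h => Set.mem_accumulate.2 ⟨k, le_rfl, h⟩⟩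
    obtain ⟨i, hi, h⟩ := Set.mem_accumulate.1 h
    exact Nat.le_induction h (fun j _ hj => hπ j hj) k hi
  simp only [h₃] at h₂
  refine tendsto_nhds_unique ?_ (G.tendsto_reachIn σ τ _)
  have := (ENNReal.tendsto_toReal (measure_ne_top (G.playMeasure σ τ) G.Reach)).comp h₂
  refine this.congr fun k => ?_
  exact G.playMeasure_target σ τ k

end ArrivalInstance

/-! ### The value and optimal strategies -/

namespace ArrivalInstance

variable (G : ArrivalInstance)

instance (k : NodeKind) : Nonempty (G.Strategy k) :=
  ⟨fun x => ⟨(G.exists_out x.1).choose, (G.exists_out x.1).choose_spec⟩⟩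

theorem val_eq : G.val = ⨆ σ, ⨅ τ, G.reach σ τ G.initialState := by
  simp only [val, playMeasure_reach]

theorem exists_strategies : ∃ σ τ, G.val = G.reach σ τ G.initialState := by
  obtain ⟨σ, hσ⟩ := exists_eq_ciSup_of_finite
    (f := fun σ => ⨅ τ, G.reach σ τ G.initialState)
  obtain ⟨τ, hτ⟩ := exists_eq_ciInf_of_finite (f := fun τ => G.reach σ τ G.initialState)
  exact ⟨σ, τ, by rw [val_eq, ← hσ, ← hτ]⟩

theorem exists_max_strategy : ∃ σ, ∀ τ, G.val ≤ G.reach σ τ G.initialState := by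
  obtain ⟨σ, hσ⟩ := exists_eq_ciSup_of_finite
    (f := fun σ => ⨅ τ, G.reach σ τ G.initialState)
  refine ⟨σ, fun τ => ?_⟩
  rw [val_eq, ← hσ]
  exact ciInf_le (Set.finite_range _).bddBelow τ

theorem exists_min_strategy (σ : G.Strategy .maxPlayer) :
    ∃ τ, G.reach σ τ G.initialState ≤ G.val := by
  obtain ⟨τ, hτ⟩ := exists_eq_ciInf_of_finite (f := fun τ => G.reach σ τ G.initialState)
  refine ⟨τ, ?_⟩
  rw [hτ, val_eq]
  exact le_ciSup (f := fun σ => ⨅ τ, G.reach σ τ G.initialState) (Set.finite_range _).bddAbove σ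

theorem le_val {c : ℝ} {σ : G.Strategy .maxPlayer}
    (h : ∀ τ, c ≤ G.reach σ τ G.initialState) : c ≤ G.val := by
  obtain ⟨τ, hτ⟩ := G.exists_min_strategy σ
  exact (h τ).trans hτ

theorem val_le {c : ℝ} (h : ∀ σ, ∃ τ, G.reach σ τ G.initialState ≤ c) : G.val ≤ c := by
  obtain ⟨σ, hσ⟩ := G.exists_max_strategy
  obtain ⟨τ, hτ⟩ := h σ
  exact (hσ τ).trans hτ

theorem val_nonneg : 0 ≤ G.val := by
  obtain ⟨σ, τ, h⟩ := G.exists_strategies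
  exact h ▸ G.reach_nonneg σ τ _

theorem val_le_one : G.val ≤ 1 := by
  obtain ⟨σ, τ, h⟩ := G.exists_strategies
  exact h ▸ G.reach_le_one σ τ _

end ArrivalInstance

/-! ### The denominator of the value -/

/-- Expanding the right side gives one nonnegative term for each map of the index set to itself; the
terms of the determinant correspond to the bijective maps only. -/
theorem Matrix.abs_det_le_prod_sum {ι : Type*} [Fintype ι] [DecidableEq ι] (A : Matrix ι ι ℝ) :
    |A.det| ≤ ∏ i, ∑ j, |A i j| := by
  rw [← Matrix.det_transpose, Matrix.det_apply, Finset.prod_univ_sum, Fintype.piFinset_univ]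
  refine (Finset.abs_sum_le_sum_abs _ _).trans ?_
  have h : ∀ e : Equiv.Perm ι, |Equiv.Perm.sign e • ∏ i, A.transpose (e i) i| =
      ∏ i, |A i (e i)| := by
    intro e
    rw [Units.smul_def, zsmul_eq_mul, abs_mul, Finset.abs_prod]
    rcases Int.units_eq_one_or (Equiv.Perm.sign e) with h | h <;> simp [h, Matrix.transpose_apply]
  simp only [h]
  refine (Finset.sum_map Finset.univ
    (⟨fun e : Equiv.Perm ι => (e : ι → ι), DFunLike.coe_injective⟩ : Equiv.Perm ι ↪ (ι → ι))
    (fun f : ι → ι => ∏ i, |A i (f i)|)).symm.trans_le ?_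
  exact Finset.sum_le_sum_of_subset_of_nonneg (Finset.subset_univ _)
    fun f _ _ => Finset.prod_nonneg fun i _ => abs_nonneg _

namespace ArrivalInstance

variable (G : ArrivalInstance) (σ : G.Strategy .maxPlayer) (τ : G.Strategy .minPlayer)

/-- A common denominator of the probabilities at a vertex. -/
def commonDen (v : Fin G.n) : ℕ := ∏ w, (G.P v w).den

theorem commonDen_pos (v : Fin G.n) : 0 < G.commonDen v :=
  Finset.prod_pos fun w _ => (G.P v w).den_pos

theorem exists_int_mul_P (v w : Fin G.n) : ∃ z : ℤ, (G.commonDen v : ℝ) * (G.P v w : ℝ) = z := by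
  obtain ⟨k, hk⟩ : (G.P v w).den ∣ G.commonDen v := Finset.dvd_prod_of_mem _ (Finset.mem_univ w)
  refine ⟨k * (G.P v w).num, ?_⟩
  rw [hk]
  have : ((G.P v w : ℚ) : ℝ) * ((G.P v w).den : ℝ) = ((G.P v w).num : ℝ) := by
    exact_mod_cast congrArg (Rat.cast : ℚ → ℝ) (Rat.mul_den_eq_num (G.P v w))
  push_cast
  rw [← this]
  ring

theorem exists_int_mul_stepPMF (x y : G.State) :
    ∃ z : ℤ, (G.commonDen x.1 : ℝ) * (G.stepPMF σ τ x y).toReal = z := by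
  have key : ∀ z, G.stepPMF σ τ x = PMF.pure z →
      ∃ z : ℤ, (G.commonDen x.1 : ℝ) * (G.stepPMF σ τ x y).toReal = z := by
    intro z hz
    rw [hz, PMF.pure_apply]
    split_ifs
    · exact ⟨G.commonDen x.1, by simp⟩
    · exact ⟨0, by simp⟩
  rcases h : G.kind x.1 with _ | k
  · exact key _ (G.stepPMF_target σ τ ((G.kind_eq_none_iff _).1 h))
  · cases k
    · rw [stepPMF_random_apply G σ τ h]
      split_ifs
      · exact G.exists_int_mul_P _ _
      · exact ⟨0, by simp⟩
    · exact key _ (G.stepPMF_switching σ τ h)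
    · exact key _ (G.stepPMF_max σ τ h)
    · exact key _ (G.stepPMF_min σ τ h)

/-- The states from which the target has not been reached, but can be reached. -/
abbrev Transient : Type := {x : G.State // x.1 ≠ G.t ∧ 0 < G.reach σ τ x}

/-- A function that vanishes on non-transient states and is harmonic on transient ones is zero. -/
theorem eq_zero_of_harmonic (u : G.State → ℝ)
    (h₀ : ∀ x, ¬ (x.1 ≠ G.t ∧ 0 < G.reach σ τ x) → u x = 0)
    (h₁ : ∀ x, x.1 ≠ G.t ∧ 0 < G.reach σ τ x → u x = G.stepExp σ τ u x) : u = 0 := by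
  by_contra hu
  obtain ⟨x₀, hx₀⟩ := Function.ne_iff.1 hu
  obtain ⟨x₁, -, hx₁⟩ := Finset.exists_max_image Finset.univ (fun x => |u x|)
    ⟨x₀, Finset.mem_univ _⟩
  have hpos : 0 < |u x₁| := (abs_pos.2 hx₀).trans_le (hx₁ x₀ (Finset.mem_univ _))
  -- Maximum principle: where |u| is maximal, it is also maximal at every successor of positive
  -- probability, since otherwise the average would be strictly smaller. As u vanishes at the
  -- target, the target is never reached from such a state.
  have key : ∀ k x, |u x| = |u x₁| → G.reachIn σ τ k x = 0 := by
    intro k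
    induction k with
    | zero =>
      intro x hx
      have : x.1 ≠ G.t := by
        by_contra hxt
        rw [h₀ x (fun h => h.1 hxt), abs_zero] at hx
        exact hpos.ne hx
      simp [reachIn, this]
    | succ k ih =>
      intro x hx
      have hxZ : x.1 ≠ G.t ∧ 0 < G.reach σ τ x := by
        by_contra hxt
        rw [h₀ x hxt, abs_zero] at hx
        exact hpos.ne hx
      rw [reachIn, stepExp]
      refine Finset.sum_eq_zero fun y _ => ?_
      by_cases hy : |u y| = |u x₁|
      · rw [ih y hy, mul_zero]
      · suffices (G.stepPMF σ τ x y).toReal = 0 by rw [this, zero_mul]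
        by_contra hp
        have hp' : 0 < (G.stepPMF σ τ x y).toReal :=
          lt_of_le_of_ne ENNReal.toReal_nonneg (Ne.symm hp)
        have h₂ : |u x| ≤ ∑ y, (G.stepPMF σ τ x y).toReal * |u y| := by
          rw [h₁ x hxZ, stepExp]
          refine (Finset.abs_sum_le_sum_abs _ _).trans (Finset.sum_le_sum fun z _ => ?_)
          rw [abs_mul, abs_of_nonneg ENNReal.toReal_nonneg]
        have h₃ : ∑ y, (G.stepPMF σ τ x y).toReal * |u y| <
            ∑ y, (G.stepPMF σ τ x y).toReal * |u x₁| := by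
          refine Finset.sum_lt_sum (fun z _ => mul_le_mul_of_nonneg_left (hx₁ z (Finset.mem_univ _))
            ENNReal.toReal_nonneg) ⟨y, Finset.mem_univ _, ?_⟩
          exact mul_lt_mul_of_pos_left (lt_of_le_of_ne (hx₁ y (Finset.mem_univ _)) hy) hp'
        rw [← Finset.sum_mul, sum_stepPMF, one_mul] at h₃
        exact (h₂.trans_lt h₃).ne hx
  have hx₁Z : x₁.1 ≠ G.t ∧ 0 < G.reach σ τ x₁ := by
    by_contra hxt
    rw [h₀ x₁ hxt, abs_zero] at hpos
    exact lt_irrefl _ hpos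
  have : G.reach σ τ x₁ = 0 := by simp [reach, fun k => key k x₁ rfl]
  exact hx₁Z.2.ne' this

open Classical in
theorem sum_transient (F : G.State → ℝ) : ∑ y : G.Transient σ τ, F y.1 =
    ∑ y, if y.1 ≠ G.t ∧ 0 < G.reach σ τ y then F y else 0 := by
  rw [← Finset.sum_filter]
  exact (Finset.sum_subtype _ (by simp) F).symm

/-- Cramer's rule for the system that the hitting probabilities satisfy on the transient states,
with each row multiplied by its common denominator. States that cannot reach the target are left
out, as they could make the matrix singular. The denominator is the absolute value of the
determinant. -/
theorem exists_reach_den (x : G.State) : ∃ d : ℕ, 0 < d ∧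
    d ≤ (∏ v, 2 * G.commonDen v) ^ Fintype.card G.Position ∧
    ∃ z : ℤ, (d : ℝ) * G.reach σ τ x = z := by
  classical
  choose zf hzf using G.exists_int_mul_stepPMF σ τ
  obtain ⟨M, hM⟩ : ∃ M : Matrix (G.Transient σ τ) (G.Transient σ τ) ℤ, ∀ x y, M x y =
    (if x = y then (G.commonDen x.1.1 : ℤ) else 0) - zf x.1 y.1 := ⟨fun _ _ => _, fun _ _ => rfl⟩
  obtain ⟨A, hAM⟩ : ∃ A : Matrix (G.Transient σ τ) (G.Transient σ τ) ℝ,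
    A = M.map (Int.cast : ℤ → ℝ) := ⟨_, rfl⟩
  have hdet : A.det = (M.det : ℝ) := by rw [hAM]; exact (Int.cast_det M).symm
  have hA : ∀ x y : G.Transient σ τ, A x y = G.commonDen x.1.1 *
      ((if x = y then 1 else 0) - (G.stepPMF σ τ x.1 y.1).toReal) := by
    intro x y
    rw [hAM, Matrix.map_apply, hM, Int.cast_sub, ← hzf]
    split_ifs <;> push_cast <;> ring
  have hsumZ : ∀ (x : G.State) (u : G.State → ℝ),
      (∀ x, ¬ (x.1 ≠ G.t ∧ 0 < G.reach σ τ x) → u x = 0) → G.stepExp σ τ u x =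
        ∑ y : G.Transient σ τ, (G.stepPMF σ τ x y.1).toReal * u y.1 := by
    intro x u hu
    rw [stepExp, G.sum_transient σ τ fun y => (G.stepPMF σ τ x y).toReal * u y]
    refine Finset.sum_congr rfl fun y _ => ?_
    split_ifs with hy
    · rfl
    · rw [hu y hy, mul_zero]
  have hmul : ∀ (w : G.Transient σ τ → ℝ) (x : G.Transient σ τ), (A.mulVec w) x =
      G.commonDen x.1.1 *
      (w x - ∑ y : G.Transient σ τ, (G.stepPMF σ τ x.1 y.1).toReal * w y) := by
    intro w x
    simp only [Matrix.mulVec, dotProduct, hA, mul_assoc, ← Finset.mul_sum, sub_mul,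
      Finset.sum_sub_distrib, ite_mul, one_mul, zero_mul]
    rw [Finset.sum_ite_eq, if_pos (Finset.mem_univ x)]
  -- A vector in the kernel, extended by zero, is harmonic on the transient states.
  have hne : A.det ≠ 0 := by
    intro h0
    obtain ⟨w, hw, hAw⟩ := Matrix.exists_mulVec_eq_zero_iff.2 h0
    let u : G.State → ℝ := fun x => if h : x.1 ≠ G.t ∧ 0 < G.reach σ τ x then w ⟨x, h⟩ else 0
    have hu : u = 0 := by
      refine G.eq_zero_of_harmonic σ τ u (fun x hx => dif_neg hx) fun x hx => ?_
      rw [hsumZ x u fun x hx => dif_neg hx]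
      have h₁ := congrFun hAw ⟨x, hx⟩
      rw [hmul, Pi.zero_apply, mul_eq_zero] at h₁
      have h₂ := h₁.resolve_left (by exact_mod_cast (G.commonDen_pos _).ne')
      have h₃ : u x = w ⟨x, hx⟩ := dif_pos hx
      rw [h₃, sub_eq_zero.1 h₂]
      refine Finset.sum_congr rfl fun y _ => ?_
      rw [show u y.1 = w y from dif_pos y.2]
    refine hw (funext fun y => ?_)
    rw [← show u y.1 = w y from dif_pos y.2, hu]
    rfl
  refine ⟨M.det.natAbs, ?_, ?_, ?_⟩
  · rw [Int.natAbs_pos]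
    intro h
    rw [hdet, h] at hne
    simp at hne
  · have h₁ : |A.det| ≤ ∏ x : G.Transient σ τ, (2 * G.commonDen x.1.1 : ℝ) := by
      refine (Matrix.abs_det_le_prod_sum A).trans (Finset.prod_le_prod
        (fun _ _ => Finset.sum_nonneg fun _ _ => abs_nonneg _) fun x _ => ?_)
      -- Without the common denominator, the identity and the transition probabilities contribute at
      -- most one each to the row sum; hence the factor 2.
      have h₂ : ∀ y : G.Transient σ τ, |A x y| ≤ G.commonDen x.1.1 *
          ((if x = y then 1 else 0) + (G.stepPMF σ τ x.1 y.1).toReal) := by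
        intro y
        rw [hA, abs_mul, Nat.abs_cast]
        refine mul_le_mul_of_nonneg_left ((abs_sub _ _).trans ?_) (Nat.cast_nonneg _)
        rw [abs_of_nonneg (ENNReal.toReal_nonneg (a := G.stepPMF σ τ x.1 y.1))]
        split_ifs <;> simp
      refine (Finset.sum_le_sum fun y _ => h₂ y).trans ?_
      rw [← Finset.mul_sum, Finset.sum_add_distrib, mul_comm (2 : ℝ)]
      refine mul_le_mul_of_nonneg_left ?_ (Nat.cast_nonneg _)
      have h₃ : ∑ y : G.Transient σ τ, (G.stepPMF σ τ x.1 y.1).toReal ≤ 1 := by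
        rw [← G.sum_stepPMF σ τ x.1, G.sum_transient σ τ fun y => (G.stepPMF σ τ x.1 y).toReal]
        refine Finset.sum_le_sum fun y _ => ?_
        split_ifs
        exacts [le_rfl, ENNReal.toReal_nonneg]
      rw [Finset.sum_ite_eq, if_pos (Finset.mem_univ x)]
      linarith
    have h₂ : ∏ x : G.Transient σ τ, (2 * G.commonDen x.1.1 : ℝ) ≤
        ((∏ v, 2 * G.commonDen v) ^ Fintype.card G.Position : ℕ) := by
      -- All factors are at least one, so the product may run over all states. It then splits into
      -- one copy of the product over vertices for each position.
      have h₃ : ∏ x : G.Transient σ τ, (2 * G.commonDen x.1.1) ≤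
          ∏ x : G.State, 2 * G.commonDen x.1 := by
        rw [← Finset.prod_subtype (Finset.univ.filter fun x : G.State =>
          x.1 ≠ G.t ∧ 0 < G.reach σ τ x) (by simp) fun x => 2 * G.commonDen x.1]
        refine Finset.prod_le_prod_of_subset_of_one_le' (Finset.subset_univ _) fun x _ _ => ?_
        have := G.commonDen_pos x.1
        omega
      rw [Fintype.prod_prod_type] at h₃
      simp only [Finset.prod_const, Finset.card_univ, Finset.prod_pow] at h₃
      exact_mod_cast h₃
    rw [hdet] at h₁
    have := h₁.trans h₂
    rw [← Int.cast_abs, Int.abs_eq_natAbs] at this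
    exact_mod_cast this
  · suffices ∃ z : ℤ, (M.det : ℝ) * G.reach σ τ x = z by
      obtain ⟨z, hz⟩ := this
      have h : ((M.det.natAbs : ℕ) : ℝ) = ((M.det.natAbs : ℤ) : ℝ) := by simp
      rw [h]
      rcases Int.natAbs_eq M.det with h | h
      · exact ⟨z, by rw [← h, hz]⟩
      · refine ⟨-z, ?_⟩
        rw [show (M.det.natAbs : ℤ) = -M.det by omega, Int.cast_neg, Int.cast_neg, ← hz, neg_mul]
    by_cases hx : x.1 ≠ G.t ∧ 0 < G.reach σ τ x
    · let b : G.Transient σ τ → ℤ := fun x => ∑ y : G.State, if y.1 = G.t then zf x.1 y else 0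
      have hb : A.mulVec (fun y : G.Transient σ τ => G.reach σ τ y.1) = fun x => (b x : ℝ) := by
        funext x
        rw [hmul]
        simp only [b, Int.cast_sum]
        rw [reach_eq_stepExp, stepExp, G.sum_transient σ τ fun y =>
          (G.stepPMF σ τ x.1 y).toReal * G.reach σ τ y, ← Finset.sum_sub_distrib, Finset.mul_sum]
        refine Finset.sum_congr rfl fun y _ => ?_
        by_cases hyt : y.1 = G.t
        · rw [if_neg (fun h => h.1 hyt), if_pos hyt, G.reach_target σ τ hyt, ← hzf]
          ring
        · rw [if_neg hyt]
          by_cases hy : 0 < G.reach σ τ y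
          · rw [if_pos ⟨hyt, hy⟩]; simp
          · rw [if_neg (fun h => hy h.2), le_antisymm (not_lt.1 hy) (G.reach_nonneg σ τ y)]
            simp
      -- Multiplying by the adjugate, which has integer entries, leaves det · reach on the left.
      have h₁ := congrArg (fun u => (A.adjugate.mulVec u) ⟨x, hx⟩) hb
      simp only [Matrix.mulVec_mulVec, Matrix.adjugate_mul, Matrix.smul_mulVec, Matrix.one_mulVec,
        Pi.smul_apply, smul_eq_mul, hdet] at h₁
      rw [h₁]
      refine ⟨(M.adjugate.mulVec b) ⟨x, hx⟩, ?_⟩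
      have h₂ : A.adjugate = M.adjugate.map (Int.cast : ℤ → ℝ) :=
        by rw [hAM]; exact ((Int.castRingHom ℝ).map_adjugate M).symm
      rw [h₂]
      simp [Matrix.mulVec, dotProduct]
    · by_cases hxt : x.1 = G.t
      · exact ⟨M.det, by rw [G.reach_target σ τ hxt, mul_one]⟩
      · have : G.reach σ τ x = 0 := by
          have := G.reach_nonneg σ τ x
          by_contra h
          exact hx ⟨hxt, lt_of_le_of_ne this (Ne.symm h)⟩
        exact ⟨0, by rw [this]; simp⟩

end ArrivalInstance

/-! ### New vertices -/

namespace Row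

/-- The type of a new vertex. -/
def kind : Row → NodeKind
  | .one _ => .random
  | .two _ _ _ => .random
  | .sw _ _ => .switching

/-- The out-edges of a new vertex. -/
def Edge : Row → ℕ → Prop
  | .one a, w => w = a
  | .two a b _, w => w = a ∨ w = b
  | .sw a b, w => w = a ∨ w = b

instance (r : Row) (w : ℕ) : Decidable (r.Edge w) := by
  cases r <;> unfold Edge <;> infer_instance

/-- The transition probabilities at a new vertex. -/
def prob : Row → ℕ → ℚ
  | .one a, w => if w = a then 1 else 0
  | .two a b p, w => if w = a then p else if w = b then 1 - p else 0
  | .sw _ _, _ => 0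

/-- The switching order of a new vertex. -/
def order : Row → List ℕ
  | .sw a b => [a, b]
  | _ => []

/-- The new vertex fits into an instance with `N` vertices. -/
def Valid (N : ℕ) : Row → Prop
  | .one a => a < N
  | .two a b p => a < b ∧ b < N ∧ 0 < p ∧ p < 1
  | .sw a b => a < b ∧ b < N

variable {N : ℕ} {r : Row}

theorem Valid.order_lt (h : r.Valid N) : ∀ a ∈ r.order, a < N := by
  cases r <;> simp_all [order, Valid]
  omega

theorem Valid.exists_edge (h : r.Valid N) : ∃ w : Fin N, r.Edge w := by
  cases r with
  | one a => exact ⟨⟨a, h⟩, rfl⟩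
  | two a b p => exact ⟨⟨b, h.2.1⟩, .inr rfl⟩
  | sw a b => exact ⟨⟨b, h.2⟩, .inr rfl⟩

theorem Valid.prob_nonneg (h : r.Valid N) (w : ℕ) : 0 ≤ r.prob w := by
  cases r with
  | one a => simp only [prob]; split_ifs <;> norm_num
  | two a b p =>
    have := h.2.2
    simp only [prob]
    split_ifs <;> linarith
  | sw a b => exact le_rfl

theorem sum_fin_ite {M : Type*} [AddCommMonoid M] {a : ℕ} (h : a < N) (f : Fin N → M) :
    ∑ w : Fin N, (if (w : ℕ) = a then f w else 0) = f ⟨a, h⟩ := by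
  have : ∀ w : Fin N, (w : ℕ) = a ↔ w = ⟨a, h⟩ := fun w => by rw [Fin.ext_iff]
  simp [this]

theorem sum_prob_two {a b : ℕ} {p : ℚ} (hab : a < b) (hb : b < N) (f : Fin N → ℝ) :
    ∑ w : Fin N, ((Row.two a b p).prob w : ℝ) * f w =
      p * f ⟨a, hab.trans hb⟩ + (1 - p) * f ⟨b, hb⟩ := by
  have : ∀ w : Fin N, ((Row.two a b p).prob w : ℝ) * f w =
      (if (w : ℕ) = a then p * f w else 0) + (if (w : ℕ) = b then (1 - p) * f w else 0) := by
    intro w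
    simp only [prob]
    split_ifs <;> first | omega | (push_cast; ring)
  simp only [this, Finset.sum_add_distrib]
  rw [sum_fin_ite (hab.trans hb) fun w => (p : ℝ) * f w, sum_fin_ite hb fun w => (1 - p : ℝ) * f w]

theorem sum_prob_one {a : ℕ} (ha : a < N) (f : Fin N → ℝ) :
    ∑ w : Fin N, ((Row.one a).prob w : ℝ) * f w = f ⟨a, ha⟩ := by
  have : ∀ w : Fin N, ((Row.one a).prob w : ℝ) * f w = if (w : ℕ) = a then f w else 0 := by
    intro w
    simp only [prob]
    split_ifs <;> simp
  simp only [this]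
  exact sum_fin_ite ha f

theorem Valid.sum_prob (h : r.Valid N) (hr : r.kind = .random) : ∑ w : Fin N, r.prob w = 1 := by
  have key : ∑ w : Fin N, (r.prob w : ℝ) * 1 = 1 := by
    cases r with
    | one a => exact sum_prob_one h fun _ => 1
    | two a b p => exact (sum_prob_two h.1 h.2.1 fun _ => 1).trans (by ring)
    | sw a b => cases hr
  simp only [mul_one] at key
  exact_mod_cast key

theorem Valid.prob_pos_iff (h : r.Valid N) (hr : r.kind = .random) (w : ℕ) :
    0 < r.prob w ↔ r.Edge w := by
  cases r with
  | one a => simp only [prob, Edge]; split_ifs <;> simp_all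
  | two a b p =>
    have h₁ := h.2.2.1
    have h₂ := h.2.2.2
    simp only [prob, Edge]
    split_ifs <;> simp_all
  | sw a b => cases hr

theorem prob_eq_zero (hr : r.kind ≠ .random) (w : ℕ) : r.prob w = 0 := by
  cases r <;> simp_all [kind, prob]

theorem mem_order_iff (hr : r.kind = .switching) (w : ℕ) : w ∈ r.order ↔ r.Edge w := by
  cases r <;> simp_all [kind, order, Edge]

theorem order_eq_nil (hr : r.kind ≠ .switching) : r.order = [] := by
  cases r <;> simp_all [kind, order]

theorem kind_cases (r : Row) : r.kind = .random ∨ r.kind = .switching := by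
  cases r <;> simp [kind]

theorem filter_finRange (l : List (Fin N)) (hl : l.Pairwise (· < ·)) :
    (List.finRange N).filter (fun w => decide (w ∈ l)) = l := by
  refine List.Perm.eq_of_pairwise (le := (· < ·)) (fun a b _ _ h₁ h₂ => absurd h₁ h₂.asymm) ?_ hl ?_
  · exact (List.pairwise_lt_finRange N).filter _
  · refine (List.perm_ext_iff_of_nodup ((List.nodup_finRange N).filter _)
      (hl.imp fun h => h.ne)).2 fun a => ?_
    simp

/-- An instance lists out-edges by increasing vertex number. The condition a < b in `Valid` makes
this the order in which a row is written. -/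
theorem Valid.encode_eq (h : r.Valid N) :
    .node (some r.kind) :: (((List.finRange N).filter fun w : Fin N => r.Edge w).flatMap fun w =>
      .edge :: (encodeVertex w ++ .comma :: encodeRat (r.prob w))) ++
    (r.order.pmap Fin.mk h.order_lt).flatMap (fun w => .ord :: encodeVertex w) = r.encode := by
  have key : ∀ l : List (Fin N), l.Pairwise (· < ·) → (∀ w : Fin N, r.Edge w ↔ w ∈ l) →
      (List.finRange N).filter (fun w : Fin N => decide (r.Edge w)) = l := by
    intro l hl h
    refine Eq.trans ?_ (filter_finRange l hl)
    exact List.filter_congr fun w _ => decide_eq_decide.2 (h w)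
  cases r with
  | one a =>
    rw [key [⟨a, h⟩] (by simp) (by simp [Row.Edge, Fin.ext_iff])]
    simp [Row.encode, Row.kind, Row.order, Row.prob, encodeEdge, encodeVertex]
  | two a b p =>
    rw [key [⟨a, h.1.trans h.2.1⟩, ⟨b, h.2.1⟩] (by simpa using h.1)
      (by simp [Row.Edge, Fin.ext_iff])]
    simp [Row.encode, Row.kind, Row.order, Row.prob, encodeEdge, encodeVertex, h.1.ne']
  | sw a b =>
    rw [key [⟨a, h.1.trans h.2⟩, ⟨b, h.2⟩] (by simpa using h.1)
      (by simp [Row.Edge, Fin.ext_iff])]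
    simp [Row.encode, Row.kind, Row.order, Row.prob, encodeEdge, encodeVertex]

end Row

/-! ### Appending vertices to an instance -/

namespace ArrivalInstance

variable (G : ArrivalInstance) {k : ℕ}

open Classical in
/-- Append new vertices to an instance. -/
noncomputable abbrev extend (start : Fin (G.n + k)) (rows : Fin k → Row)
    (hrows : ∀ j, (rows j).Valid (G.n + k)) : ArrivalInstance where
  n := G.n + k
  E := Finset.univ.filter fun e => Fin.addCases
    (fun v => ∃ w, e.2 = Fin.castAdd k w ∧ (v, w) ∈ G.E) (fun j => (rows j).Edge e.2) e.1
  s := start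
  t := Fin.castAdd k G.t
  kind := Fin.addCases G.kind fun j => some (rows j).kind
  P v w := Fin.addCases (fun v => Fin.addCases (G.P v) (fun _ => 0) w) (fun j => (rows j).prob w) v
  Ord := Fin.addCases (fun v => (G.Ord v).map (Fin.castAdd k))
    fun j => (rows j).order.pmap Fin.mk (hrows j).order_lt
  exists_out := by
    refine Fin.addCases (fun v => ?_) fun j => ?_
    · obtain ⟨w, hw⟩ := G.exists_out v
      exact ⟨Fin.castAdd k w, by simpa using hw⟩
    · obtain ⟨w, hw⟩ := (hrows j).exists_edge
      exact ⟨w, by simpa using hw⟩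
  target_out v hv := by
    simp only [Finset.mem_filter, Finset.mem_univ, true_and, Fin.addCases_left] at hv
    obtain ⟨w, rfl, hw⟩ := hv
    rw [G.target_out w hw]
  kind_eq_none_iff := by
    refine Fin.addCases (fun v => ?_) fun j => ?_
    · simp [G.kind_eq_none_iff]
    · simp only [Fin.addCases_right, reduceCtorEq, false_iff, Fin.ext_iff, Fin.val_natAdd,
        Fin.val_castAdd]
      have := G.t.2
      omega
  P_nonneg v w := by
    refine Fin.addCases (fun v => ?_) (fun j => ?_) v
    · simp only [Fin.addCases_left]
      refine Fin.addCases (fun w => ?_) (fun j => ?_) w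
      · simpa using G.P_nonneg v w
      · simp
    · simpa using (hrows j).prob_nonneg w
  P_sum := by
    refine Fin.addCases (fun v => ?_) fun j => ?_
    · intro h
      simp only [Fin.addCases_left] at h ⊢
      rw [Fin.sum_univ_add]
      simpa using G.P_sum v h
    · intro h
      simp only [Fin.addCases_right, Option.some.injEq] at h ⊢
      exact (hrows j).sum_prob h
  P_pos_iff v w := by
    refine Fin.addCases (fun v => ?_) (fun j => ?_) v
    · intro h
      simp only [Fin.addCases_left, Finset.mem_filter, Finset.mem_univ, true_and] at h ⊢
      refine Fin.addCases (fun w => ?_) (fun j => ?_) w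
      · simpa using G.P_pos_iff v w h
      · simp only [Fin.addCases_right, lt_irrefl, false_iff, not_exists, not_and, Fin.ext_iff,
          Fin.val_natAdd, Fin.val_castAdd]
        intro w hw
        have := w.2
        omega
    · intro h
      simp only [Fin.addCases_right, Option.some.injEq, Finset.mem_filter, Finset.mem_univ,
        true_and] at h ⊢
      exact (hrows j).prob_pos_iff h w
  P_eq_zero v w := by
    refine Fin.addCases (fun v => ?_) (fun j => ?_) v
    · intro h
      simp only [Fin.addCases_left] at h ⊢
      refine Fin.addCases (fun w => ?_) (fun j => ?_) w
      · simpa using G.P_eq_zero v w h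
      · simp
    · intro h
      simp only [Fin.addCases_right, ne_eq, Option.some.injEq] at h ⊢
      exact Row.prob_eq_zero h w
  mem_Ord_iff v w := by
    refine Fin.addCases (fun v => ?_) (fun j => ?_) v
    · intro h
      simp only [Fin.addCases_left, Finset.mem_filter, Finset.mem_univ, true_and] at h ⊢
      simp only [List.mem_map, G.mem_Ord_iff v _ h]
      exact exists_congr fun u => by rw [and_comm, eq_comm]
    · intro h
      simp only [Fin.addCases_right, Option.some.injEq, Finset.mem_filter, Finset.mem_univ,
        true_and] at h ⊢
      rw [← Row.mem_order_iff h]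
      simp only [List.mem_pmap, Fin.ext_iff]
      exact ⟨fun ⟨a, ha, e⟩ => e ▸ ha, fun ha => ⟨_, ha, rfl⟩⟩
  Ord_eq_nil := by
    refine Fin.addCases (fun v => ?_) fun j => ?_
    · intro h
      simp only [Fin.addCases_left] at h ⊢
      rw [G.Ord_eq_nil v h, List.map_nil]
    · intro h
      simp only [Fin.addCases_right, ne_eq, Option.some.injEq] at h ⊢
      simp only [Row.order_eq_nil h, List.pmap_nil]

variable (start : Fin (G.n + k)) (rows : Fin k → Row) (hrows : ∀ j, (rows j).Valid (G.n + k))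

theorem extend_kind_old (v : Fin G.n) :
    (G.extend start rows hrows).kind (Fin.castAdd k v) = G.kind v := by
  simp

theorem extend_kind_new (j : Fin k) :
    (G.extend start rows hrows).kind (Fin.natAdd G.n j) = some (rows j).kind := by
  simp

theorem extend_edge_old (v : Fin G.n) (w : Fin (G.n + k)) :
    (Fin.castAdd k v, w) ∈ (G.extend start rows hrows).E ↔
      ∃ u, w = Fin.castAdd k u ∧ (v, u) ∈ G.E := by
  simp [extend]

theorem extend_edge_old_old (v w : Fin G.n) :
    (Fin.castAdd k v, Fin.castAdd k w) ∈ (G.extend start rows hrows).E ↔ (v, w) ∈ G.E := by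
  simp [extend]

theorem extend_edge_new (j : Fin k) (w : Fin (G.n + k)) :
    (Fin.natAdd G.n j, w) ∈ (G.extend start rows hrows).E ↔ (rows j).Edge w := by
  simp [extend]

theorem extend_P_old (v w : Fin G.n) :
    (G.extend start rows hrows).P (Fin.castAdd k v) (Fin.castAdd k w) = G.P v w := by
  simp

theorem extend_P_new (j : Fin k) (w : Fin (G.n + k)) :
    (G.extend start rows hrows).P (Fin.natAdd G.n j) w = (rows j).prob w := by
  simp

theorem extend_Ord_old (v : Fin G.n) :
    (G.extend start rows hrows).Ord (Fin.castAdd k v) = (G.Ord v).map (Fin.castAdd k) := by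
  simp [extend]

theorem extend_Ord_new (j : Fin k) :
    (G.extend start rows hrows).Ord (Fin.natAdd G.n j) =
      (rows j).order.pmap Fin.mk (hrows j).order_lt := by
  simp [extend]

theorem extend_kind_mem {B : Set NodeKind} (hG : ∀ v k, G.kind v = some k → k ∈ B)
    (hB : ∀ j, (rows j).kind ∈ B) :
    ∀ v k, (G.extend start rows hrows).kind v = some k → k ∈ B := by
  refine Fin.addCases (fun v => ?_) fun j => ?_
  · intro k' h
    rw [extend_kind_old] at h
    exact hG v k' h
  · intro k' h
    rw [extend_kind_new, Option.some.injEq] at h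
    exact h ▸ hB j

/-- The list of the vertices of an instance. -/
def encodeNodes : List InputSymbol := (List.finRange G.n).flatMap G.encodeNode

theorem finRange_add (n k : ℕ) : List.finRange (n + k) =
    (List.finRange n).map (Fin.castAdd k) ++ (List.finRange k).map (Fin.natAdd n) := by
  apply List.map_injective_iff.2 Fin.val_injective
  rw [List.map_append, List.map_map, List.map_map, List.map_coe_finRange_eq_range, List.range_add]
  congr 1
  · exact List.map_coe_finRange_eq_range.symm
  · rw [← List.map_coe_finRange_eq_range (n := k), List.map_map]
    rfl

/-- Old vertices keep their numbers and get no new out-edges, so the machine can copy their text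
verbatim. -/
theorem encodeNode_old (v : Fin G.n) :
    (G.extend start rows hrows).encodeNode (Fin.castAdd k v) = G.encodeNode v := by
  unfold encodeNode
  rw [extend_kind_old, extend_Ord_old]
  congr 1
  congr 1
  · have h := finRange_add G.n k
    rw [show List.finRange (G.extend start rows hrows).n = _ from h]
    rw [List.filter_append, List.filter_map, List.filter_map, List.flatMap_append]
    have h₁ : (List.finRange k).filter ((fun w => decide ((Fin.castAdd k v, w) ∈
        (G.extend start rows hrows).E)) ∘ Fin.natAdd G.n) = [] := by
      rw [List.filter_eq_nil_iff]
      intro j _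
      simp only [Function.comp, decide_eq_true_eq]
      rw [extend_edge_old]
      rintro ⟨u, hu, -⟩
      rw [Fin.ext_iff] at hu
      simp at hu
      have := u.2
      omega
    have h₂ : ((fun w => decide ((Fin.castAdd k v, w) ∈ (G.extend start rows hrows).E)) ∘
        Fin.castAdd k) = fun w => decide ((v, w) ∈ G.E) := by
      funext w
      simp only [Function.comp, decide_eq_decide]
      exact G.extend_edge_old_old start rows hrows v w
    rw [h₁, h₂, List.map_nil, List.flatMap_nil, List.append_nil, List.flatMap_map]
    congr 1
    funext w
    rw [extend_P_old]
    rfl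
  · rw [List.flatMap_map]
    rfl

theorem encodeNode_new (j : Fin k) :
    (G.extend start rows hrows).encodeNode (Fin.natAdd G.n j) = (rows j).encode := by
  rw [← (hrows j).encode_eq]
  unfold encodeNode
  rw [extend_kind_new, extend_Ord_new]
  congr 2
  have hE : (fun w => decide ((Fin.natAdd G.n j, w) ∈ (G.extend start rows hrows).E)) =
      fun w : Fin (G.n + k) => decide ((rows j).Edge w) := by
    funext w
    rw [decide_eq_decide]
    exact G.extend_edge_new start rows hrows j w
  rw [hE]
  congr 1
  funext w
  rw [G.extend_P_new start rows hrows j w]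

theorem encode_extend : (G.extend start rows hrows).encode =
    ticks start ++ .comma :: (ticks G.t ++ .comma :: (G.encodeNodes ++
      (List.finRange k).flatMap fun j => (rows j).encode)) := by
  unfold encode
  rw [show List.finRange (G.extend start rows hrows).n = _ from finRange_add G.n k,
    List.flatMap_append, List.flatMap_map, List.flatMap_map]
  have h₁ : (fun v => (G.extend start rows hrows).encodeNode (Fin.castAdd k v)) = G.encodeNode :=
    funext fun v => G.encodeNode_old start rows hrows v
  have h₂ : (fun j => (G.extend start rows hrows).encodeNode (Fin.natAdd G.n j)) =
      fun j => (rows j).encode := funext fun j => G.encodeNode_new start rows hrows j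
  rw [h₁, h₂]
  rfl

end ArrivalInstance

/-! ### The reduced instance -/

/-- The new vertices: a vertex that leads to `s` or to the second new vertex, a vertex that leads
to the target or to the sink, the sink, a chain of `m + 1` vertices, and the last vertex. -/
def reducedRow (sw : Bool) (α π : ℚ) (y : Bool) (s t n m : ℕ) : ℕ → Row
  | 0 => .two s (n + 1) α
  | 1 => .two t (n + 2) π
  | 2 => .one (n + 2)
  | 3 => .chain false n (n + 4)
  | j + 4 => if j < m then .chain sw n (n + 5 + j) else .one (if y then t else n + 2)

theorem reducedRow_add_four (sw : Bool) (α π : ℚ) (y : Bool) (s t n m j : ℕ) :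
    reducedRow sw α π y s t n m (j + 4) =
      if j < m then .chain sw n (n + 5 + j) else .one (if y then t else n + 2) := rfl

theorem Row.chain_valid {sw : Bool} {n b N : ℕ} (hb : n + 3 < b) (hN : b < N) :
    (Row.chain sw n b).Valid N := by
  cases sw <;> simp only [Row.chain, Row.Valid, if_true, if_false, Bool.false_eq_true]
  · refine ⟨by omega, hN, by norm_num, by norm_num⟩
  · exact ⟨hb, hN⟩

theorem reducedRow_valid {sw : Bool} {α π : ℚ} (hα : 0 < α ∧ α < 1) (hπ : 0 < π ∧ π < 1) {y : Bool}
    {s t n m : ℕ} (hs : s < n) (ht : t < n) (j : ℕ) (hj : j < m + 5) :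
    (reducedRow sw α π y s t n m j).Valid (n + (m + 5)) := by
  match j with
  | 0 => exact ⟨by omega, by omega, hα⟩
  | 1 => exact ⟨by omega, by omega, hπ⟩
  | 2 => exact (by omega : n + 2 < n + (m + 5))
  | 3 => exact Row.chain_valid (by omega : n + 3 < n + 4) (by omega)
  | j + 4 =>
    rw [reducedRow_add_four]
    split_ifs
    · exact Row.chain_valid (by omega : n + 3 < n + 5 + j) (by omega)
    · exact (by omega : t < n + (m + 5))
    · exact (by omega : n + 2 < n + (m + 5))

theorem reducedRow_kind_mem {B : Set NodeKind} (hB : .random ∈ B) {sw : Bool}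
    (hsw : sw = true → .switching ∈ B) (α π : ℚ) (y : Bool) (s t n m j : ℕ) :
    (reducedRow sw α π y s t n m j).kind ∈ B := by
  have h : ∀ b, (Row.chain sw n b).kind ∈ B := by
    intro b
    cases sw
    · exact hB
    · exact hsw rfl
  match j with
  | 0 | 1 | 2 | 3 => exact hB
  | j + 4 =>
    rw [reducedRow_add_four]
    split_ifs
    · exact h _
    · exact hB
    · exact hB

theorem flatMap_reducedRow (sw : Bool) (α π : ℚ) (y : Bool) (s t n m : ℕ) :
    ((List.finRange (m + 5)).flatMap fun j : Fin (m + 5) =>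
      (reducedRow sw α π y s t n m j).encode) =
      encodeNewNodes sw α y (encodeRat π) (encodeRat (1 - π)) s t n m := by
  have h₁ : ((List.finRange (m + 5)).flatMap fun j : Fin (m + 5) =>
      (reducedRow sw α π y s t n m j).encode) =
      (List.range (m + 5)).flatMap fun j => (reducedRow sw α π y s t n m j).encode := by
    rw [← List.map_coe_finRange_eq_range, List.flatMap_map]
  have h₂ : List.range (m + 5) = [0, 1, 2, 3] ++ ((List.range m).map (4 + ·) ++ [m + 4]) := by
    rw [show m + 5 = 4 + (m + 1) by omega, List.range_add, List.range_succ (n := m),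
      List.map_append, add_comm m 4]
    rfl
  have h₃ : ((List.range m).flatMap fun j => (reducedRow sw α π y s t n m (4 + j)).encode) =
      (List.range m).flatMap fun j => (Row.chain sw n (n + 5 + j)).encode := by
    refine List.flatMap_congr fun j hj => ?_
    rw [add_comm 4 j]
    simp only [reducedRow, List.mem_range.1 hj, if_true]
  rw [h₁, h₂, List.flatMap_append, List.flatMap_append, List.flatMap_map, h₃]
  simp [reducedRow, encodeNewNodes, Row.encode, encodeEdge]

namespace ArrivalInstance

open StackProgram

variable (G : ArrivalInstance)

/-- The instance to which an instance is reduced. -/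
noncomputable abbrev reduced (sw : Bool) {α π : ℚ} (hα : 0 < α ∧ α < 1) (hπ : 0 < π ∧ π < 1)
    (y : Bool) (m : ℕ) : ArrivalInstance :=
  G.extend (k := m + 5) ⟨G.n + 3, by omega⟩ (fun j => reducedRow sw α π y G.s G.t G.n m j)
    fun j => reducedRow_valid hα hπ G.s.2 G.t.2 j j.2

theorem nodeCount_append (l₁ l₂ : List InputSymbol) :
    nodeCount (l₁ ++ l₂) = nodeCount l₁ + nodeCount l₂ := List.countP_append

theorem nodeCount_eq_zero {l : List InputSymbol} (h : ∀ k, .node k ∉ l) : nodeCount l = 0 := by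
  refine List.countP_eq_zero.2 fun a ha => ?_
  cases a <;> simp
  exact h _ ha

theorem nodeCount_encodeNode (v : Fin G.n) : nodeCount (G.encodeNode v) = 1 := by
  unfold encodeNode
  rw [List.cons_append, nodeCount_cons, nodeCount_eq_zero]
  · rfl
  · simp [encodeVertex, encodeRat, List.mem_replicate]

theorem nodeCount_encodeNodes : nodeCount G.encodeNodes = G.n := by
  have : ∀ l : List (Fin G.n), nodeCount (l.flatMap G.encodeNode) = l.length := by
    intro l
    induction l with
    | nil => rfl
    | cons v l ih =>
      rw [List.flatMap_cons, nodeCount_append, nodeCount_encodeNode, ih, List.length_cons, add_comm]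
  rw [encodeNodes, this, List.length_finRange]

/-- The meeting point of the two halves of the proof: the string written by the machine is the
encoding of the instance whose value is computed below. -/
theorem encode_reduced (pre : List InputSymbol) (sw : Bool) {α π : ℚ} (hα : 0 < α ∧ α < 1)
    (hπ : 0 < π ∧ π < 1) (y : Bool) (c : ℕ) :
    pre ++ (G.reduced sw hα hπ y (2 * G.encodeNodes.length + c)).encode =
      encodeReduced pre sw α y (encodeRat π) (encodeRat (1 - π)) c G.s G.t G.encodeNodes := by
  rw [encode_extend, flatMap_reducedRow, encodeReduced, nodeCount_encodeNodes]

/-! ### The length of the encoding bounds the probabilities -/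

theorem length_flatMap_filter {n : ℕ} {β : Type*} (p : Fin n → Bool) (f : Fin n → List β) :
    (((List.finRange n).filter p).flatMap f).length =
      ∑ w, if p w then (f w).length else 0 := by
  rw [Fin.sum_univ_def]
  generalize List.finRange n = l
  induction l with
  | nil => rfl
  | cons a l ih =>
    rw [List.filter_cons, List.map_cons, List.sum_cons, ← ih]
    split_ifs <;> simp

theorem length_encodeNodes : G.encodeNodes.length = ∑ v, (G.encodeNode v).length := by
  have := length_flatMap_filter (fun _ => true) G.encodeNode
  simpa [encodeNodes] using this

/-- A denominator is less than 2 to its number of binary digits, all of which appear in the text of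
the edge. Off the edges the probability is zero, with denominator one. -/
theorem P_den_le (v w : Fin G.n) :
    (G.P v w).den ≤ 2 ^ (if (v, w) ∈ G.E then
      (.edge :: (encodeVertex w ++ .comma :: encodeRat (G.P v w)) : List InputSymbol).length
      else 0) := by
  by_cases h : (v, w) ∈ G.E
  · rw [if_pos h]
    have h₁ := bitsVal_lt (Computability.encodeNat (G.P v w).den)
    rw [bitsVal_encodeNat] at h₁
    refine h₁.le.trans (Nat.pow_le_pow_right two_pos ?_)
    simp [encodeRat]
    omega
  · have : G.P v w = 0 := by
      by_cases hv : G.kind v = some .random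
      · exact le_antisymm (not_lt.1 fun h' => h ((G.P_pos_iff v w hv).1 h')) (G.P_nonneg v w)
      · exact G.P_eq_zero v w hv
    simp [h, this]

theorem two_mul_commonDen_le (v : Fin G.n) :
    2 * G.commonDen v ≤ 2 ^ (G.encodeNode v).length := by
  have h : G.commonDen v ≤ 2 ^ ((((List.finRange G.n).filter fun w => (v, w) ∈ G.E).flatMap fun w =>
      .edge :: (encodeVertex w ++ .comma :: encodeRat (G.P v w))) : List InputSymbol).length := by
    rw [length_flatMap_filter, ← Finset.prod_pow_eq_pow_sum]
    refine Finset.prod_le_prod' fun w _ => ?_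
    simpa using G.P_den_le v w
  rw [encodeNode, List.length_append, List.length_cons, Nat.add_right_comm, pow_succ, mul_comm]
  exact Nat.mul_le_mul_right _ (h.trans (Nat.pow_le_pow_right two_pos (Nat.le_add_right _ _)))

theorem prod_two_mul_commonDen_le :
    ∏ v, 2 * G.commonDen v ≤ 2 ^ G.encodeNodes.length := by
  rw [length_encodeNodes, ← Finset.prod_pow_eq_pow_sum]
  exact Finset.prod_le_prod' fun v _ => G.two_mul_commonDen_le v

theorem length_Ord_le (v : Fin G.n) : (G.Ord v).length ≤ (G.encodeNode v).length := by
  have : ∀ l : List (Fin G.n),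
      l.length ≤ (l.flatMap fun w => InputSymbol.ord :: encodeVertex w).length := by
    intro l
    induction l with
    | nil => exact le_rfl
    | cons a l ih =>
      rw [List.flatMap_cons, List.length_append, List.length_cons, List.length_cons]
      omega
  rw [encodeNode, List.length_append]
  exact (this _).trans (Nat.le_add_left _ _)

theorem card_position_le : Fintype.card G.Position ≤ 2 ^ G.encodeNodes.length := by
  rw [Fintype.card_pi]
  simp only [Fintype.card_fin]
  have h₁ : ∏ v : G.NodesOf .switching, (G.Ord v).length ≤
      ∏ v : G.NodesOf .switching, 2 ^ (G.encodeNode v).length :=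
    Finset.prod_le_prod' fun v _ => (G.length_Ord_le v).trans Nat.lt_two_pow_self.le
  refine h₁.trans ?_
  rw [Finset.prod_pow_eq_pow_sum]
  refine Nat.pow_le_pow_right two_pos ?_
  rw [length_encodeNodes, ← Finset.sum_subtype
    (Finset.univ.filter fun v => G.kind v = some .switching)
    (by simp) fun v => (G.encodeNode v).length]
  exact Finset.sum_le_sum_of_subset (Finset.subset_univ _)

theorem card_position_eq_one (h : ∀ v, G.kind v ≠ some .switching) :
    Fintype.card G.Position = 1 := by
  have : IsEmpty (G.NodesOf .switching) := ⟨fun v => h v v.2⟩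
  rw [Fintype.card_pi, Finset.univ_eq_empty, Finset.prod_empty]

/-- The probability to get from the start of a chain of `m + 1` vertices to its end in one go. -/
noncomputable def passProb (sw : Bool) (m : ℕ) : ℝ :=
  if sw then (1 / 2) ^ 2 ^ m else (1 / 2) ^ (m + 1)

theorem passProb_pos (sw : Bool) (m : ℕ) : 0 < passProb sw m := by
  unfold passProb
  split_ifs <;> positivity

theorem passProb_le_one (sw : Bool) (m : ℕ) : passProb sw m ≤ 1 := by
  unfold passProb
  split_ifs <;> exact pow_le_one₀ (by norm_num) (by norm_num)

/-- With l the length of the vertex list, d ≤ 2^(l · number of positions). For the switching chain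
there are at most 2^l positions, and 2^(2l + c) ≥ l·2^l + c; this is the reason for the factor 2 in
the length of the chain. For the random chain there is one position, and 2l + c + 1 ≥ l + c. The
spare factor 2^-c accounts for the threshold and the weights. -/
theorem passProb_le (sw : Bool) (hsw : sw = false → ∀ v, G.kind v ≠ some .switching) (c : ℕ) {d : ℕ}
    (hd : 0 < d) (h : d ≤ (∏ v, 2 * G.commonDen v) ^ Fintype.card G.Position) :
    passProb sw (2 * G.encodeNodes.length + c) ≤ (1 / 2) ^ c / d := by
  set l := G.encodeNodes.length with hl
  have key : ∀ e, l * Fintype.card G.Position + c ≤ e → (1 / 2 : ℝ) ^ e ≤ (1 / 2) ^ c / d := by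
    intro e he
    have h₁ : (d : ℝ) ≤ 2 ^ (l * Fintype.card G.Position) := by
      rw [pow_mul]
      exact_mod_cast h.trans (Nat.pow_le_pow_left G.prod_two_mul_commonDen_le _)
    rw [le_div_iff₀ (by exact_mod_cast hd)]
    calc (1 / 2 : ℝ) ^ e * d
        ≤ (1 / 2) ^ (l * Fintype.card G.Position + c) * 2 ^ (l * Fintype.card G.Position) := by
          refine mul_le_mul (pow_le_pow_of_le_one (by norm_num) (by norm_num) he) h₁ ?_ ?_ <;>
            positivity
      _ = (1 / 2) ^ c := by
          rw [pow_add, mul_right_comm, ← mul_pow]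
          norm_num
  unfold passProb
  split_ifs with hs
  · apply key
    have h₁ := G.card_position_le
    have h₂ : l < 2 ^ l := Nat.lt_two_pow_self
    have h₃ : c < 2 ^ c := Nat.lt_two_pow_self
    have h₄ : l * Fintype.card G.Position ≤ l * 2 ^ l := Nat.mul_le_mul_left _ h₁
    rw [pow_add, two_mul, pow_add]
    rw [← hl] at *
    generalize 2 ^ l = a at *
    generalize 2 ^ c = b at *
    nlinarith [Nat.mul_le_mul_right a (Nat.succ_le_of_lt h₂), Nat.mul_le_mul (show 1 ≤ a * a from
      Nat.mul_pos (by omega) (by omega)) (Nat.succ_le_of_lt h₃)]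
  · apply key
    rw [G.card_position_eq_one (hsw (by simpa using hs))]
    omega

end ArrivalInstance

/-! ### Plays of an extended instance -/

namespace ArrivalInstance

/-- The instance `H` consists of a copy of `G` and of further vertices which have no edges from
the copy. -/
structure IsExtension (G H : ArrivalInstance) (ι : Fin G.n → Fin H.n) : Prop where
  injective : Function.Injective ι
  kind_eq : ∀ v, H.kind (ι v) = G.kind v
  edge_iff : ∀ v w, (ι v, w) ∈ H.E ↔ ∃ u, w = ι u ∧ (v, u) ∈ G.E
  P_eq : ∀ v w, H.P (ι v) (ι w) = G.P v w
  Ord_eq : ∀ v, H.Ord (ι v) = (G.Ord v).map ι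

namespace IsExtension

variable {G H : ArrivalInstance} {ι : Fin G.n → Fin H.n} (hι : IsExtension G H ι)

/-- A vertex of the copy. -/
def node {κ : NodeKind} (v : G.NodesOf κ) : H.NodesOf κ := ⟨ι v, (hι.kind_eq v).trans v.2⟩

theorem node_injective {κ : NodeKind} : Function.Injective (hι.node (κ := κ)) := fun _ _ h =>
  Subtype.ext (hι.injective (congrArg Subtype.val h))

theorem map_target (hι : IsExtension G H ι) : ι G.t = H.t :=
  (H.kind_eq_none_iff _).1 ((hι.kind_eq _).trans ((G.kind_eq_none_iff _).2 rfl))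

theorem edge_map (hι : IsExtension G H ι) (v w : Fin G.n) : (ι v, ι w) ∈ H.E ↔ (v, w) ∈ G.E := by
  rw [hι.edge_iff]
  exact ⟨fun ⟨u, hu, h⟩ => hι.injective hu ▸ h, fun h => ⟨w, rfl, h⟩⟩

theorem P_eq_zero (hι : IsExtension G H ι) (v : Fin G.n) {w : Fin H.n}
    (hw : w ∉ Set.range ι) : H.P (ι v) w = 0 := by
  by_cases hv : H.kind (ι v) = some .random
  · refine le_antisymm (not_lt.1 fun h => ?_) (H.P_nonneg _ _)
    obtain ⟨u, rfl, -⟩ := (hι.edge_iff v w).1 ((H.P_pos_iff _ _ hv).1 h)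
    exact hw ⟨u, rfl⟩
  · exact H.P_eq_zero _ _ hv

theorem length_Ord (hι : IsExtension G H ι) (v : Fin G.n) :
    (H.Ord (ι v)).length = (G.Ord v).length := by
  rw [hι.Ord_eq, List.length_map]

open Classical in
/-- The position of `H` with the counters of the copy from `q` and the other ones from `c`. -/
noncomputable def combine (c : H.Position) (q : G.Position) : H.Position := fun v =>
  if h : ∃ u, hι.node u = v then
    ⟨q h.choose, by
      have e : ι h.choose = v := congrArg Subtype.val h.choose_spec
      rw [← e, hι.length_Ord]
      exact (q _).2⟩
  else c v

/-- The counters of the copy. -/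
def restrict (p : H.Position) : G.Position := fun v =>
  ⟨p (hι.node v), (p (hι.node v)).2.trans_eq (hι.length_Ord v)⟩

theorem combine_node (c : H.Position) (q : G.Position) (v : G.NodesOf .switching) :
    (hι.combine c q (hι.node v) : ℕ) = q v := by
  have h : ∃ u, hι.node u = hι.node v := ⟨v, rfl⟩
  have hv : h.choose = v := hι.node_injective h.choose_spec
  unfold combine
  rw [dif_pos h]
  show (q h.choose : ℕ) = q v
  rw [hv]

theorem combine_of_not (c : H.Position) (q : G.Position) {v : H.NodesOf .switching}
    (h : ¬ ∃ u, hι.node u = v) : hι.combine c q v = c v := dif_neg h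

theorem position_ext {p p' : H.Position} (h₁ : ∀ v, (p (hι.node v) : ℕ) = p' (hι.node v))
    (h₂ : ∀ v, (¬ ∃ u, hι.node u = v) → p v = p' v) : p = p' := by
  funext v
  by_cases h : ∃ u, hι.node u = v
  · obtain ⟨u, rfl⟩ := h
    exact Fin.ext (h₁ u)
  · exact h₂ v h

theorem restrict_combine (c : H.Position) (q : G.Position) : hι.restrict (hι.combine c q) = q :=
  funext fun v => Fin.ext (hι.combine_node c q v)

theorem combine_combine (c : H.Position) (q q' : G.Position) :
    hι.combine (hι.combine c q) q' = hι.combine c q' := by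
  refine hι.position_ext (fun v => ?_) fun v h => ?_
  · rw [combine_node, combine_node]
  · rw [hι.combine_of_not _ _ h, hι.combine_of_not _ _ h, hι.combine_of_not _ _ h]

/-- A state of the copy, where the other counters are given by `c`. -/
noncomputable def embed (c : H.Position) (x : G.State) : H.State := (ι x.1, hι.combine c x.2)

theorem switchStep_embed (c : H.Position) (v : G.NodesOf .switching) (q : G.Position) :
    H.switchStep (hι.node v) (hι.combine c q) = hι.embed c (G.switchStep v q) := by
  have hv := hι.combine_node c q v
  have hl := hι.length_Ord v
  refine Prod.ext ?_ ?_
  · simp only [switchStep, embed, List.get_eq_getElem, hv]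
    exact (List.getElem_of_eq (hι.Ord_eq v) _).trans (List.getElem_map _)
  · refine hι.position_ext (fun u => ?_) fun u hu => ?_
    · simp only [switchStep, embed]
      refine Eq.trans ?_ (hι.combine_node c _ u).symm
      by_cases huv : u = v
      · subst huv
        simp only [Function.update_self]
        rw [hv]
        exact congrArg _ hl
      · rw [Function.update_of_ne huv, Function.update_of_ne fun h => huv (hι.node_injective h),
          hι.combine_node]
    · simp only [switchStep, embed]
      rw [hι.combine_of_not _ _ hu, Function.update_of_ne, hι.combine_of_not _ _ hu]
      rintro rfl
      exact hu ⟨v, rfl⟩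

theorem exists_pull (hι : IsExtension G H ι) (v w) (h : (ι v, w) ∈ H.E) :
    ∃ u, w = ι u ∧ (v, u) ∈ G.E :=
  (hι.edge_iff v w).1 h

/-- The strategy on the copy given by a strategy on `H` and by the values of the other counters. -/
noncomputable def pull {κ : NodeKind} (c : H.Position) (σ : H.Strategy κ) : G.Strategy κ := fun x =>
  have h := hι.exists_pull x.1 _ (σ (hι.node x.1, hι.combine c x.2)).2
  ⟨h.choose, h.choose_spec.2⟩

theorem map_pull {κ : NodeKind} (c : H.Position) (σ : H.Strategy κ) (v : G.NodesOf κ)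
    (q : G.Position) :
    ι (hι.pull c σ (v, q)) = σ (hι.node v, hι.combine c q) :=
  (hι.exists_pull v _ (σ (hι.node v, hι.combine c q)).2).choose_spec.1.symm

/-- The pulled-back strategy sees only those counters of `c` that lie outside the copy. -/
theorem pull_combine {κ : NodeKind} (c : H.Position) (q : G.Position) (σ : H.Strategy κ) :
    hι.pull (hι.combine c q) σ = hι.pull c σ := by
  funext x
  refine Subtype.ext (hι.injective ?_)
  rw [hι.map_pull, hι.map_pull, combine_combine]

theorem edge_of_node (hι : IsExtension G H ι) {κ : NodeKind} {v : H.NodesOf κ}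
    {u : G.NodesOf κ} (h : hι.node u = v)
    {w : Fin G.n} (hw : ((u : Fin G.n), w) ∈ G.E) : ((v : Fin H.n), ι w) ∈ H.E := by
  subst h
  exact (hι.edge_map _ _).2 hw

/-- The strategy on `H` given by strategies on the copy that may depend on the values of the other
counters. -/
noncomputable def lift {κ : NodeKind} (hκ : ∀ v : H.NodesOf κ, ∃ u, hι.node u = v)
    (T : H.Position → G.Strategy κ) : H.Strategy κ := fun x =>
  let w := T (hι.combine x.2 G.initialPosition) ((hκ x.1).choose, hι.restrict x.2)
  ⟨ι w, hι.edge_of_node (hκ x.1).choose_spec w.2⟩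

/-- `lift` resets the copy's counters before it consults `T`, so the chosen strategy of G does not
change while the play moves inside the copy. -/
theorem pull_lift {κ : NodeKind} (hκ : ∀ v : H.NodesOf κ, ∃ u, hι.node u = v)
    (T : H.Position → G.Strategy κ) (c : H.Position) :
    hι.pull c (hι.lift hκ T) = T (hι.combine c G.initialPosition) := by
  funext x
  obtain ⟨v, q⟩ := x
  refine Subtype.ext (hι.injective ?_)
  have hv : (hκ (hι.node v)).choose = v := hι.node_injective (hκ (hι.node v)).choose_spec
  rw [hι.map_pull]
  simp only [lift, combine_combine]
  rw [hv, restrict_combine]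

variable (σ : H.Strategy .maxPlayer) (τ : H.Strategy .minPlayer)

/-- No edge leaves the copy, so the outer counters keep their values and each step is a step of G
under the pulled-back strategies. -/
theorem reachIn_embed (c : H.Position) (i : ℕ) (x : G.State) :
    H.reachIn σ τ i (hι.embed c x) = G.reachIn (hι.pull c σ) (hι.pull c τ) i x := by
  induction i generalizing x with
  | zero =>
    simp only [reachIn, embed]
    exact if_congr (by rw [← hι.map_target, hι.injective.eq_iff]) rfl rfl
  | succ i ih =>
    have hk : H.kind (hι.embed c x).1 = G.kind x.1 := hι.kind_eq x.1
    rw [reachIn, reachIn]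
    match h : G.kind x.1 with
    | none =>
      have ht := (G.kind_eq_none_iff _).1 h
      rw [stepExp_target _ _ _ _ ht,
        stepExp_target _ _ _ _ ((congrArg ι ht).trans hι.map_target), ih]
    | some .random =>
      rw [stepExp_random _ _ _ _ h, stepExp_random _ _ _ _ (hk.trans h)]
      refine (Fintype.sum_of_injective ι hι.injective _ _ (fun w hw => ?_) fun w => ?_).symm
      · show ((H.P (ι x.1) w : ℚ) : ℝ) * _ = 0
        rw [hι.P_eq_zero x.1 hw, Rat.cast_zero, zero_mul]
      · rw [← ih, ← hι.P_eq]
        rfl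
    | some .switching =>
      rw [stepExp_switching _ _ _ _ h, stepExp_switching _ _ _ _ (hk.trans h), ← ih]
      exact congrArg _ (hι.switchStep_embed c ⟨x.1, h⟩ x.2)
    | some .maxPlayer =>
      rw [stepExp_max _ _ _ _ h, stepExp_max _ _ _ _ (hk.trans h), ← ih]
      refine congrArg _ (Prod.ext ?_ rfl)
      exact (hι.map_pull c _ ⟨x.1, h⟩ x.2).symm
    | some .minPlayer =>
      rw [stepExp_min _ _ _ _ h, stepExp_min _ _ _ _ (hk.trans h), ← ih]
      refine congrArg _ (Prod.ext ?_ rfl)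
      exact (hι.map_pull c _ ⟨x.1, h⟩ x.2).symm

theorem reach_embed (c : H.Position) (x : G.State) :
    H.reach σ τ (hι.embed c x) = G.reach (hι.pull c σ) (hι.pull c τ) x := by
  simp only [reach, reachIn_embed]

/-- There is a max player strategy of `H` which secures the value of the copy, whatever the other
counters are. -/
theorem exists_max_strategy (hκ : ∀ v : H.NodesOf .maxPlayer, ∃ u, hι.node u = v) :
    ∃ σ : H.Strategy .maxPlayer, ∀ τ c, G.val ≤ H.reach σ τ (hι.embed c G.initialState) := by
  obtain ⟨σ, hσ⟩ := G.exists_max_strategy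
  refine ⟨hι.lift hκ fun _ => σ, fun τ c => ?_⟩
  rw [reach_embed, pull_lift]
  exact hσ _

/-- Against a max player strategy of `H` there is a min player strategy which secures the value of
the copy, whatever the other counters are. -/
theorem exists_min_strategy (hκ : ∀ v : H.NodesOf .minPlayer, ∃ u, hι.node u = v)
    (σ : H.Strategy .maxPlayer) :
    ∃ τ, ∀ c, H.reach σ τ (hι.embed c G.initialState) ≤ G.val := by
  -- The max player may use the outer counters, so the min player needs a best response for each
  -- value of them.
  choose T hT using fun c => G.exists_min_strategy (hι.pull c σ)
  refine ⟨hι.lift hκ T, fun c => ?_⟩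
  rw [reach_embed, pull_lift, ← hι.pull_combine c G.initialPosition]
  exact hT _

end IsExtension

variable (G : ArrivalInstance) {k : ℕ} (start : Fin (G.n + k)) (rows : Fin k → Row)
  (hrows : ∀ j, (rows j).Valid (G.n + k))

theorem isExtension_extend : IsExtension G (G.extend start rows hrows) (Fin.castAdd k) where
  injective := Fin.castAdd_injective _ _
  kind_eq := G.extend_kind_old start rows hrows
  edge_iff := G.extend_edge_old start rows hrows
  P_eq := G.extend_P_old start rows hrows
  Ord_eq := G.extend_Ord_old start rows hrows

/-- Applied to the two player types: new vertices are random or switching, so both players decide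
only inside the copy. -/
theorem exists_node_extend {κ : NodeKind} (hκ : ∀ j, (rows j).kind ≠ κ)
    (v : (G.extend start rows hrows).NodesOf κ) :
    ∃ u, (G.isExtension_extend start rows hrows).node u = v := by
  obtain ⟨v, hv⟩ := v
  revert hv
  refine Fin.addCases (fun v hv => ?_) (fun j hj => ?_) v
  · exact ⟨⟨v, (G.extend_kind_old start rows hrows v).symm.trans hv⟩, rfl⟩
  · exact absurd (Option.some.inj ((G.extend_kind_new start rows hrows j).symm.trans hj)) (hκ j)

end ArrivalInstance

/-! ### The value of the reduced instance -/

namespace ArrivalInstance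

/-! ### Passing the chain -/

section Chain

variable {V Q : Type*} (f : V → Q → ℝ) {h a : V} {g : ℕ → V} {m : ℕ} {lo hi : ℝ}

/-- A chain of random vertices, at each of which the play escapes to `a` with probability `1/2`. -/
theorem passProb_random (Z : Set Q) (ha : ∀ p ∈ Z, lo ≤ f a p ∧ f a p ≤ hi)
    (h₀ : ∀ p, f h p = 1 / 2 * f a p + 1 / 2 * f (g 0) p)
    (hg : ∀ j < m, ∀ p, f (g j) p = 1 / 2 * f a p + 1 / 2 * f (g (j + 1)) p) (j : ℕ) (hj : j ≤ m)
    (p : Q) (hp : p ∈ Z) :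
    (1 - passProb false j) * lo + passProb false j * f (g j) p ≤ f h p ∧
      f h p ≤ (1 - passProb false j) * hi + passProb false j * f (g j) p := by
  obtain ⟨hlo, hhi⟩ := ha p hp
  induction j with
  | zero =>
    rw [h₀]
    simp only [passProb, Bool.false_eq_true, if_false]
    constructor <;> linarith
  | succ j ih =>
    have hδ := passProb_pos false j
    have e : passProb false (j + 1) = passProb false j / 2 := by
      simp only [passProb, Bool.false_eq_true, if_false]
      rw [pow_succ _ (j + 1)]
      ring
    obtain ⟨h₁, h₂⟩ := ih (by omega)
    rw [hg j (by omega)] at h₁ h₂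
    rw [e]
    constructor <;> nlinarith

/-- A chain of switching vertices, from each of which the play returns to `h` the first time. -/
theorem passProb_switching (Z : ℕ → Set Q) (hZ : ∀ j, Z (j + 1) ⊆ Z j)
    (ha : ∀ p ∈ Z 0, lo ≤ f a p ∧ f a p ≤ hi)
    (h₀ : ∀ p, f h p = 1 / 2 * f a p + 1 / 2 * f (g 0) p)
    (hg : ∀ j < m, ∀ p ∈ Z (j + 1), ∃ p' ∈ Z j, f (g j) p = f h p' ∧ f (g j) p' = f (g (j + 1)) p)
    (j : ℕ) (hj : j ≤ m) (p : Q) (hp : p ∈ Z j) :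
    (1 - passProb true j) * lo + passProb true j * f (g j) p ≤ f h p ∧
      f h p ≤ (1 - passProb true j) * hi + passProb true j * f (g j) p := by
  induction j generalizing p with
  | zero =>
    obtain ⟨hlo, hhi⟩ := ha p hp
    rw [h₀]
    simp only [passProb, if_true]
    constructor <;> linarith
  | succ j ih =>
    have hδ := passProb_pos true j
    have e : passProb true (j + 1) = passProb true j * passProb true j := by
      simp only [passProb, if_true]
      rw [← pow_add, pow_succ, mul_two]
    -- The first arrival at `g j` sends the play back to `h` with this counter at one; the second
    -- lets it go on and restores p. So the initial part of the chain has to be passed twice, and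
    -- the probability is squared.
    obtain ⟨p', hp', e₁, e₂⟩ := hg j (by omega) p hp
    obtain ⟨h₁, h₂⟩ := ih (by omega) p (hZ j hp)
    obtain ⟨h₃, h₄⟩ := ih (by omega) p' hp'
    rw [e₁] at h₁ h₂
    rw [e₂] at h₃ h₄
    rw [e]
    constructor <;> nlinarith

end Chain

variable (G : ArrivalInstance)

/-! ### Transitions at new vertices -/

section Rows

variable {G} {k : ℕ} {start : Fin (G.n + k)} {rows : Fin k → Row}
  {hrows : ∀ j, (rows j).Valid (G.n + k)} (σ : (G.extend start rows hrows).Strategy .maxPlayer)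
  (τ : (G.extend start rows hrows).Strategy .minPlayer) {j : Fin k} {v w w' : Fin (G.n + k)}

theorem stepExp_one (hv : v = Fin.natAdd G.n j) (h : rows j = .one w)
    (F : (G.extend start rows hrows).State → ℝ) (p : (G.extend start rows hrows).Position) :
    (G.extend start rows hrows).stepExp σ τ F (v, p) = F (w, p) := by
  subst hv
  have hk := G.extend_kind_new start rows hrows j
  rw [h] at hk
  rw [stepExp_random _ _ _ _ hk]
  refine Eq.trans ?_ (Row.sum_prob_one w.2 fun w => F (w, p))
  refine Finset.sum_congr rfl fun u _ => ?_
  rw [← h]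
  exact congrArg (fun a : ℚ => (a : ℝ) * F (u, p)) (G.extend_P_new start rows hrows j u)

theorem stepExp_two {π : ℚ} (hv : v = Fin.natAdd G.n j) (h : rows j = .two w w' π)
    (F : (G.extend start rows hrows).State → ℝ) (p : (G.extend start rows hrows).Position) :
    (G.extend start rows hrows).stepExp σ τ F (v, p) = π * F (w, p) + (1 - π) * F (w', p) := by
  subst hv
  have hk := G.extend_kind_new start rows hrows j
  have hr := hrows j
  rw [h] at hk hr
  rw [stepExp_random _ _ _ _ hk]
  refine Eq.trans ?_ (Row.sum_prob_two hr.1 w'.2 fun w => F (w, p))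
  refine Finset.sum_congr rfl fun u _ => ?_
  rw [← h]
  exact congrArg (fun a : ℚ => (a : ℝ) * F (u, p)) (G.extend_P_new start rows hrows j u)

theorem extend_Ord_sw (h : rows j = .sw w w') :
    (G.extend start rows hrows).Ord (Fin.natAdd G.n j) = [w, w'] := by
  rw [extend_Ord_new]
  simp only [h]
  rfl

/-- Two consecutive visits to a new switching vertex whose counter is zero. After the second visit
the position is p again. -/
theorem stepExp_sw (hv : v = Fin.natAdd G.n j) (h : rows j = .sw w w')
    (F : (G.extend start rows hrows).State → ℝ) :
    ∃ hk : (G.extend start rows hrows).kind v = some .switching,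
      ∀ p : (G.extend start rows hrows).Position, (p ⟨v, hk⟩ : ℕ) = 0 →
        ∃ i, (Function.update p ⟨v, hk⟩ i ⟨v, hk⟩ : ℕ) = 1 ∧
          (G.extend start rows hrows).stepExp σ τ F (v, p) =
            F (w, Function.update p ⟨v, hk⟩ i) ∧
          (G.extend start rows hrows).stepExp σ τ F (v, Function.update p ⟨v, hk⟩ i) =
            F (w', p) := by
  subst hv
  have hk := G.extend_kind_new start rows hrows j
  rw [h] at hk
  have hO := extend_Ord_sw (start := start) (hrows := hrows) h
  have hl : ((G.extend start rows hrows).Ord (Fin.natAdd G.n j)).length = 2 := by rw [hO]; rfl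
  refine ⟨hk, fun p hp => ?_⟩
  have hi : 1 < ((G.extend start rows hrows).Ord (Fin.natAdd G.n j)).length := by omega
  refine ⟨⟨1, hi⟩, by rw [Function.update_self], ?_, ?_⟩
  · rw [stepExp_switching _ _ _ _ hk]
    refine congrArg F (Prod.ext ?_ ?_)
    · refine (List.getElem_of_eq hO _).trans ?_
      simp only [hp]
      rfl
    · refine congrArg (Function.update p _) (Fin.ext ?_)
      show ((p ⟨_, hk⟩ : ℕ) + 1) % _ = 1
      rw [hp]
      exact Nat.mod_eq_of_lt hi
  · rw [stepExp_switching _ _ _ _ hk]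
    refine congrArg F (Prod.ext ?_ ?_)
    · have key : ∀ (l : List (Fin (G.n + k))) (i : Fin l.length), l = [w, w'] → (i : ℕ) = 1 →
          l.get i = w' := by
        rintro _ ⟨i, hi⟩ rfl rfl
        rfl
      exact key _ _ hO (by
        show (Function.update p _ _ _ : Fin _).1 = 1
        rw [Function.update_self])
    · refine (Function.update_idem _ _ _).trans
        (Function.update_eq_iff.2 ⟨Fin.ext ?_, fun _ _ => rfl⟩)
      show ((Function.update p _ _ _ : Fin _).1 + 1) % _ = _
      rw [Function.update_self, hp]
      show 2 % _ = 0
      exact (congrArg (2 % ·) hl)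

end Rows

/-! ### Reaching the target in the reduced instance -/

section Reduced

variable {sw : Bool} {α π : ℚ} (hα : 0 < α ∧ α < 1) (hπ : 0 < π ∧ π < 1) (y : Bool) (m : ℕ)

theorem isExtension_reduced :
    IsExtension G (G.reduced sw hα hπ y m) (Fin.castAdd (m + 5)) :=
  G.isExtension_extend _ _ _

variable {G} in
/-- A new vertex of the reduced instance. -/
def newVertex (m i : ℕ) (hi : i < m + 5) : Fin (G.n + (m + 5)) := Fin.natAdd G.n ⟨i, hi⟩

variable {G hα hπ y m} (σ : (G.reduced sw hα hπ y m).Strategy .maxPlayer)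
  (τ : (G.reduced sw hα hπ y m).Strategy .minPlayer) (p : (G.reduced sw hα hπ y m).Position)

theorem reach_sink :
    (G.reduced sw hα hπ y m).reach σ τ (newVertex m 2 (by omega), p) = 0 := by
  have h : ∀ i, (G.reduced sw hα hπ y m).reachIn σ τ i (newVertex m 2 (by omega), p) = 0 := by
    intro i
    induction i with
    | zero =>
      refine if_neg fun h => ?_
      have h' : G.n + 2 = G.t := congrArg Fin.val h
      have := G.t.2
      omega
    | succ i ih =>
      refine (stepExp_one σ τ (w := newVertex m 2 (by omega)) rfl rfl _ p).trans ih
  simp only [reach, h, ciSup_const]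

theorem reach_second :
    (G.reduced sw hα hπ y m).reach σ τ (newVertex m 1 (by omega), p) = π := by
  rw [reach_eq_stepExp]
  refine (stepExp_two σ τ (w := Fin.castAdd (m + 5) G.t) (w' := newVertex m 2 (by omega)) rfl rfl
    _ p).trans ?_
  rw [reach_sink, reach_target _ _ _ rfl]
  ring

theorem reach_first :
    (G.reduced sw hα hπ y m).reach σ τ (newVertex m 0 (by omega), p) =
      α * (G.reduced sw hα hπ y m).reach σ τ (Fin.castAdd (m + 5) G.s, p) + (1 - α) * π := by
  rw [reach_eq_stepExp]
  refine (stepExp_two σ τ (w := Fin.castAdd (m + 5) G.s) (w' := newVertex m 1 (by omega)) rfl rfl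
    _ p).trans ?_
  rw [reach_second]

theorem reach_start :
    (G.reduced sw hα hπ y m).reach σ τ (newVertex m 3 (by omega), p) =
      1 / 2 * (G.reduced sw hα hπ y m).reach σ τ (newVertex m 0 (by omega), p) +
      1 / 2 * (G.reduced sw hα hπ y m).reach σ τ (newVertex m 4 (by omega), p) := by
  rw [reach_eq_stepExp]
  refine (stepExp_two σ τ (w := newVertex m 0 (by omega)) (w' := newVertex m 4 (by omega)) rfl rfl
    _ p).trans ?_
  norm_num

theorem reach_last :
    (G.reduced sw hα hπ y m).reach σ τ (newVertex m (m + 4) (by omega), p) =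
      if y then 1 else 0 := by
  rw [reach_eq_stepExp]
  have h : reducedRow sw α π y G.s G.t G.n m (m + 4) = .one (if y then G.t else G.n + 2) := by
    rw [reducedRow_add_four, if_neg (lt_irrefl m)]
  cases y
  · refine (stepExp_one σ τ (w := newVertex m 2 (by omega)) rfl h _ p).trans ?_
    rw [reach_sink]
    rfl
  · refine (stepExp_one σ τ (w := Fin.castAdd (m + 5) G.t) rfl h _ p).trans ?_
    rw [reach_target _ _ _ rfl]
    rfl

theorem reducedRow_chain {j : ℕ} (hj : j < m) :
    reducedRow sw α π y G.s G.t G.n m (j + 4) = .chain sw G.n (G.n + (j + 1 + 4)) := by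
  rw [reducedRow_add_four, if_pos hj]
  congr 1
  omega

theorem embed_initialState (hp : ∀ v, (v.1 : ℕ) < G.n → (p v : ℕ) = 0) :
    (Fin.castAdd (m + 5) G.s, p) = (G.isExtension_reduced hα hπ y m).embed p G.initialState := by
  refine Prod.ext rfl ?_
  refine (G.isExtension_reduced hα hπ y m).position_ext (fun v => ?_) fun v h => ?_
  · rw [hp _ v.1.2]
    exact ((G.isExtension_reduced hα hπ y m).combine_node p G.initialPosition v).symm
  · exact ((G.isExtension_reduced hα hπ y m).combine_of_not _ _ h).symm

/-- The value that is obtained from the start of the reduced instance if the value from the start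
of the copy is between `lo` and `hi`. -/
theorem reach_reduced {lo hi : ℝ}
    (h : ∀ c, lo ≤ (G.reduced sw hα hπ y m).reach σ τ
        ((G.isExtension_reduced hα hπ y m).embed c G.initialState) ∧
      (G.reduced sw hα hπ y m).reach σ τ
        ((G.isExtension_reduced hα hπ y m).embed c G.initialState) ≤ hi) :
    (1 - passProb sw m) * (α * lo + (1 - α) * π) + passProb sw m * (if y then 1 else 0) ≤
        (G.reduced sw hα hπ y m).reach σ τ (G.reduced sw hα hπ y m).initialState ∧
      (G.reduced sw hα hπ y m).reach σ τ (G.reduced sw hα hπ y m).initialState ≤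
        (1 - passProb sw m) * (α * hi + (1 - α) * π) + passProb sw m * (if y then 1 else 0) := by
  set f : Fin (G.n + (m + 5)) → (G.reduced sw hα hπ y m).Position → ℝ :=
    fun v p => (G.reduced sw hα hπ y m).reach σ τ (v, p) with hf
  let g : ℕ → Fin (G.n + (m + 5)) := fun j =>
    if hj : j ≤ m then newVertex m (j + 4) (by omega) else newVertex m 4 (by omega)
  have hg : ∀ j (hj : j ≤ m), g j = newVertex m (j + 4) (by omega) := fun j hj => dif_pos hj
  -- The copy must be entered with its counters at zero, and the first j switches must be reset for
  -- the passing probability of level j to apply. Later switches are left free, because a return to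
  -- the start happens with the counter of the current one at one.
  let Z : ℕ → Set (G.reduced sw hα hπ y m).Position := fun j =>
    {p | ∀ v, (v.1 : ℕ) < G.n ∨ G.n + 4 ≤ (v.1 : ℕ) ∧ (v.1 : ℕ) < G.n + 4 + j → (p v : ℕ) = 0}
  have ha : ∀ p ∈ Z 0, α * lo + (1 - α) * π ≤ f (newVertex m 0 (by omega)) p ∧
      f (newVertex m 0 (by omega)) p ≤ α * hi + (1 - α) * π := by
    intro p hp
    simp only [hf]
    rw [reach_first, embed_initialState p fun v hv => hp v (.inl hv)]
    have hα' : (0 : ℝ) < α := by exact_mod_cast hα.1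
    exact ⟨by nlinarith [(h p).1], by nlinarith [(h p).2]⟩
  have h₀ : ∀ p, f (newVertex m 3 (by omega)) p =
      1 / 2 * f (newVertex m 0 (by omega)) p + 1 / 2 * f (g 0) p := by
    intro p
    rw [hg 0 (by omega)]
    exact reach_start σ τ p
  have hm : ∀ p, f (g m) p = if y then 1 else 0 := fun p => by
    rw [hg m le_rfl]
    exact reach_last σ τ p
  have hz : ∀ j, (G.reduced sw hα hπ y m).initialPosition ∈ Z j := fun j v _ => rfl
  rw [← hm (G.reduced sw hα hπ y m).initialPosition]
  cases sw
  · refine passProb_random f (Z 0) ha h₀ (fun j hj p => ?_) m le_rfl _ (hz 0)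
    rw [hg j hj.le, hg (j + 1) hj]
    simp only [hf]
    rw [reach_eq_stepExp]
    refine (stepExp_two σ τ (w := newVertex m 0 (by omega)) (w' := newVertex m (j + 1 + 4)
      (by omega)) rfl (reducedRow_chain hj) _ p).trans ?_
    norm_num
  · refine passProb_switching f Z (fun j p hp v hv => hp v ?_) ha h₀ (fun j hj p hp => ?_) m
      le_rfl _ (hz m)
    · omega
    · rw [hg j hj.le, hg (j + 1) hj]
      simp only [hf]
      obtain ⟨hk, hs⟩ := stepExp_sw σ τ (v := newVertex m (j + 4) (by omega))
        (w := newVertex m 3 (by omega)) (w' := newVertex m (j + 1 + 4) (by omega)) rfl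
        (reducedRow_chain hj) ((G.reduced true hα hπ y m).reach σ τ)
      obtain ⟨i, h₁, h₂, h₃⟩ := hs p (hp _ (.inr (by
        show G.n + 4 ≤ G.n + (j + 4) ∧ G.n + (j + 4) < G.n + 4 + (j + 1)
        omega)))
      refine ⟨_, fun v hv' => ?_, (reach_eq_stepExp _ _ _ _).trans h₂,
        (reach_eq_stepExp _ _ _ _).trans h₃⟩
      rw [Function.update_of_ne]
      · exact hp v (by omega)
      · rintro rfl
        have : G.n + (j + 4) < G.n ∨ G.n + 4 ≤ G.n + (j + 4) ∧ G.n + (j + 4) < G.n + 4 + j := hv'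
        omega

theorem reducedRow_kind_ne {κ : NodeKind} (h₁ : κ ≠ .random) (h₂ : κ ≠ .switching)
    (s t n j : ℕ) : (reducedRow sw α π y s t n m j).kind ≠ κ := by
  rcases Row.kind_cases (reducedRow sw α π y s t n m j) with h | h <;> rw [h]
  · exact h₁.symm
  · exact h₂.symm

variable (G sw hα hπ y m) in
-- Each player can secure the value of G in the copy for every value of the chain's counters. One
-- such strategy gives one bound on the probability from the copy's start; the opposite bound is
-- taken as 0 or 1 and not used.
theorem val_reduced : (G.reduced sw hα hπ y m).val =
    (1 - passProb sw m) * (α * G.val + (1 - α) * π) + passProb sw m * (if y then 1 else 0) := by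
  have hex : ∀ {κ : NodeKind}, κ ≠ .random → κ ≠ .switching →
      ∀ v : (G.reduced sw hα hπ y m).NodesOf κ,
        ∃ u, (G.isExtension_reduced hα hπ y m).node u = v := fun h₁ h₂ =>
    G.exists_node_extend _ _ _ fun j => reducedRow_kind_ne h₁ h₂ _ _ _ _
  refine le_antisymm ?_ ?_
  · refine val_le _ fun σ => ?_
    obtain ⟨τ, hτ⟩ := (G.isExtension_reduced hα hπ y m).exists_min_strategy
      (hex (by decide) (by decide)) σ
    exact ⟨τ, (reach_reduced σ τ fun c => ⟨reach_nonneg _ _ _ _, hτ c⟩).2⟩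
  · obtain ⟨σ, hσ⟩ := (G.isExtension_reduced hα hπ y m).exists_max_strategy
      (hex (by decide) (by decide))
    exact le_val _ (σ := σ) fun τ => (reach_reduced σ τ fun c => ⟨hσ τ c, reach_le_one _ _ _ _⟩).1

end Reduced

end ArrivalInstance

/-! ### The reductions -/

namespace ArrivalInstance

variable (G : ArrivalInstance)

theorem exists_val_den : ∃ d : ℕ, 0 < d ∧
    d ≤ (∏ v, 2 * G.commonDen v) ^ Fintype.card G.Position ∧ ∃ z : ℤ, (d : ℝ) * G.val = z := by
  obtain ⟨σ, τ, h⟩ := G.exists_strategies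
  rw [h]
  exact G.exists_reach_den σ τ _

variable {sw : Bool} {p : ℚ}

/-- The main term is 1/2 + (val - p)/2. If it is at least 1/2, the bonus ε lifts the value strictly
above 1/2. If val < p, then ε ≤ (p - val)/2 is too small to make up for the deficit. -/
theorem half_lt_val_reduced_iff (hsw : sw = false → ∀ v, G.kind v ≠ some .switching)
    (hα : (0 : ℚ) < 1 / 2 ∧ (1 : ℚ) / 2 < 1) (hπ : 0 < 1 - p ∧ 1 - p < 1) {c : ℕ}
    (hc : 2 * p.den ≤ 2 ^ c) :
    1 / 2 < (G.reduced sw hα hπ true (2 * G.encodeNodes.length + c)).val ↔ (p : ℝ) ≤ G.val := by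
  rw [val_reduced]
  obtain ⟨d, hd, hd', z, hz⟩ := G.exists_val_den
  have hε := passProb_pos sw (2 * G.encodeNodes.length + c)
  have hε' := G.passProb_le sw hsw c hd hd'
  generalize passProb sw (2 * G.encodeNodes.length + c) = ε at *
  have hv := G.val_nonneg
  have hp₁ : (p : ℝ) < 1 := by exact_mod_cast (by linarith [hπ.1] : p < 1)
  push_cast
  simp only [if_true]
  constructor
  · intro h
    by_contra! hlt
    have hd₀ : (0 : ℝ) < d := by exact_mod_cast hd
    have hq₀ : (0 : ℝ) < p.den := by exact_mod_cast p.den_pos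
    have hpd : (p : ℝ) * p.den = p.num := by exact_mod_cast p.mul_den_eq_num
    -- A positive integer, since d · val and den(p) · p are integers.
    have hgap : (1 : ℝ) ≤ d * p.den * (p - G.val) := by
      have h₁ : (d : ℝ) * p.den * (p - G.val) = ((d * p.num - p.den * z : ℤ) : ℝ) := by
        push_cast
        rw [← hz, ← hpd]
        ring
      have h₂ : (0 : ℝ) < d * p.den * (p - G.val) := by
        have := sub_pos.2 hlt
        positivity
      rw [h₁] at h₂ ⊢
      exact_mod_cast (by exact_mod_cast h₂ : (0 : ℤ) < d * p.num - p.den * z)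
    have hc' : (1 / 2 : ℝ) ^ c * (2 * p.den) ≤ 1 := by
      have : (2 * p.den : ℝ) ≤ 2 ^ c := by exact_mod_cast hc
      calc (1 / 2 : ℝ) ^ c * (2 * p.den) ≤ (1 / 2) ^ c * 2 ^ c := by gcongr
        _ = 1 := by rw [← mul_pow]; norm_num
    have hg : ε ≤ (p - G.val) / 2 := by
      refine hε'.trans ?_
      rw [div_le_iff₀ hd₀, ← mul_le_mul_iff_left₀ (by positivity : (0 : ℝ) < 2 * p.den)]
      linarith
    nlinarith
  · intro h
    have hε₁ : ε ≤ 1 := hε'.trans (by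
      rw [div_le_one (by exact_mod_cast hd)]
      refine (pow_le_one₀ (by norm_num) (by norm_num)).trans ?_
      exact_mod_cast hd)
    nlinarith

/-- The main term is p + α(val - 1/2). If val ≤ 1/2, the loss factor 1 - ε pushes the value strictly
below p, because p > 0. If val > 1/2, the loss is at most ε ≤ α(val - 1/2), the excess. -/
theorem le_val_reduced_iff (hsw : sw = false → ∀ v, G.kind v ≠ some .switching) {α π : ℚ}
    (hα : 0 < α ∧ α < 1) (hπ : 0 < π ∧ π < 1) (h : (1 - α) * π = p - α / 2)
    (hp : 0 < p ∧ p + α / 2 ≤ 1) {c : ℕ} (hc : (1 / 2) ^ c ≤ α / 2) :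
    (p : ℝ) ≤ (G.reduced sw hα hπ false (2 * G.encodeNodes.length + c)).val ↔ 1 / 2 < G.val := by
  rw [val_reduced]
  obtain ⟨d, hd, hd', z, hz⟩ := G.exists_val_den
  have hε := passProb_pos sw (2 * G.encodeNodes.length + c)
  have hε' := G.passProb_le sw hsw c hd hd'
  have hε₁ := passProb_le_one sw (2 * G.encodeNodes.length + c)
  generalize passProb sw (2 * G.encodeNodes.length + c) = ε at *
  have hv := G.val_nonneg
  have hv₁ := G.val_le_one
  have h' : (1 - α : ℝ) * π = p - α / 2 := by exact_mod_cast h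
  have hα₀ : (0 : ℝ) < α := by exact_mod_cast hα.1
  have hp₀ : (0 : ℝ) < p := by exact_mod_cast hp.1
  have hp₁ : (p : ℝ) + α / 2 ≤ 1 := by exact_mod_cast hp.2
  have hc' : (1 / 2 : ℝ) ^ c ≤ α / 2 := by
    have := (Rat.cast_le (K := ℝ)).2 hc
    push_cast at this
    exact this
  rw [h']
  simp only [Bool.false_eq_true, if_false, mul_zero, add_zero]
  constructor
  · intro hle
    by_contra! hlt
    have hw : α * G.val + (p - α / 2) ≤ p := by nlinarith
    linarith [mul_le_mul_of_nonneg_left hw (sub_nonneg.2 hε₁), mul_pos hε hp₀]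
  · intro hlt
    have hd₀ : (0 : ℝ) < d := by exact_mod_cast hd
    -- A positive integer; hence α(val - 1/2) ≥ (α/2)/d, which explains the condition on c.
    have hgap : (1 : ℝ) ≤ d * (2 * (G.val - 1 / 2)) := by
      have h₁ : (d : ℝ) * (2 * (G.val - 1 / 2)) = ((2 * z - d : ℤ) : ℝ) := by
        push_cast
        rw [← hz]
        ring
      have h₂ : (0 : ℝ) < d * (2 * (G.val - 1 / 2)) := by
        have := sub_pos.2 hlt
        positivity
      rw [h₁] at h₂ ⊢
      exact_mod_cast (by exact_mod_cast h₂ : (0 : ℤ) < 2 * z - d)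
    have hg : ε ≤ α * (G.val - 1 / 2) := by
      refine hε'.trans ?_
      rw [div_le_iff₀ hd₀]
      nlinarith
    have hw : α * G.val + (p - α / 2) ≤ 1 := by nlinarith
    linarith [mul_le_mul_of_nonneg_left hw hε.le]

end ArrivalInstance

/-- The reduced instance stays in the class of `B`-instances. -/
noncomputable def ArrivalInstanceOf.reduced {B : Set NodeKind} (hB : NodeKind.random ∈ B)
    {sw : Bool} (hsw : sw = true → .switching ∈ B) {α π : ℚ} (hα : 0 < α ∧ α < 1) (hπ : 0 < π ∧ π < 1)
    (y : Bool) (c : ℕ) (G : ArrivalInstanceOf B) : ArrivalInstanceOf B :=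
  ⟨G.1.reduced sw hα hπ y (2 * G.1.encodeNodes.length + c),
    G.1.extend_kind_mem _ _ _ G.2 fun _ => reducedRow_kind_mem hB hsw _ _ _ _ _ _ _ _⟩

theorem exists_two_pow_le {x : ℚ} (hx : 0 < x) : ∃ c : ℕ, (1 / 2) ^ c ≤ x := by
  obtain ⟨c, hc⟩ := exists_pow_lt_of_lt_one hx (by norm_num : (1 / 2 : ℚ) < 1)
  exact ⟨c, hc.le⟩

section

open StackProgram Computability

variable {B : Set NodeKind}

/-- The strong chain is available whenever it may be needed: if B forbids switching nodes, the given
instance has none either. -/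
theorem exists_chain_kind (B : Set NodeKind) : ∃ sw : Bool, (sw = true → NodeKind.switching ∈ B) ∧
    ∀ G : ArrivalInstanceOf B, sw = false → ∀ v, G.1.kind v ≠ some .switching := by
  by_cases h : NodeKind.switching ∈ B
  · exact ⟨true, fun _ => h, fun _ h' => nomatch h'⟩
  · exact ⟨false, fun h' => (nomatch h'), fun G _ v hv => h (G.2 v _ hv)⟩

theorem exists_weights {p : ℚ} (hp₀ : 0 < p) (hp₁ : p < 1) : ∃ α π : ℚ, (0 < α ∧ α < 1) ∧
    (0 < π ∧ π < 1) ∧ (1 - α) * π = p - α / 2 ∧ p + α / 2 ≤ 1 := by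
  have hα : p * (1 - p) < 1 := by nlinarith
  have h := sub_pos.2 hα
  -- The choice α = p(1 - p) is small compared with both p and 1 - p, so that π lies strictly
  -- between 0 and 1.
  refine ⟨p * (1 - p), (p - p * (1 - p) / 2) / (1 - p * (1 - p)),
    ⟨mul_pos hp₀ (sub_pos.2 hp₁), hα⟩, ⟨div_pos ?_ h, (div_lt_one h).2 ?_⟩,
    mul_div_cancel₀ _ h.ne', ?_⟩ <;> nlinarith

theorem arrivalQuantEqInput_reducible (hB : NodeKind.random ∈ B) :
    PolyTimeReducible (arrivalQuantEqInput B) (arrivalQuant B (1 / 2)) := by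
  obtain ⟨sw, hsw, hsw'⟩ := exists_chain_kind B
  have hα : (0 : ℚ) < 1 / 2 ∧ (1 : ℚ) / 2 < 1 := by norm_num
  have hπ : ∀ p : {p : ℚ // 0 < p ∧ p < 1}, 0 < 1 - p.1 ∧ 1 - p.1 < 1 := fun p =>
    ⟨by linarith [p.2.2], by linarith [p.2.1]⟩
  refine ⟨fun x => x.2.reduced hB hsw hα (hπ x.1) true
    ((encodeNat x.1.1.den).length + (encodeNat x.1.1.num.natAbs).length), ?_, fun x => ?_⟩
  · refine computable_encodeReduced_of_fraction sw (1 / 2) true fun x =>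
      ⟨x.2.1.s, x.2.1.t, x.2.1.encodeNodes, x.1, x.1.2.1, x.1.2.2, rfl, ?_⟩
    refine (x.2.1.encode_reduced [] sw hα (hπ x.1) true _).trans ?_
    rw [sub_sub_cancel]
  · refine Iff.symm (Iff.trans (Iff.of_eq ?_) (x.2.1.half_lt_val_reduced_iff (hsw' x.2) hα (hπ x.1)
      (c := (encodeNat x.1.1.den).length + (encodeNat x.1.1.num.natAbs).length) ?_))
    · simp [arrivalQuant, ArrivalInstanceOf.reduced]
    -- The digits of the denominator account for the factor den(p); the positive numerator has at
    -- least one digit, which accounts for the factor 2.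
    · have h₁ := bitsVal_lt (encodeNat x.1.1.den)
      have h₂ := bitsVal_lt (encodeNat x.1.1.num.natAbs)
      rw [bitsVal_encodeNat] at h₁ h₂
      have h₃ := Rat.num_pos.2 x.1.2.1
      rw [pow_add, mul_comm]
      exact Nat.mul_le_mul h₁.le (by omega)

theorem arrivalQuantEq_reducible (hB : NodeKind.random ∈ B) {p : ℚ} (hp₀ : 0 < p) (hp₁ : p < 1) :
    PolyTimeReducible (arrivalQuantEq B p) (arrivalQuant B (1 / 2)) := by
  obtain ⟨sw, hsw, hsw'⟩ := exists_chain_kind B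
  have hα : (0 : ℚ) < 1 / 2 ∧ (1 : ℚ) / 2 < 1 := by norm_num
  have hπ : 0 < 1 - p ∧ 1 - p < 1 := ⟨by linarith, by linarith⟩
  refine ⟨ArrivalInstanceOf.reduced hB hsw hα hπ true (2 * p.den), ?_, fun G => ?_⟩
  · exact computable_encodeReduced [] sw (1 / 2) (1 - p) true (2 * p.den) fun G =>
      ⟨G.1.s, G.1.t, G.1.encodeNodes, rfl, G.1.encode_reduced [] sw hα hπ true _⟩
  · refine Iff.symm ((Iff.of_eq ?_).trans
      (G.1.half_lt_val_reduced_iff (hsw' G) hα hπ Nat.lt_two_pow_self.le))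
    simp [arrivalQuant, ArrivalInstanceOf.reduced]

theorem reducible_arrivalQuantEq (hB : NodeKind.random ∈ B) {p : ℚ} (hp₀ : 0 < p) (hp₁ : p < 1) :
    PolyTimeReducible (arrivalQuant B (1 / 2)) (arrivalQuantEq B p) := by
  obtain ⟨sw, hsw, hsw'⟩ := exists_chain_kind B
  obtain ⟨α, π, hα, hπ, h, h'⟩ := exists_weights hp₀ hp₁
  obtain ⟨c, hc⟩ := exists_two_pow_le (half_pos hα.1)
  refine ⟨ArrivalInstanceOf.reduced hB hsw hα hπ false c, ?_, fun G => ?_⟩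
  · exact computable_encodeReduced [] sw α π false c fun G =>
      ⟨G.1.s, G.1.t, G.1.encodeNodes, rfl, G.1.encode_reduced [] sw hα hπ false _⟩
  · refine Iff.trans (Iff.of_eq ?_) (G.1.le_val_reduced_iff (hsw' G) hα hπ h ⟨hp₀, h'⟩ hc).symm
    simp [arrivalQuant]

theorem reducible_arrivalQuantEqInput (hB : NodeKind.random ∈ B) :
    PolyTimeReducible (arrivalQuant B (1 / 2)) (arrivalQuantEqInput B) := by
  obtain ⟨sw, hsw, hsw'⟩ := exists_chain_kind B
  have hp : (0 : ℚ) < 1 / 2 ∧ (1 : ℚ) / 2 < 1 := by norm_num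
  obtain ⟨α, π, hα, hπ, h, h'⟩ := exists_weights hp.1 hp.2
  obtain ⟨c, hc⟩ := exists_two_pow_le (half_pos hα.1)
  refine ⟨fun G => (⟨1 / 2, hp⟩, G.reduced hB hsw hα hπ false c), ?_, fun G => ?_⟩
  · exact computable_encodeReduced (encodeRat (1 / 2)) sw α π false c fun G =>
      ⟨G.1.s, G.1.t, G.1.encodeNodes, rfl, G.1.encode_reduced _ sw hα hπ false _⟩
  · refine Iff.trans (Iff.of_eq ?_) (G.1.le_val_reduced_iff (hsw' G) hα hπ h ⟨hp.1, h'⟩ hc).symm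
    simp [arrivalQuant]

end

theorem mainTheorem11 (B : Set NodeKind) (hB : NodeKind.random ∈ B) :
    PolyTimeEquivalent (arrivalQuantEqInput B) (arrivalQuant B (1 / 2)) ∧
      ∀ p : ℚ, 0 < p → p < 1 →
        PolyTimeEquivalent (arrivalQuantEq B p) (arrivalQuant B (1 / 2)) :=
  ⟨⟨arrivalQuantEqInput_reducible hB, reducible_arrivalQuantEqInput hB⟩, fun _ hp₀ hp₁ =>
    ⟨arrivalQuantEq_reducible hB hp₀ hp₁, reducible_arrivalQuantEq hB hp₀ hp₁⟩⟩
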